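/- **Soundness of the type-and-effect system of Proto-Quipper-R.** *Circuits and effects.* A strict symmetric premonoidal category is a category with a strictly associative and unital tensor $\otimes$ (unit $I$) on objects, functors $X\rtimes-$ and $-\ltimes X$ acting as $X\otimes-$ and $-\otimes X$ on objects and compatible with the strict associativity and unit laws (interchange is not required), and a natural symmetry with central components satisfying the hexagon law. A *circuit algebra* $\mathcal E$ is a strict symmetric premonoidal category whose hom-sets carry preorders $\lesssim$ for which composition, $X\rtimes-$ and $-\ltimes X$ are monotone. Let $\mathcal M$ be a strict symmetric premonoidal category (of circuits), $W$ a set of wire types, each interpreted as an object of $\mathcal M$, and $\alpha:\mathcal M\to\mathcal E$ an *abstraction*, i.e. a strict symmetric premonoidal functor. For $T,U\in\mathcal M$ and $e:\alpha T\to\alpha U$ put $\mathcal M^{\lesssim e}(T,U)=\{C\in\mathcal M(T,U)\mid\alpha(C)\lesssim e\}$ and $\mathcal T^{e}(X)=X\times\mathcal M^{\lesssim e}(T,U)$ for a set $X$. If $e\lesssim d$, there is an inclusion $\mathcal T^{e\lesssim d}:\mathcal T^eX\to\mathcal T^dX$. For a function $f:X\to Y$ and a circuit $C:T\to U$, $J(f,C):X\to\mathcal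 T^{\alpha(C)}Y$ is $x\mapsto(f(x),C)$. *Types and terms.* Here $w\in W$, and $e$ ranges over morphisms of $\mathcal E$. - Bundle types: $T,U::=\mathbb 1\mid w\mid T\otimes U$. - Types: $A,B::=\mathbb 1\mid\mathsf{Nat}\mid w\mid A\otimes B\mid A\multimap_T^{e}B\mid\,!^{e}A\mid\mathsf{Circ}^{e}(T,U)$. Parameter types are generated by $\mathbb 1,\mathsf{Nat},\otimes,!^eA,\mathsf{Circ}^e(T,U)$. - Values: $V::=*\mid n\mid\ell\mid x\mid\lambda x^A.M\mid\mathsf{lift}\,M\mid(\bar\ell,C,\bar k)\mid\langle V,V'\rangle$, where $\bar\ell,\bar k$ are wire bundles (built from $*$, labels and pairs) and $C:Q\to L$ is a morphism of $\mathcal M$ between the interpretations of label contexts $Q,L$ (lists of distinct labels with wire types). - Computations: $M::=V\,V'\mid\mathsf{force}\,V\mid\mathsf{box}_TV\mid\mathsf{apply}(V,V')\mid\mathsf{let}\,\langle x,y\rangle=V\,\mathsf{in}\,M\mid\mathsf{ifz}\,V\,M\,M'\mid\mathsf{return}\,V\mid\mathsf{let}\,x=M\,\mathsf{in}\,N$,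 up to renaming of bound variables. A type is interpreted by a set $\flat A$ and an object $\sharp A$ of $\mathcal M$. The set $\flat$ is a singleton for $\mathbb 1$ and $w$, is $\mathbb N$ for $\mathsf{Nat}$, and is the product for $\otimes$; $\sharp w$ is the given object, $\sharp(A\otimes B)=\sharp A\otimes\sharp B$, $\sharp(A\multimap_T^eB)=\sharp T$, and $\sharp=I$ otherwise. Moreover $\flat(A\multimap_T^eB)$ is the set of functions $\flat A\to\flat B\times\mathcal M^{\lesssim e}(\sharp T\otimes\sharp A,\sharp B)$, $\flat(!^eA)=\flat A\times\mathcal M^{\lesssim e}(I,\sharp A)$ and $\flat\,\mathsf{Circ}^e(T,U)=\mathcal M^{\lesssim e}(\sharp T,\sharp U)$. Annotations in types must have the corresponding domain and codomain under $\alpha$. Contexts $\Gamma$ are lists of typed labels and variables, interpreted componentwise; $\Phi$ denotes a context of variables of parameter type. *Typing of values* $\Gamma\vdash V:A$: - $\Phi\vdash *:\mathbb 1$; $\ \Phi\vdash n:\mathsf{Nat}$; $\ \Phi,\ell:w\vdash\ell:w$; $\ \Phi,x:A\vdash x:A$. - If $\Gamma,x:A\vdash M:B;e$ then $\Gamma\vdash\lambda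 x^A.M:A\multimap_{T}^eB$, where the list of wire types of $T$ is that of $\sharp\Gamma$. - If $\Phi\vdash M:A;e$ then $\Phi\vdash\mathsf{lift}\,M:\,!^eA$. - Let $C:Q\to L$, let $Q',L'$ be permutations of $Q,L$ with $Q'\vdash\bar\ell:T$ and $L'\vdash\bar k:U$, and let $[\![(\bar\ell,C,\bar k)]\!]:\sharp T\to\sharp U$ be $C$ composed with the permutation isomorphisms $Q'\cong Q$ and $L\cong L'$. If $\alpha([\![(\bar\ell,C,\bar k)]\!])\lesssim e$ then $\Phi\vdash(\bar\ell,C,\bar k):\mathsf{Circ}^e(T,U)$. - If $\Phi,\Gamma_1\vdash V:A$ and $\Phi,\Gamma_2\vdash V':B$ then $\Phi,\Gamma_1,\Gamma_2\vdash\langle V,V'\rangle:A\otimes B$. *Typing of computations* $\Gamma\vdash M:A;e$ (so that $e:\alpha(\sharp\Gamma)\to\alpha(\sharp A)$): - If $\Phi,\Gamma_1\vdash V:A\multimap_T^eB$ and $\Phi,\Gamma_2\vdash V':A$ then $\Phi,\Gamma_1,\Gamma_2\vdash V\,V':B;e$. - If $\Phi\vdash V:\,!^eA$ then $\Phi\vdash\mathsf{force}\,V:A;e$.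 - If $\Phi\vdash V:T\multimap_{\mathbb 1}^eU$ then $\Phi\vdash\mathsf{box}_TV:\mathsf{Circ}^e(T,U);\mathrm{id}_I$. - If $\Phi,\Gamma_1\vdash V:\mathsf{Circ}^e(T,U)$ and $\Phi,\Gamma_2\vdash V':T$ then $\Phi,\Gamma_1,\Gamma_2\vdash\mathsf{apply}(V,V'):U;e$. - If $\Phi,\Gamma_1\vdash V:A\otimes B$ and $\Phi,\Gamma_2,x:A,y:B\vdash M:A';e$ then $\Phi,\Gamma_2,\Gamma_1\vdash\mathsf{let}\,\langle x,y\rangle=V\,\mathsf{in}\,M:A';e$. - If $\Phi\vdash V:\mathsf{Nat}$ and $\Phi,\Gamma\vdash M:A;e$, $\ \Phi,\Gamma\vdash M':A;e$ then $\Phi,\Gamma\vdash\mathsf{ifz}\,V\,M\,M':A;e$. - If $\Gamma\vdash V:A$ then $\Gamma\vdash\mathsf{return}\,V:A;\mathrm{id}_{\alpha(\sharp A)}$. - If $\Phi,\Gamma_1\vdash M:A;e_1$ and $\Phi,\Gamma_2,x:A\vdash N:B;e_2$ then $\Phi,\Gamma_2,\Gamma_1\vdash\mathsf{let}\,x=M\,\mathsf{in}\,N:B;(\alpha(\sharp\Gamma_2)\rtimes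 e_1);e_2$. - (subsumption) If $\Gamma\vdash M:A;e_1$ and $e_1\lesssim e_2$ then $\Gamma\vdash M:A;e_2$. - (exchange) If $\Gamma_1,a:A,b:B,\Gamma_2\vdash M:A';e$ then $\Gamma_1,b:B,a:A,\Gamma_2\vdash M:A';\alpha(\mathbf{perm});e$, where $\mathbf{perm}$ is the symmetry exchanging $\sharp B$ and $\sharp A$. *Interpretation.* By induction on derivations, $\Gamma\vdash V:A$ is interpreted as a function $\flat\Gamma\to\flat A$ (one has $\sharp\Gamma=\sharp A$), and $\Gamma\vdash M:A;e$ as a function $[\![M]\!]:\flat\Gamma\to\flat A\times\mathcal M^{\lesssim e}(\sharp\Gamma,\sharp A)$. Values are interpreted in the evident way, abstractions and $\mathsf{lift}$ by currying, and a boxed circuit by $[\![(\bar\ell,C,\bar k)]\!]$. Application and $\mathsf{force}$ are function evaluation; $\mathsf{apply}$ returns the circuit denoted by its first argument; $\mathsf{box}$ returns the circuit part of the value of $V$ at the unique element of $\flat T$, together with the identity circuit; $\mathsf{return}$ adds an identity circuit; destructuring and $\mathsf{ifz}$ are as in sets. If $M$ yields $(a,C)$ and $N$, at $a$, yields $(b,D)$,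 then $\mathsf{let}\,x=M\,\mathsf{in}\,N$ yields $(b,(\sharp\Gamma_2\rtimes C);D)$. Subsumption is the inclusion, and exchange precomposes the circuit with $\mathbf{perm}$. *Configurations and evaluation.* A configuration is a pair $(C,M)$ of a circuit $C:Q\to R$ between label contexts and a computation. Evaluation $(C,M)\Downarrow(C',V)$ is the least relation such that: - $((\lambda x^A.M)\,V)$, $\mathsf{force}(\mathsf{lift}\,M)$, $\mathsf{let}\,\langle x,y\rangle=\langle V,V'\rangle\,\mathsf{in}\,M$, $\mathsf{ifz}\,0\,M\,M'$ and $\mathsf{ifz}\,(n+1)\,M\,M'$, run with $C$, evaluate as $M[V/x]$, $M$, $M[V/x,V'/y]$, $M$ and $M'$, respectively, run with $C$; - $(C,\mathsf{return}\,V)\Downarrow(C,V)$; - if $(C,M)\Downarrow(C',U)$ and $(C',N[U/x])\Downarrow(C'',V)$ then $(C,\mathsf{let}\,x=M\,\mathsf{in}\,N)\Downarrow(C'',V)$; - if $\bar\ell$ is a bundle of distinct labels with $Q\vdash\bar\ell:T$ and $(\mathrm{id}_Q,V\,\bar\ell)\Downarrow(D,\bar k)$ then $(C,\mathsf{box}_TV)\Downarrow(C,(\bar\ell,D,\bar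 k))$; - $(C,\mathsf{apply}((\bar\ell,D,\bar k),\bar\ell'))\Downarrow(C',\bar k')$, where $\bar\ell'$ is a renaming of $\bar\ell$, $\bar k'$ is a renaming of $\bar k$ to labels distinct from the remaining outputs, and $C'$ is $C$ followed by a permutation bringing the labels of the renamed inputs of $D$ to the front, and by $D\ltimes R$, where $R$ are the remaining outputs of $C$. The judgment $Q\vdash(C,M):A;Q';e$ means that $C$ is a circuit from $Q$ to label contexts $L,Q'$ (up to a permutation of the outputs) and that $L\vdash M:A;e$. Then $[\![(C,M)]\!]$ is the element $(a,\,C;(D\ltimes Q'))$ of $\flat A\times\mathcal M^{\lesssim e'}(Q,\sharp A\otimes Q')$, where $(a,D)$ is the value of $[\![M]\!]$ and $e'=\alpha(C);(e\ltimes\alpha(Q'))$. Similarly $Q\vdash(C',V):A;Q'$ means that the outputs of $C'$ are $L',Q'$ (up to a permutation) and $L'\vdash V:A$; then $[\![(C',V)]\!]$ is the pair of the element $[\![V]\!]\in\flat A$ and the morphism $C'$ (with this permutation) from $Q$ to $\sharp A\otimes Q'$. **Theorem.** Suppose that $Q\vdash(C,M):A;Q';e$ and $(C,M)\Downarrow(C',V)$.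 Then $Q\vdash(C',V):A;Q'$ and $[\![(C,M)]\!]=J([\![(C',V)]\!])$. Explicitly: for every derivation of the judgment for $(C,M)$ there is a derivation of the judgment for $(C',V)$ such that, writing $c$ for the morphism part of $[\![(C',V)]\!]$, one has $\alpha(c)\lesssim\alpha(C);(e\ltimes\alpha(Q'))$, and $[\![(C,M)]\!]$ is the image of $J([\![(C',V)]\!])$ under the inclusion $\mathcal T^{\alpha(c)\,\lesssim\,\alpha(C);(e\ltimes\alpha(Q'))}$. -/

import Mathlib

open CategoryTheory

universe v v' u u' w

namespace ProtoQuipperR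

/-! ### Strict symmetric premonoidal categories, circuit algebras, abstractions -/

/-- A strict symmetric premonoidal category.  `lw X f` is the functor `X ⋊ -` (wires `X` are added
on the left of `f`) and `rw f X` is the functor `- ⋉ X` (wires `X` are added on the right).
Strictness means that associators and unitors are identities; naturality of the
associator and of the unitors then amounts to the equations between whiskerings below.
Interchange of `lw` and `rw` is not assumed, except for the symmetry, which is central. -/
class StrictSymPremonoidal (C : Type u) [Category.{v} C] where
  tensor : C → C → C
  unit : C
  tensor_assoc : ∀ X Y Z : C, tensor (tensor X Y) Z = tensor X (tensor Y Z)
  unit_tensor : ∀ X : C, tensor unit X = X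
  tensor_unit : ∀ X : C, tensor X unit = X
  lw : ∀ (X : C) {Y Z : C}, (Y ⟶ Z) → (tensor X Y ⟶ tensor X Z)
  rw : ∀ {Y Z : C}, (Y ⟶ Z) → ∀ X : C, (tensor Y X ⟶ tensor Z X)
  lw_id : ∀ X Y : C, lw X (𝟙 Y) = 𝟙 (tensor X Y)
  lw_comp : ∀ (X : C) {Y Z W : C} (f : Y ⟶ Z) (g : Z ⟶ W), lw X (f ≫ g) = lw X f ≫ lw X g
  rw_id : ∀ X Y : C, rw (𝟙 Y) X = 𝟙 (tensor Y X)
  rw_comp : ∀ (X : C) {Y Z W : C} (f : Y ⟶ Z) (g : Z ⟶ W), rw (f ≫ g) X = rw f X ≫ rw g X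
  lw_tensor : ∀ (X X' : C) {Y Z : C} (f : Y ⟶ Z),
    lw (tensor X X') f =
      eqToHom (tensor_assoc X X' Y) ≫ lw X (lw X' f) ≫ eqToHom (tensor_assoc X X' Z).symm
  rw_tensor : ∀ {Y Z : C} (f : Y ⟶ Z) (X X' : C),
    rw f (tensor X X') =
      eqToHom (tensor_assoc Y X X').symm ≫ rw (rw f X) X' ≫ eqToHom (tensor_assoc Z X X')
  rw_lw : ∀ (X : C) {Y Z : C} (f : Y ⟶ Z) (X' : C),
    rw (lw X f) X' =
      eqToHom (tensor_assoc X Y X') ≫ lw X (rw f X') ≫ eqToHom (tensor_assoc X Z X').symm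
  lw_unit : ∀ {Y Z : C} (f : Y ⟶ Z),
    lw unit f = eqToHom (unit_tensor Y) ≫ f ≫ eqToHom (unit_tensor Z).symm
  rw_unit : ∀ {Y Z : C} (f : Y ⟶ Z),
    rw f unit = eqToHom (tensor_unit Y) ≫ f ≫ eqToHom (tensor_unit Z).symm
  braid : ∀ X Y : C, tensor X Y ⟶ tensor Y X
  braid_braid : ∀ X Y : C, braid X Y ≫ braid Y X = 𝟙 (tensor X Y)
  braid_natural : ∀ {Y Z : C} (f : Y ⟶ Z) (X : C),
    rw f X ≫ braid Z X = braid Y X ≫ lw X f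
  braid_tensor : ∀ X Y Z : C,
    braid X (tensor Y Z) =
      eqToHom (tensor_assoc X Y Z).symm ≫ rw (braid X Y) Z ≫ eqToHom (tensor_assoc Y X Z) ≫
        lw Y (braid X Z) ≫ eqToHom (tensor_assoc Y Z X).symm
  braid_central_left : ∀ (X Y : C) {A B : C} (g : A ⟶ B),
    rw (braid X Y) A ≫ lw (tensor Y X) g = lw (tensor X Y) g ≫ rw (braid X Y) B
  braid_central_right : ∀ (X Y : C) {A B : C} (g : A ⟶ B),
    lw A (braid X Y) ≫ rw g (tensor Y X) = rw g (tensor X Y) ≫ lw B (braid X Y)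

open StrictSymPremonoidal

infixr:70 " ⊗ₚ " => StrictSymPremonoidal.tensor

/-- A circuit algebra: a preorder-enriched strict symmetric premonoidal category. -/
class CircuitAlgebra (E : Type u) [Category.{v} E] extends StrictSymPremonoidal E where
  homPreorder : ∀ X Y : E, Preorder (X ⟶ Y)
  comp_mono : ∀ {X Y Z : E} {e₁ d₁ : X ⟶ Y} {e₂ d₂ : Y ⟶ Z},
    e₁ ≤ d₁ → e₂ ≤ d₂ → e₁ ≫ e₂ ≤ d₁ ≫ d₂
  lw_mono : ∀ (X : E) {Y Z : E} {e d : Y ⟶ Z}, e ≤ d → lw X e ≤ lw X d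
  rw_mono : ∀ {Y Z : E} {e d : Y ⟶ Z} (X : E), e ≤ d → rw e X ≤ rw d X

attribute [instance, reducible] CircuitAlgebra.homPreorder

/-- An abstraction: a strict symmetric premonoidal functor from circuits to a circuit algebra. -/
structure Abstraction (M : Type u) [Category.{v} M] [StrictSymPremonoidal M]
    (E : Type u') [Category.{v'} E] [CircuitAlgebra E] extends M ⥤ E where
  obj_unit : obj (StrictSymPremonoidal.unit : M) = StrictSymPremonoidal.unit
  obj_tensor : ∀ X Y : M, obj (X ⊗ₚ Y) = obj X ⊗ₚ obj Y
  map_lw : ∀ (X : M) {Y Z : M} (f : Y ⟶ Z),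
    map (lw X f) =
      eqToHom (obj_tensor X Y) ≫ lw (obj X) (map f) ≫ eqToHom (obj_tensor X Z).symm
  map_rw : ∀ {Y Z : M} (f : Y ⟶ Z) (X : M),
    map (rw f X) =
      eqToHom (obj_tensor Y X) ≫ rw (map f) (obj X) ≫ eqToHom (obj_tensor Z X).symm
  map_braid : ∀ X Y : M,
    map (braid X Y) =
      eqToHom (obj_tensor X Y) ≫ braid (obj X) (obj Y) ≫ eqToHom (obj_tensor Y X).symm

/-! ### Tensor products of lists and permutation isomorphisms -/

section Lists

variable {C : Type u} [Category.{v} C] [StrictSymPremonoidal C] {X : Type w} (f : X → C)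

/-- The tensor product of the objects attached to the entries of a list. -/
def listObj : List X → C
  | [] => StrictSymPremonoidal.unit
  | a :: l => f a ⊗ₚ listObj l

theorem listObj_append (l l' : List X) :
    listObj f (l ++ l') = listObj f l ⊗ₚ listObj f l' := by
  induction l with
  | nil => exact (unit_tensor _).symm
  | cons a l ih =>
    change f a ⊗ₚ listObj f (l ++ l') = (f a ⊗ₚ listObj f l) ⊗ₚ listObj f l'
    rw [ih, tensor_assoc]

/-- The symmetry exchanging two adjacent entries of a list. -/
def swapHom : (l : List X) → (a b : X) → (l' : List X) →
    (listObj f (l ++ a :: b :: l') ⟶ listObj f (l ++ b :: a :: l'))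
  | [], a, b, l' =>
    eqToHom (tensor_assoc (f a) (f b) (listObj f l')).symm ≫
      rw (braid (f a) (f b)) (listObj f l') ≫ eqToHom (tensor_assoc (f b) (f a) (listObj f l'))
  | c :: l, a, b, l' => lw (f c) (swapHom l a b l')

/-- `IsPerm f l l' p`: the list `l'` is a permutation of `l`, and `p` is a permutation isomorphism
from the tensor product of `l` to that of `l'`, i.e. a composite of symmetries
exchanging adjacent entries. -/
inductive IsPerm : (l l' : List X) → (listObj f l ⟶ listObj f l') → Prop
  | refl (l : List X) : IsPerm l l (𝟙 _)
  | swap (l : List X) (a b : X) (l' : List X) :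
      IsPerm (l ++ a :: b :: l') (l ++ b :: a :: l') (swapHom f l a b l')
  | trans {l₁ l₂ l₃ : List X} {p : listObj f l₁ ⟶ listObj f l₂}
      {q : listObj f l₂ ⟶ listObj f l₃} :
      IsPerm l₁ l₂ p → IsPerm l₂ l₃ q → IsPerm l₁ l₃ (p ≫ q)

end Lists

/-! ### Effect annotations and circuits bounded by an effect annotation -/

/-- An effect annotation `e : t ⟶ u`, i.e. a morphism of the circuit algebra together with
its domain and codomain. -/
structure Eff (E : Type u) [Category.{v} E] where
  dom : E
  cod : E
  hom : dom ⟶ cod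

section Bounded

variable {M : Type u} [Category.{v} M] [StrictSymPremonoidal M]
  {E : Type u'} [Category.{v'} E] [CircuitAlgebra E] (α : Abstraction M E)

/-- `Bounded α C e` says that `e` is an annotation `α X ⟶ α Y` and that `α(C) ≲ e`. -/
def Bounded {X Y : M} (C : X ⟶ Y) (e : Eff E) : Prop :=
  ∃ (h : α.obj X = e.dom) (h' : e.cod = α.obj Y), α.map C ≤ eqToHom h ≫ e.hom ≫ eqToHom h'

/-- The set of circuits `C : X ⟶ Y` with `α(C) ≲ e`. -/
def Circs (e : Eff E) (X Y : M) : Type v := {C : X ⟶ Y // Bounded α C e}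

/-- The action on objects of the category-graded circuit monad. -/
abbrev CircMonad (e : Eff E) (X Y : M) (S : Type v) : Type v := S × Circs α e X Y

/-- The preorder on effect annotations. -/
def Eff.Le (e d : Eff E) : Prop :=
  ∃ (h : e.dom = d.dom) (h' : d.cod = e.cod), e.hom ≤ eqToHom h ≫ d.hom ≫ eqToHom h'

variable {α}

/-- A circuit, bounded by its own abstraction. -/
def Circs.pure {X Y : M} (C : X ⟶ Y) : Circs α ⟨α.obj X, α.obj Y, α.map C⟩ X Y :=
  ⟨C, rfl, rfl, by simp⟩

/-- Transport of a bounded circuit along equalities of objects. -/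
def Circs.cast {e : Eff E} {X X' Y Y' : M} (hX : X' = X) (hY : Y = Y') (C : Circs α e X Y) :
    Circs α e X' Y' :=
  ⟨eqToHom hX ≫ C.1 ≫ eqToHom hY, by subst hX hY; simpa using C.2⟩

/-- The identity circuit. -/
def Circs.id (X : M) : Circs α ⟨α.obj X, α.obj X, 𝟙 _⟩ X X := ⟨𝟙 X, rfl, rfl, by simp⟩

/-- The identity circuit of the monoidal unit, bounded by the null effect. -/
def Circs.idUnit : Circs α ⟨StrictSymPremonoidal.unit, StrictSymPremonoidal.unit, 𝟙 _⟩
    StrictSymPremonoidal.unit StrictSymPremonoidal.unit :=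
  ⟨𝟙 _, α.obj_unit, α.obj_unit.symm, by simp⟩

/-- Sequential composition of bounded circuits. -/
def Circs.comp {e d : Eff E} {X Y Z : M} (C : Circs α e X Y) (D : Circs α d Y Z)
    (h : e.cod = d.dom) : Circs α ⟨e.dom, d.cod, e.hom ≫ eqToHom h ≫ d.hom⟩ X Z :=
  ⟨C.1 ≫ D.1, by
    obtain ⟨C, hX, hY, hC⟩ := C
    obtain ⟨D, hY', hZ, hD⟩ := D
    obtain ⟨a, b, e⟩ := e
    obtain ⟨a', b', d⟩ := d
    dsimp only at hX hY hC hY' hZ hD h ⊢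
    subst hX hY hZ h
    refine ⟨rfl, rfl, ?_⟩
    rw [α.map_comp]
    simpa using CircuitAlgebra.comp_mono hC hD⟩

/-- Adding wires on the left of a bounded circuit. -/
def Circs.lwhisk {e : Eff E} {X Y : M} (Z : M) (C : Circs α e X Y) :
    Circs α ⟨α.obj Z ⊗ₚ e.dom, α.obj Z ⊗ₚ e.cod, lw (α.obj Z) e.hom⟩ (Z ⊗ₚ X) (Z ⊗ₚ Y) :=
  ⟨lw Z C.1, by
    obtain ⟨C, hX, hY, hC⟩ := C
    obtain ⟨a, b, e⟩ := e
    dsimp only at hX hY hC ⊢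
    subst hX hY
    refine ⟨α.obj_tensor _ _, (α.obj_tensor _ _).symm, ?_⟩
    rw [α.map_lw]
    refine CircuitAlgebra.comp_mono le_rfl (CircuitAlgebra.comp_mono ?_ le_rfl)
    exact CircuitAlgebra.lw_mono _ (by simpa using hC)⟩

/-- Adding wires on the right of a bounded circuit. -/
def Circs.rwhisk {e : Eff E} {X Y : M} (C : Circs α e X Y) (Z : M) :
    Circs α ⟨e.dom ⊗ₚ α.obj Z, e.cod ⊗ₚ α.obj Z, rw e.hom (α.obj Z)⟩ (X ⊗ₚ Z) (Y ⊗ₚ Z) :=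
  ⟨rw C.1 Z, by
    obtain ⟨C, hX, hY, hC⟩ := C
    obtain ⟨a, b, e⟩ := e
    dsimp only at hX hY hC ⊢
    subst hX hY
    refine ⟨α.obj_tensor _ _, (α.obj_tensor _ _).symm, ?_⟩
    rw [α.map_rw]
    refine CircuitAlgebra.comp_mono le_rfl (CircuitAlgebra.comp_mono ?_ le_rfl)
    exact CircuitAlgebra.rw_mono _ (by simpa using hC)⟩

/-- The inclusion of the circuits bounded by `e` into those bounded by `d`, where `e ≲ d`. -/
def Circs.incl {e d : Eff E} {X Y : M} (h : e.Le d) (C : Circs α e X Y) : Circs α d X Y :=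
  ⟨C.1, by
    obtain ⟨C, hX, hY, hC⟩ := C
    obtain ⟨a, b, e⟩ := e
    obtain ⟨a', b', d⟩ := d
    obtain ⟨h, h', hed⟩ := h
    dsimp only at hX hY hC h h' hed ⊢
    subst h h'
    exact ⟨hX, hY, hC.trans (CircuitAlgebra.comp_mono le_rfl
      (CircuitAlgebra.comp_mono (by simpa using hed) le_rfl))⟩⟩

/-- The map `T^{e ≲ d}` of the category-graded circuit monad. -/
def CircMonad.incl {e d : Eff E} {X Y : M} {S : Type v} (h : e.Le d)
    (r : CircMonad α e X Y S) : CircMonad α d X Y S := (r.1, r.2.incl h)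

/-- The map `J`, sending a function and a circuit to a computation that builds this circuit. -/
def J {S S' : Type v} {X Y : M} (f : S → S') (C : X ⟶ Y) :
    S → CircMonad α ⟨α.obj X, α.obj Y, α.map C⟩ X Y S' := fun x => (f x, Circs.pure C)

end Bounded

/-! ### Types -/

/-- Bundle types. -/
inductive Bundle (W : Type w) : Type w
  | unit : Bundle W
  | wire : W → Bundle W
  | tensor : Bundle W → Bundle W → Bundle W

/-- The list of wire types of a bundle type; two bundle types have the same list iff they are
equal up to the strict associativity and unit laws. -/
def Bundle.wires {W : Type w} : Bundle W → List W
  | .unit => []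
  | .wire a => [a]
  | .tensor T U => T.wires ++ U.wires

/-- Types.  The type `arrow A B T e` is the type of closures from `A` to `B` that capture wires
of bundle type `T` and build a circuit of effect `e`; `bang A e` is the type of thunks,
and `circ T U e` that of boxed circuits. -/
inductive Ty (W : Type w) (E : Type u') [Category.{v'} E] : Type (max w u' v')
  | unit : Ty W E
  | nat : Ty W E
  | wire : W → Ty W E
  | tensor : Ty W E → Ty W E → Ty W E
  | arrow : Ty W E → Ty W E → Bundle W → Eff E → Ty W E
  | bang : Ty W E → Eff E → Ty W E
  | circ : Bundle W → Bundle W → Eff E → Ty W E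

section Types

variable {W : Type w} {E : Type u'} [Category.{v'} E]

/-- Every bundle type is a type. -/
def Bundle.toTy : Bundle W → Ty W E
  | .unit => .unit
  | .wire a => .wire a
  | .tensor T U => .tensor T.toTy U.toTy

/-- Parameter types. -/
def Ty.IsParam : Ty W E → Prop
  | .unit => True
  | .nat => True
  | .wire _ => False
  | .tensor A B => A.IsParam ∧ B.IsParam
  | .arrow _ _ _ _ => False
  | .bang _ _ => True
  | .circ _ _ _ => True

/-- The list of wire types of the circuit part of a type. -/
def Ty.wires : Ty W E → List W
  | .unit => []
  | .nat => []
  | .wire a => [a]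
  | .tensor A B => A.wires ++ B.wires
  | .arrow _ _ T _ => T.wires
  | .bang _ _ => []
  | .circ _ _ _ => []

variable {M : Type u} [Category.{v} M] [StrictSymPremonoidal M] (ob : W → M)

/-- The interpretation of a bundle type as an object of the category of circuits. -/
def Bundle.obj : Bundle W → M
  | .unit => StrictSymPremonoidal.unit
  | .wire a => ob a
  | .tensor T U => T.obj ⊗ₚ U.obj

/-- The circuit part `♯⟦A⟧` of the interpretation of a type. -/
def Ty.obj : Ty W E → M
  | .unit => StrictSymPremonoidal.unit
  | .nat => StrictSymPremonoidal.unit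
  | .wire a => ob a
  | .tensor A B => A.obj ⊗ₚ B.obj
  | .arrow _ _ T _ => T.obj ob
  | .bang _ _ => StrictSymPremonoidal.unit
  | .circ _ _ _ => StrictSymPremonoidal.unit

theorem Bundle.toTy_obj (T : Bundle W) : (T.toTy : Ty W E).obj ob = T.obj ob := by
  induction T with
  | unit => rfl
  | wire a => rfl
  | tensor T U ihT ihU => simp only [Bundle.toTy, Ty.obj, Bundle.obj, ihT, ihU]

theorem Bundle.obj_eq (T : Bundle W) : T.obj ob = listObj ob T.wires := by
  induction T with
  | unit => rfl
  | wire a => exact (tensor_unit _).symm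
  | tensor T U ihT ihU => simp only [Bundle.obj, Bundle.wires, listObj_append, ihT, ihU]

theorem Ty.obj_eq (A : Ty W E) : A.obj ob = listObj ob A.wires := by
  induction A with
  | wire a => exact (tensor_unit _).symm
  | tensor A B ihA ihB => simp only [Ty.obj, Ty.wires, listObj_append, ihA, ihB]
  | arrow A B T e _ _ => exact T.obj_eq ob
  | _ => rfl

theorem Ty.IsParam.obj_eq {A : Ty W E} (h : A.IsParam) :
    A.obj ob = StrictSymPremonoidal.unit := by
  induction A with
  | wire a => exact h.elim
  | tensor A B ihA ihB => simp only [Ty.obj, ihA h.1, ihB h.2, unit_tensor]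
  | arrow A B T e _ _ => exact h.elim
  | _ => rfl

end Types

section TypeSemantics

variable {W : Type w} {E : Type u'} [Category.{v'} E] [CircuitAlgebra E]
  {M : Type u} [Category.{v} M] [StrictSymPremonoidal M] (ob : W → M) (α : Abstraction M E)

/-- A type is well formed if its effect annotations go between the abstractions of the
interfaces of the circuits that they annotate. -/
def Ty.WF : Ty W E → Prop
  | .unit => True
  | .nat => True
  | .wire _ => True
  | .tensor A B => A.WF ∧ B.WF
  | .arrow A B T e =>
    A.WF ∧ B.WF ∧ e.dom = α.obj (T.obj ob ⊗ₚ A.obj ob) ∧ e.cod = α.obj (B.obj ob)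
  | .bang A e =>
    A.WF ∧ e.dom = α.obj StrictSymPremonoidal.unit ∧ e.cod = α.obj (A.obj ob)
  | .circ T U e => e.dom = α.obj (T.obj ob) ∧ e.cod = α.obj (U.obj ob)

/-- The parametric part `♭⟦A⟧` of the interpretation of a type. -/
def Ty.flat : Ty W E → Type v
  | .unit => PUnit
  | .nat => ULift ℕ
  | .wire _ => PUnit
  | .tensor A B => A.flat × B.flat
  | .arrow A B T e => A.flat → CircMonad α e (T.obj ob ⊗ₚ A.obj ob) (B.obj ob) B.flat
  | .bang A e => PUnit.{v + 1} → CircMonad α e StrictSymPremonoidal.unit (A.obj ob) A.flat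
  | .circ T U e => Circs α e (T.obj ob) (U.obj ob)

/-- The only element of the parametric part of a bundle type. -/
def Bundle.pt : (T : Bundle W) → (T.toTy : Ty W E).flat ob α
  | .unit => PUnit.unit
  | .wire _ => PUnit.unit
  | .tensor T U => (T.pt, U.pt)

end TypeSemantics

/-! ### Labelled circuits -/

/-- Label contexts: lists of labels (natural numbers) with their wire types. -/
abbrev LabCtx (W : Type w) : Type w := List (ℕ × W)

/-- The labels of a label context are pairwise distinct. -/
def LabCtx.Distinct {W : Type w} (Q : LabCtx W) : Prop := (Q.map Prod.fst).Nodup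

/-- Renaming of labels. -/
def LabCtx.relabel {W : Type w} (ρ : ℕ → ℕ) (Q : LabCtx W) : LabCtx W :=
  Q.map fun a => (ρ a.1, a.2)

section LabelledCircuits

variable {W : Type w} {M : Type u} [Category.{v} M] [StrictSymPremonoidal M] (ob : W → M)

/-- The object of the category of circuits that interprets a label context. -/
abbrev LabCtx.obj (Q : LabCtx W) : M := listObj (fun a : ℕ × W => ob a.2) Q

theorem LabCtx.relabel_obj (ρ : ℕ → ℕ) (Q : LabCtx W) : (Q.relabel ρ).obj ob = Q.obj ob := by
  induction Q with
  | nil => rfl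
  | cons a Q ih =>
    change ob a.2 ⊗ₚ LabCtx.obj ob (LabCtx.relabel ρ Q) = ob a.2 ⊗ₚ LabCtx.obj ob Q
    rw [ih]

/-- A labelled circuit `C : dom → cod` between label contexts. -/
structure LCirc where
  dom : LabCtx W
  cod : LabCtx W
  hom : dom.obj ob ⟶ cod.obj ob
  dom_distinct : dom.Distinct
  cod_distinct : cod.Distinct

/-- The identity circuit on a label context. -/
def LCirc.id (Q : LabCtx W) (hQ : Q.Distinct) : LCirc ob := ⟨Q, Q, 𝟙 _, hQ, hQ⟩

/-- The circuit obtained by appending the circuit `D`, with inputs renamed by `ρ` and outputs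
renamed by `σ`, to the outputs of `C`; the remaining outputs `R` of `C` are left alone,
and `p` brings the outputs of `C` in the required order. -/
def LCirc.append (C D : LCirc ob) (ρ σ : ℕ → ℕ) (R : LabCtx W)
    (p : C.cod.obj ob ⟶ LabCtx.obj ob (D.dom.relabel ρ ++ R))
    (h : LabCtx.Distinct (D.cod.relabel σ ++ R)) : LCirc ob where
  dom := C.dom
  cod := D.cod.relabel σ ++ R
  hom := C.hom ≫ p ≫
    eqToHom ((listObj_append _ _ _).trans
      (congrArg (· ⊗ₚ LabCtx.obj ob R) (D.dom.relabel_obj ob ρ))) ≫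
    rw D.hom (LabCtx.obj ob R) ≫
    eqToHom ((listObj_append _ _ _).trans
      (congrArg (· ⊗ₚ LabCtx.obj ob R) (D.cod.relabel_obj ob σ))).symm
  dom_distinct := C.dom_distinct
  cod_distinct := h

end LabelledCircuits

/-! ### Terms

Terms are in locally nameless style: bound variables are de Bruijn indices and free variables are
names, so that α-equivalent terms are equal. -/

/-- Wire bundles. -/
inductive WBundle : Type
  | unit : WBundle
  | lab : ℕ → WBundle
  | pair : WBundle → WBundle → WBundle

/-- Renaming of the labels of a wire bundle. -/
def WBundle.relabel (ρ : ℕ → ℕ) : WBundle → WBundle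
  | .unit => .unit
  | .lab l => .lab (ρ l)
  | .pair b c => .pair (b.relabel ρ) (c.relabel ρ)

/-- The judgment `Q ⊢ b : T` for wire bundles: the labels of `b`, in the order in which they
occur, form `Q`. -/
inductive WBundle.HasType {W : Type w} : LabCtx W → WBundle → Bundle W → Prop
  | unit : HasType [] .unit .unit
  | lab (l : ℕ) (a : W) : HasType [(l, a)] (.lab l) (.wire a)
  | pair {Q Q' : LabCtx W} {b c : WBundle} {T U : Bundle W} :
      HasType Q b T → HasType Q' c U → HasType (Q ++ Q') (.pair b c) (.tensor T U)

theorem WBundle.HasType.obj_eq {W : Type w} {M : Type u} [Category.{v} M]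
    [StrictSymPremonoidal M] (ob : W → M) {Q : LabCtx W} {b : WBundle} {T : Bundle W}
    (h : WBundle.HasType Q b T) : T.obj ob = Q.obj ob := by
  induction h with
  | unit => rfl
  | lab l a => exact (tensor_unit _).symm
  | pair _ _ ih ih' => simp only [Bundle.obj, LabCtx.obj, listObj_append, ih, ih']

section Terms

variable {W : Type w} {M : Type u} [Category.{v} M] [StrictSymPremonoidal M] (ob : W → M)
  (E : Type u') [Category.{v'} E]

mutual

/-- Values. -/
inductive Val : Type (max w u v u' v')
  | unit : Val
  | nat : ℕ → Val
  | lab : ℕ → Val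
  | bvar : ℕ → Val
  | fvar : ℕ → Val
  | lam : Ty W E → Tm → Val
  | lift : Tm → Val
  | boxed : WBundle → LCirc ob → WBundle → Val
  | pair : Val → Val → Val

/-- Computations.  `lett M N` is `let x = M in N`, binding index `0` in `N`, and `dest V M` is
`let (x, y) = V in M`, binding `x` as index `1` and `y` as index `0` in `M`. -/
inductive Tm : Type (max w u v u' v')
  | app : Val → Val → Tm
  | force : Val → Tm
  | box : Bundle W → Val → Tm
  | apply : Val → Val → Tm
  | dest : Val → Tm → Tm
  | ifz : Val → Tm → Tm → Tm
  | ret : Val → Tm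
  | lett : Tm → Tm → Tm

end

variable {ob E}

/-- Every wire bundle is a value. -/
def WBundle.toVal : WBundle → Val ob E
  | .unit => .unit
  | .lab l => .lab l
  | .pair b c => .pair b.toVal c.toVal

mutual

/-- Replacement of the bound variable with index `k` by a value without loose indices. -/
def Val.inst (k : ℕ) (U : Val ob E) : Val ob E → Val ob E
  | .unit => .unit
  | .nat n => .nat n
  | .lab l => .lab l
  | .bvar i => if i = k then U else .bvar i
  | .fvar x => .fvar x
  | .lam A N => .lam A (Tm.inst (k + 1) U N)
  | .lift N => .lift (Tm.inst k U N)
  | .boxed b C c => .boxed b C c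
  | .pair V V' => .pair (Val.inst k U V) (Val.inst k U V')

/-- Replacement of the bound variable with index `k` by a value without loose indices. -/
def Tm.inst (k : ℕ) (U : Val ob E) : Tm ob E → Tm ob E
  | .app V V' => .app (Val.inst k U V) (Val.inst k U V')
  | .force V => .force (Val.inst k U V)
  | .box T V => .box T (Val.inst k U V)
  | .apply V V' => .apply (Val.inst k U V) (Val.inst k U V')
  | .dest V N => .dest (Val.inst k U V) (Tm.inst (k + 2) U N)
  | .ifz V N N' => .ifz (Val.inst k U V) (Tm.inst k U N) (Tm.inst k U N')
  | .ret V => .ret (Val.inst k U V)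
  | .lett N N' => .lett (Tm.inst k U N) (Tm.inst (k + 1) U N')

end

mutual

/-- The free variables of a value. -/
def Val.fv : Val ob E → Set ℕ
  | .unit => ∅
  | .nat _ => ∅
  | .lab _ => ∅
  | .bvar _ => ∅
  | .fvar x => {x}
  | .lam _ N => Tm.fv N
  | .lift N => Tm.fv N
  | .boxed _ _ _ => ∅
  | .pair V V' => Val.fv V ∪ Val.fv V'

/-- The free variables of a computation. -/
def Tm.fv : Tm ob E → Set ℕ
  | .app V V' => Val.fv V ∪ Val.fv V'
  | .force V => Val.fv V
  | .box _ V => Val.fv V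
  | .apply V V' => Val.fv V ∪ Val.fv V'
  | .dest V N => Val.fv V ∪ Tm.fv N
  | .ifz V N N' => Val.fv V ∪ Tm.fv N ∪ Tm.fv N'
  | .ret V => Val.fv V
  | .lett N N' => Tm.fv N ∪ Tm.fv N'

end

/-! ### Operational semantics -/

/-- The big-step evaluation relation `(C, N) ⇓ (C', V)` on configurations. -/
inductive Eval : LCirc ob → Tm ob E → LCirc ob → Val ob E → Prop
  | app {C C' : LCirc ob} {A : Ty W E} {N : Tm ob E} {U V : Val ob E} :
      Eval C (N.inst 0 U) C' V → Eval C (.app (.lam A N) U) C' V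
  | force {C C' : LCirc ob} {N : Tm ob E} {V : Val ob E} :
      Eval C N C' V → Eval C (.force (.lift N)) C' V
  | dest {C C' : LCirc ob} {N : Tm ob E} {U U' V : Val ob E} :
      Eval C ((N.inst 1 U).inst 0 U') C' V → Eval C (.dest (.pair U U') N) C' V
  | ifz_zero {C C' : LCirc ob} {N N' : Tm ob E} {V : Val ob E} :
      Eval C N C' V → Eval C (.ifz (.nat 0) N N') C' V
  | ifz_succ {C C' : LCirc ob} {n : ℕ} {N N' : Tm ob E} {V : Val ob E} :
      Eval C N' C' V → Eval C (.ifz (.nat (n + 1)) N N') C' V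
  | ret {C : LCirc ob} {V : Val ob E} : Eval C (.ret V) C V
  | lett {C C' C'' : LCirc ob} {N N' : Tm ob E} {U V : Val ob E} :
      Eval C N C' U → Eval C' (N'.inst 0 U) C'' V → Eval C (.lett N N') C'' V
  /-- The boxed circuit is run on fresh labels. -/
  | box {C D : LCirc ob} {T : Bundle W} {V : Val ob E} {Q : LabCtx W} {b c : WBundle}
      (hQ : Q.Distinct) :
      WBundle.HasType Q b T →
      Eval (LCirc.id ob Q hQ) (.app V b.toVal) D c.toVal →
      Eval C (.box T V) C (.boxed b D c)
  /-- The inputs of the boxed circuit are renamed to the labels of the argument, and its outputs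
  are renamed to labels that are distinct from the remaining outputs of `C`. -/
  | apply {C D : LCirc ob} {b c : WBundle} (ρ σ : ℕ → ℕ) (R : LabCtx W)
      (p : C.cod.obj ob ⟶ LabCtx.obj ob (D.dom.relabel ρ ++ R))
      (h : LabCtx.Distinct (D.cod.relabel σ ++ R)) :
      IsPerm (fun a : ℕ × W => ob a.2) C.cod (D.dom.relabel ρ ++ R) p →
      Eval C (.apply (.boxed b D c) (b.relabel ρ).toVal)
        (LCirc.append ob C D ρ σ R p h) (c.relabel σ).toVal

end Terms

/-! ### Typing contexts -/

/-- The entries of typing contexts: labels with a wire type, or variables with a type. -/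
inductive Entry (W : Type w) (E : Type u') [Category.{v'} E] : Type (max w u' v')
  | lab : ℕ → W → Entry W E
  | var : ℕ → Ty W E → Entry W E

/-- Typing contexts. -/
abbrev Ctx (W : Type w) (E : Type u') [Category.{v'} E] : Type (max w u' v') := List (Entry W E)

section Contexts

variable {W : Type w} {E : Type u'} [Category.{v'} E]

/-- The type of an entry. -/
def Entry.ty : Entry W E → Ty W E
  | .lab _ a => .wire a
  | .var _ A => A

/-- A parameter context consists of variables of parameter type. -/
def Ctx.IsParam (Γ : Ctx W E) : Prop := ∀ a ∈ Γ, ∃ x A, a = Entry.var x A ∧ A.IsParam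

/-- The variable `x` is not declared in the context. -/
def Ctx.Fresh (x : ℕ) (Γ : Ctx W E) : Prop := ∀ A, Entry.var x A ∉ Γ

/-- The list of wire types of the circuit part of a context. -/
def Ctx.wires : Ctx W E → List W
  | [] => []
  | a :: Γ => a.ty.wires ++ Ctx.wires Γ

/-- A label context as a typing context. -/
def LabCtx.toCtx (Q : LabCtx W) : Ctx W E := Q.map fun a => Entry.lab a.1 a.2

variable {M : Type u} [Category.{v} M] [StrictSymPremonoidal M] (ob : W → M)

/-- The circuit part `♯⟦Γ⟧` of the interpretation of a context. -/
abbrev Ctx.obj (Γ : Ctx W E) : M := listObj (fun a : Entry W E => a.ty.obj ob) Γ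

theorem LabCtx.toCtx_obj (Q : LabCtx W) : (Q.toCtx : Ctx W E).obj ob = Q.obj ob := by
  induction Q with
  | nil => rfl
  | cons a Q ih =>
    change ob a.2 ⊗ₚ Ctx.obj ob (LabCtx.toCtx Q : Ctx W E) = ob a.2 ⊗ₚ LabCtx.obj ob Q
    rw [ih]

theorem Ctx.obj_eq (Γ : Ctx W E) : Γ.obj ob = listObj ob Γ.wires := by
  induction Γ with
  | nil => rfl
  | cons a Γ ih =>
    change a.ty.obj ob ⊗ₚ Ctx.obj ob Γ = listObj ob (a.ty.wires ++ Ctx.wires Γ)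
    rw [listObj_append, ih, Ty.obj_eq]

theorem Ctx.obj_append (Γ Δ : Ctx W E) : Ctx.obj ob (Γ ++ Δ) = Γ.obj ob ⊗ₚ Δ.obj ob :=
  listObj_append _ _ _

theorem Ctx.obj_single (a : Entry W E) : Ctx.obj ob [a] = a.ty.obj ob := tensor_unit _

theorem Ctx.IsParam.obj_eq {Φ : Ctx W E} (h : Φ.IsParam) :
    Φ.obj ob = StrictSymPremonoidal.unit := by
  induction Φ with
  | nil => rfl
  | cons a Φ ih =>
    obtain ⟨x, A, rfl, hA⟩ := h a (by simp)
    have h' := ih fun b hb => h b (by simp [hb])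
    change A.obj ob ⊗ₚ Ctx.obj ob Φ = _
    rw [h', hA.obj_eq, tensor_unit]

theorem Ctx.IsParam.append_obj {Φ : Ctx W E} (h : Φ.IsParam) (Γ : Ctx W E) :
    Ctx.obj ob (Φ ++ Γ) = Γ.obj ob := by
  rw [Ctx.obj_append, h.obj_eq, unit_tensor]

end Contexts

section Environments

variable {W : Type w} {E : Type u'} [Category.{v'} E] [CircuitAlgebra E]
  {M : Type u} [Category.{v} M] [StrictSymPremonoidal M] (ob : W → M) (α : Abstraction M E)

/-- The parametric part `♭⟦Γ⟧` of the interpretation of a context. -/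
def Ctx.flat : Ctx W E → Type v
  | [] => PUnit
  | a :: Γ => a.ty.flat ob α × Ctx.flat Γ

variable {ob α}

/-- The isomorphism `♭⟦Γ⟧ × ♭⟦Δ⟧ ≅ ♭⟦Γ, Δ⟧`. -/
def Ctx.join : {Γ Δ : Ctx W E} → Γ.flat ob α → Δ.flat ob α → Ctx.flat ob α (Γ ++ Δ)
  | [], _, _, d => d
  | _ :: _, _, g, d => (g.1, Ctx.join g.2 d)

/-- The inverse isomorphism `♭⟦Γ, Δ⟧ ≅ ♭⟦Γ⟧ × ♭⟦Δ⟧`. -/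
def Ctx.split : (Γ : Ctx W E) → {Δ : Ctx W E} → Ctx.flat ob α (Γ ++ Δ) →
    Γ.flat ob α × Δ.flat ob α
  | [], _, g => (PUnit.unit, g)
  | _ :: Γ, _, g => ((g.1, (Ctx.split Γ g.2).1), (Ctx.split Γ g.2).2)

/-- The exchange of two adjacent entries of an environment. -/
def Ctx.swapFlat : (Γ : Ctx W E) → {a b : Entry W E} → {Δ : Ctx W E} →
    Ctx.flat ob α (Γ ++ a :: b :: Δ) → Ctx.flat ob α (Γ ++ b :: a :: Δ)
  | [], _, _, _, g => (g.2.1, g.1, g.2.2)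
  | _ :: Γ, _, _, _, g => (g.1, Ctx.swapFlat Γ g.2)

/-- The only element of the parametric part of a label context. -/
def LabCtx.pt : (Q : LabCtx W) → Ctx.flat ob α (Q.toCtx : Ctx W E)
  | [] => PUnit.unit
  | _ :: Q => (PUnit.unit, LabCtx.pt Q)

end Environments

/-! ### The type-and-effect system -/

section Typing

variable {W : Type w} {E : Type u'} [Category.{v'} E] [CircuitAlgebra E]
  {M : Type u} [Category.{v} M] [StrictSymPremonoidal M] {ob : W → M} (α : Abstraction M E)

mutual

/-- Derivations of the value judgment `Γ ⊢ V : A`. -/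
inductive VTyp : Ctx W E → Val ob E → Ty W E → Type (max w u v u' v')
  | unit {Φ : Ctx W E} : Φ.IsParam → VTyp Φ .unit .unit
  | nat {Φ : Ctx W E} (n : ℕ) : Φ.IsParam → VTyp Φ (.nat n) .nat
  | lab {Φ : Ctx W E} (l : ℕ) (a : W) : Φ.IsParam → VTyp (Φ ++ [.lab l a]) (.lab l) (.wire a)
  | var {Φ : Ctx W E} (x : ℕ) (A : Ty W E) : Φ.IsParam → VTyp (Φ ++ [.var x A]) (.fvar x) A
  | abs {Γ : Ctx W E} {A B : Ty W E} {T : Bundle W} {e : Eff E} {N : Tm ob E} (x : ℕ) :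
      Γ.Fresh x → x ∉ N.fv → A.WF ob α → T.wires = Γ.wires →
      CTyp (Γ ++ [.var x A]) (N.inst 0 (.fvar x)) B e →
      VTyp Γ (.lam A N) (.arrow A B T e)
  | lift {Φ : Ctx W E} {A : Ty W E} {e : Eff E} {N : Tm ob E} :
      Φ.IsParam → CTyp Φ N A e → VTyp Φ (.lift N) (.bang A e)
  | circ {Φ : Ctx W E} {T U : Bundle W} {e : Eff E} {C : LCirc ob} {b c : WBundle}
      {Q L : LabCtx W} (p : Q.obj ob ⟶ C.dom.obj ob) (q : C.cod.obj ob ⟶ L.obj ob) :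
      Φ.IsParam →
      IsPerm (fun a : ℕ × W => ob a.2) Q C.dom p → IsPerm (fun a : ℕ × W => ob a.2) C.cod L q →
      WBundle.HasType Q b T → WBundle.HasType L c U →
      Bounded α (p ≫ C.hom ≫ q) e →
      VTyp Φ (.boxed b C c) (.circ T U e)
  | pair {Φ Γ₁ Γ₂ : Ctx W E} {V V' : Val ob E} {A B : Ty W E} :
      Φ.IsParam → VTyp (Φ ++ Γ₁) V A → VTyp (Φ ++ Γ₂) V' B →
      VTyp (Φ ++ (Γ₁ ++ Γ₂)) (.pair V V') (.tensor A B)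

/-- Derivations of the computation judgment `Γ ⊢ N : A; e`. -/
inductive CTyp : Ctx W E → Tm ob E → Ty W E → Eff E → Type (max w u v u' v')
  | app {Φ Γ₁ Γ₂ : Ctx W E} {V V' : Val ob E} {A B : Ty W E} {T : Bundle W} {e : Eff E} :
      Φ.IsParam → VTyp (Φ ++ Γ₁) V (.arrow A B T e) → VTyp (Φ ++ Γ₂) V' A →
      CTyp (Φ ++ (Γ₁ ++ Γ₂)) (.app V V') B e
  | force {Φ : Ctx W E} {V : Val ob E} {A : Ty W E} {e : Eff E} :
      Φ.IsParam → VTyp Φ V (.bang A e) → CTyp Φ (.force V) A e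
  | box {Φ : Ctx W E} {V : Val ob E} {T U : Bundle W} {e : Eff E} :
      Φ.IsParam → VTyp Φ V (.arrow T.toTy U.toTy .unit e) →
      CTyp Φ (.box T V) (.circ T U e)
        ⟨StrictSymPremonoidal.unit, StrictSymPremonoidal.unit, 𝟙 _⟩
  | apply {Φ Γ₁ Γ₂ : Ctx W E} {V V' : Val ob E} {T U : Bundle W} {e : Eff E} :
      Φ.IsParam → VTyp (Φ ++ Γ₁) V (.circ T U e) → VTyp (Φ ++ Γ₂) V' T.toTy →
      CTyp (Φ ++ (Γ₁ ++ Γ₂)) (.apply V V') U.toTy e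
  | dest {Φ Γ₁ Γ₂ : Ctx W E} {V : Val ob E} {N : Tm ob E} {A B A' : Ty W E} {e : Eff E}
      (x y : ℕ) :
      Φ.IsParam → x ≠ y → Ctx.Fresh x (Φ ++ Γ₂) → Ctx.Fresh y (Φ ++ Γ₂) →
      x ∉ N.fv → y ∉ N.fv →
      VTyp (Φ ++ Γ₁) V (.tensor A B) →
      CTyp (Φ ++ (Γ₂ ++ [.var x A, .var y B])) ((N.inst 1 (.fvar x)).inst 0 (.fvar y)) A' e →
      CTyp (Φ ++ (Γ₂ ++ Γ₁)) (.dest V N) A' e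
  | ifz {Φ Γ : Ctx W E} {V : Val ob E} {N N' : Tm ob E} {A : Ty W E} {e : Eff E} :
      Φ.IsParam → VTyp Φ V .nat → CTyp (Φ ++ Γ) N A e → CTyp (Φ ++ Γ) N' A e →
      CTyp (Φ ++ Γ) (.ifz V N N') A e
  | ret {Γ : Ctx W E} {V : Val ob E} {A : Ty W E} :
      VTyp Γ V A → CTyp Γ (.ret V) A ⟨α.obj (A.obj ob), α.obj (A.obj ob), 𝟙 _⟩
  | lett {Φ Γ₁ Γ₂ : Ctx W E} {N N' : Tm ob E} {A B : Ty W E} {e₁ e₂ : Eff E} (x : ℕ) :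
      Φ.IsParam → Ctx.Fresh x (Φ ++ Γ₂) → x ∉ N'.fv →
      CTyp (Φ ++ Γ₁) N A e₁ →
      CTyp (Φ ++ (Γ₂ ++ [.var x A])) (N'.inst 0 (.fvar x)) B e₂ →
      (h : α.obj (Γ₂.obj ob) ⊗ₚ e₁.cod = e₂.dom) →
      CTyp (Φ ++ (Γ₂ ++ Γ₁)) (.lett N N') B
        ⟨α.obj (Γ₂.obj ob) ⊗ₚ e₁.dom, e₂.cod,
          lw (α.obj (Γ₂.obj ob)) e₁.hom ≫ eqToHom h ≫ e₂.hom⟩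
  | sub {Γ : Ctx W E} {N : Tm ob E} {A : Ty W E} {t u : E} {e₁ e₂ : t ⟶ u} :
      CTyp Γ N A ⟨t, u, e₁⟩ → e₁ ≤ e₂ → CTyp Γ N A ⟨t, u, e₂⟩
  | ex {Γ₁ Γ₂ : Ctx W E} {a b : Entry W E} {N : Tm ob E} {A : Ty W E} {e : Eff E} :
      CTyp (Γ₁ ++ a :: b :: Γ₂) N A e →
      (h : α.obj (Ctx.obj ob (Γ₁ ++ a :: b :: Γ₂)) = e.dom) →
      CTyp (Γ₁ ++ b :: a :: Γ₂) N A
        ⟨α.obj (Ctx.obj ob (Γ₁ ++ b :: a :: Γ₂)), e.cod,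
          α.map (swapHom (fun c : Entry W E => c.ty.obj ob) Γ₁ b a Γ₂) ≫ eqToHom h ≫ e.hom⟩

end

variable {α}

/-- The circuit part of a value judgment is an identity: both sides have the same object. -/
theorem VTyp.obj_eq : {Γ : Ctx W E} → {V : Val ob E} → {A : Ty W E} → VTyp α Γ V A →
    Γ.obj ob = A.obj ob
  | _, _, _, .unit h => h.obj_eq ob
  | _, _, _, .nat _ h => h.obj_eq ob
  | _, _, _, .lab _ _ h => (h.append_obj ob _).trans (Ctx.obj_single ob _)
  | _, _, _, .var _ _ h => (h.append_obj ob _).trans (Ctx.obj_single ob _)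
  | Γ, _, _, .abs (T := T) _ _ _ _ h _ => by
    rw [Ctx.obj_eq, ← h, ← Bundle.obj_eq]
    rfl
  | _, _, _, .lift h _ => h.obj_eq ob
  | _, _, _, .circ _ _ h _ _ _ _ _ => h.obj_eq ob
  | _, _, _, .pair h d d' => by
    have h₁ := (h.append_obj ob _).symm.trans d.obj_eq
    have h₂ := (h.append_obj ob _).symm.trans d'.obj_eq
    rw [h.append_obj, Ctx.obj_append, h₁, h₂]
    rfl

/-- All types of a context are well formed. -/
def Ctx.WF (α : Abstraction M E) (Γ : Ctx W E) : Prop := ∀ a ∈ Γ, a.ty.WF ob α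

theorem Bundle.toTy_wf (T : Bundle W) : (T.toTy : Ty W E).WF ob α := by
  induction T with
  | unit => trivial
  | wire a => trivial
  | tensor T U ihT ihU => exact ⟨ihT, ihU⟩

theorem Ctx.WF.swap {Γ Δ : Ctx W E} {a b : Entry W E}
    (h : Ctx.WF (ob := ob) α (Γ ++ b :: a :: Δ)) : Ctx.WF (ob := ob) α (Γ ++ a :: b :: Δ) := by
  intro c hc
  refine h c ?_
  simp only [List.mem_append, List.mem_cons] at hc ⊢
  tauto

theorem Ctx.WF.left {Φ Γ₁ Γ₂ : Ctx W E}
    (h : Ctx.WF (ob := ob) α (Φ ++ (Γ₁ ++ Γ₂))) : Ctx.WF (ob := ob) α (Φ ++ Γ₁) := by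
  intro c hc
  refine h c ?_
  simp only [List.mem_append] at hc ⊢
  tauto

theorem Ctx.WF.right {Φ Γ₁ Γ₂ : Ctx W E}
    (h : Ctx.WF (ob := ob) α (Φ ++ (Γ₁ ++ Γ₂))) : Ctx.WF (ob := ob) α (Φ ++ Γ₂) := by
  intro c hc
  refine h c ?_
  simp only [List.mem_append] at hc ⊢
  tauto

theorem Ctx.WF.snoc {Γ : Ctx W E} {x : ℕ} {A : Ty W E} (h : Ctx.WF (ob := ob) α Γ)
    (hA : A.WF ob α) : Ctx.WF (ob := ob) α (Γ ++ [.var x A]) := by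
  intro c hc
  rcases List.mem_append.1 hc with hc | hc
  · exact h c hc
  · obtain rfl := List.mem_singleton.1 hc
    exact hA

theorem LabCtx.toCtx_wf (Q : LabCtx W) : Ctx.WF (ob := ob) α Q.toCtx := by
  intro c hc
  obtain ⟨a, _, rfl⟩ := List.mem_map.1 hc
  trivial

mutual

theorem VTyp.wf : {Γ : Ctx W E} → {V : Val ob E} → {A : Ty W E} → VTyp α Γ V A →
    Ctx.WF (ob := ob) α Γ → A.WF ob α
  | _, _, _, .unit _, _ => trivial
  | _, _, _, .nat _ _, _ => trivial
  | _, _, _, .lab _ _ _, _ => trivial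
  | _, _, _, .var x A _, hΓ => hΓ (.var x A) (by simp)
  | Γ, _, _, .abs (A := A) (T := T) x _ _ hA hT d, hΓ => by
    obtain ⟨hB, h₁, h₂⟩ := d.wf (hΓ.snoc hA)
    refine ⟨hA, hB, h₁.trans ?_, h₂⟩
    rw [Ctx.obj_append, Ctx.obj_single, Ctx.obj_eq, Bundle.obj_eq, hT]
    rfl
  | _, _, _, .lift hΦ d, hΓ => by
    obtain ⟨hA, h₁, h₂⟩ := d.wf hΓ
    exact ⟨hA, by rw [h₁, hΦ.obj_eq], h₂⟩
  | _, _, _, .circ _ _ _ _ _ hb hc ⟨h₁, h₂, _⟩, _ =>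
    ⟨by rw [hb.obj_eq ob, h₁], by rw [hc.obj_eq ob, h₂]⟩
  | _, _, _, .pair _ d d', hΓ => ⟨d.wf hΓ.left, d'.wf hΓ.right⟩

/-- The domain and codomain of the effect of a computation are the abstractions of the circuit
parts of its context and of its type. -/
theorem CTyp.wf : {Γ : Ctx W E} → {N : Tm ob E} → {A : Ty W E} → {e : Eff E} →
    CTyp α Γ N A e → Ctx.WF (ob := ob) α Γ →
    A.WF ob α ∧ e.dom = α.obj (Γ.obj ob) ∧ e.cod = α.obj (A.obj ob)
  | _, _, _, _, .app hΦ d d', hΓ => by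
    obtain ⟨_, hB, h₁, h₂⟩ := d.wf hΓ.left
    refine ⟨hB, h₁.trans ?_, h₂⟩
    have h₃ := (hΦ.append_obj ob _).symm.trans d.obj_eq
    have h₄ := (hΦ.append_obj ob _).symm.trans d'.obj_eq
    rw [hΦ.append_obj, Ctx.obj_append, h₃, h₄]
    rfl
  | _, _, _, _, .force hΦ d, hΓ => by
    obtain ⟨hA, h₁, h₂⟩ := d.wf hΓ
    exact ⟨hA, by rw [h₁, hΦ.obj_eq], h₂⟩
  | _, _, _, _, .box (T := T) (U := U) hΦ d, hΓ => by
    obtain ⟨_, _, h₁, h₂⟩ := d.wf hΓ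
    rw [Bundle.toTy_obj] at h₁ h₂
    refine ⟨⟨h₁.trans ?_, h₂⟩, ?_, α.obj_unit.symm⟩
    · exact congrArg α.obj (unit_tensor _)
    · rw [hΦ.obj_eq, α.obj_unit]
  | _, _, _, _, .apply hΦ d d', hΓ => by
    obtain ⟨h₁, h₂⟩ := d.wf hΓ.left
    refine ⟨Bundle.toTy_wf _, h₁.trans ?_, by rw [h₂, Bundle.toTy_obj]⟩
    have h₃ := (hΦ.append_obj ob _).symm.trans d.obj_eq
    have h₄ := (hΦ.append_obj ob _).symm.trans d'.obj_eq
    rw [hΦ.append_obj, Ctx.obj_append, h₃, h₄, Bundle.toTy_obj]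
    exact congrArg α.obj (unit_tensor _).symm
  | _, _, _, _, .dest (Γ₂ := Γ₂) x y hΦ _ _ _ _ _ d d', hΓ => by
    obtain ⟨hA, hB⟩ := d.wf hΓ.right
    obtain ⟨hA', h₁, h₂⟩ := d'.wf (by
      have := (hΓ.left.snoc hA (x := x)).snoc hB (x := y)
      simpa using this)
    refine ⟨hA', h₁.trans ?_, h₂⟩
    have h₃ := (hΦ.append_obj ob _).symm.trans d.obj_eq
    rw [hΦ.append_obj, Ctx.obj_append, hΦ.append_obj, Ctx.obj_append, h₃]
    refine congrArg (fun Y => α.obj (Ctx.obj ob Γ₂ ⊗ₚ Y)) ?_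
    change _ ⊗ₚ _ ⊗ₚ StrictSymPremonoidal.unit = _
    rw [tensor_unit]
    rfl
  | _, _, _, _, .ifz _ _ d _, hΓ => d.wf hΓ
  | _, _, _, _, .ret d, hΓ => ⟨d.wf hΓ, by rw [d.obj_eq], rfl⟩
  | _, _, _, _, .lett x hΦ _ _ d d' h, hΓ => by
    obtain ⟨hA, h₁, _⟩ := d.wf hΓ.right
    obtain ⟨hB, _, h₂⟩ := d'.wf (by simpa using hΓ.left.snoc hA (x := x))
    refine ⟨hB, ?_, h₂⟩
    rw [hΦ.append_obj, Ctx.obj_append, α.obj_tensor]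
    rw [hΦ.append_obj] at h₁
    exact congrArg (α.obj _ ⊗ₚ ·) h₁
  | _, _, _, _, .sub d _, hΓ => d.wf hΓ
  | _, _, _, _, .ex d _, hΓ => by
    obtain ⟨hA, _, h₂⟩ := d.wf hΓ.swap
    exact ⟨hA, rfl, h₂⟩

end

/-! ### Interpretation of derivations -/

/-- The map `♭⟦T ⊸ U⟧ → M^{≲ e}(⟦T⟧, ⟦U⟧)` for closures that capture no wires. -/
def boxMap (T U : Bundle W) (e : Eff E)
    (f : (Ty.arrow T.toTy U.toTy .unit e).flat ob α) : (Ty.circ T U e).flat ob α :=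
  (f (T.pt ob α)).2.cast
    ((T.toTy_obj (E := E) ob).symm.trans (unit_tensor _).symm) (U.toTy_obj ob)

mutual

/-- The interpretation of a derivation of `Γ ⊢ V : A` as a function `♭⟦Γ⟧ → ♭⟦A⟧`.  Its circuit
part is the equality `VTyp.obj_eq`. -/
def VTyp.interp : {Γ : Ctx W E} → {V : Val ob E} → {A : Ty W E} → VTyp α Γ V A →
    Γ.flat ob α → A.flat ob α
  | _, _, _, .unit _, _ => PUnit.unit
  | _, _, _, .nat n _, _ => ⟨n⟩
  | _, _, _, .lab _ _ _, _ => PUnit.unit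
  | _, _, _, .var (Φ := Φ) _ _ _, g => (Ctx.split Φ g).2.1
  | Γ, _, _, .abs (A := A) (T := T) x _ _ _ hT d, g => fun a =>
    let r := d.interp (Ctx.join g ((a, PUnit.unit) : Ctx.flat ob α [.var x A]))
    (r.1, r.2.cast (by
      rw [Ctx.obj_append, Ctx.obj_single, Ctx.obj_eq, Bundle.obj_eq, hT]
      rfl) rfl)
  | _, _, _, .lift hΦ d, g => fun _ =>
    let r := d.interp g
    (r.1, r.2.cast (hΦ.obj_eq ob).symm rfl)
  | _, _, _, .circ (C := C) p q _ _ _ hb hc h, _ =>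
    Circs.cast (hb.obj_eq ob) (hc.obj_eq ob).symm ⟨p ≫ C.hom ≫ q, h⟩
  | _, _, _, .pair (Φ := Φ) (Γ₁ := Γ₁) _ d d', g =>
    let s := Ctx.split Φ g
    let s' := Ctx.split Γ₁ s.2
    (d.interp (Ctx.join s.1 s'.1), d'.interp (Ctx.join s.1 s'.2))

/-- The interpretation of a derivation of `Γ ⊢ N : A; e` as a function
`♭⟦Γ⟧ → ♭⟦A⟧ × M^{≲ e}(♯⟦Γ⟧, ♯⟦A⟧)`. -/
def CTyp.interp : {Γ : Ctx W E} → {N : Tm ob E} → {A : Ty W E} → {e : Eff E} →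
    CTyp α Γ N A e → Γ.flat ob α → CircMonad α e (Γ.obj ob) (A.obj ob) (A.flat ob α)
  | _, _, _, _, .app (Φ := Φ) (Γ₁ := Γ₁) hΦ d d', g =>
    let s := Ctx.split Φ g
    let s' := Ctx.split Γ₁ s.2
    let r := d.interp (Ctx.join s.1 s'.1) (d'.interp (Ctx.join s.1 s'.2))
    (r.1, r.2.cast (by
      have h₃ := (hΦ.append_obj ob _).symm.trans d.obj_eq
      have h₄ := (hΦ.append_obj ob _).symm.trans d'.obj_eq
      rw [hΦ.append_obj, Ctx.obj_append, h₃, h₄]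
      rfl) rfl)
  | _, _, _, _, .force hΦ d, g =>
    let r := d.interp g PUnit.unit
    (r.1, r.2.cast (hΦ.obj_eq ob) rfl)
  | _, _, _, _, .box (T := T) (U := U) (e := e) hΦ d, g =>
    (boxMap T U e (d.interp g), Circs.idUnit.cast (hΦ.obj_eq ob) rfl)
  | _, _, _, _, .apply (Φ := Φ) (Γ₁ := Γ₁) (U := U) hΦ d d', g =>
    let s := Ctx.split Φ g
    let s' := Ctx.split Γ₁ s.2
    (U.pt ob α, Circs.cast (by
      have h₃ := (hΦ.append_obj ob _).symm.trans d.obj_eq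
      have h₄ := (hΦ.append_obj ob _).symm.trans d'.obj_eq
      rw [hΦ.append_obj, Ctx.obj_append, h₃, h₄, Bundle.toTy_obj]
      exact unit_tensor _) (U.toTy_obj ob).symm (d.interp (Ctx.join s.1 s'.1)))
  | _, _, _, _, .dest (Φ := Φ) (Γ₂ := Γ₂) (A := A) (B := B) x y hΦ _ _ _ _ _ d d', g =>
    let s := Ctx.split Φ g
    let s' := Ctx.split Γ₂ s.2
    let ab := d.interp (Ctx.join s.1 s'.2)
    let r := d'.interp (Ctx.join s.1 (Ctx.join s'.1
      ((ab.1, ab.2, PUnit.unit) : Ctx.flat ob α [.var x A, .var y B])))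
    (r.1, r.2.cast (by
      have h₃ := (hΦ.append_obj ob _).symm.trans d.obj_eq
      rw [hΦ.append_obj, Ctx.obj_append, hΦ.append_obj, Ctx.obj_append, h₃]
      refine congrArg (fun Y => Ctx.obj ob Γ₂ ⊗ₚ Y) ?_
      change _ = _ ⊗ₚ _ ⊗ₚ StrictSymPremonoidal.unit
      rw [tensor_unit]
      rfl) rfl)
  | _, _, _, _, .ifz (Φ := Φ) _ d d' d'', g =>
    match d.interp (Ctx.split Φ g).1 with
    | ⟨0⟩ => d'.interp g
    | ⟨_ + 1⟩ => d''.interp g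
  | _, _, _, _, .ret (A := A) d, g => (d.interp g, (Circs.id (A.obj ob)).cast d.obj_eq rfl)
  | _, _, _, _, .lett (Φ := Φ) (Γ₁ := Γ₁) (Γ₂ := Γ₂) (A := A) x hΦ _ _ d d' h, g =>
    let s := Ctx.split Φ g
    let s' := Ctx.split Γ₂ s.2
    let r := d.interp (Ctx.join s.1 s'.2)
    let r' := d'.interp (Ctx.join s.1 (Ctx.join s'.1
      ((r.1, PUnit.unit) : Ctx.flat ob α [.var x A])))
    (r'.1, ((r.2.lwhisk (Γ₂.obj ob)).comp (r'.2.cast (by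
      rw [hΦ.append_obj, Ctx.obj_append, Ctx.obj_single]
      rfl) rfl) h).cast (by
      rw [hΦ.append_obj, Ctx.obj_append, hΦ.append_obj]) rfl)
  | _, _, _, _, .sub (t := t) (u := u) (e₁ := e₁) (e₂ := e₂) d h, g =>
    CircMonad.incl (e := ⟨t, u, e₁⟩) (d := ⟨t, u, e₂⟩) ⟨rfl, rfl, by simpa using h⟩ (d.interp g)
  | _, _, _, _, .ex (Γ₁ := Γ₁) d h, g =>
    let r := d.interp (Ctx.swapFlat Γ₁ g)
    (r.1, (Circs.pure (swapHom _ _ _ _ _)).comp r.2 h)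

end

/-! ### Configurations -/

variable (α)

/-- Derivations of `Q ⊢ (C, N) : A; Q'; e`: the outputs of the circuit `C`, whose inputs are `Q`,
are those of a label context `L` together with the disjoint label context `Q'`, up to
a permutation, and `N` is a computation of type `A` and effect `e` in the context `L`. -/
structure ConfTyp (Q : LabCtx W) (C : LCirc ob) (N : Tm ob E) (A : Ty W E) (Q' : LabCtx W)
    (e : Eff E) where
  ctx : LabCtx W
  dom_eq : Q = C.dom
  perm : C.cod.obj ob ⟶ LabCtx.obj ob (ctx ++ Q')
  isPerm : IsPerm (fun a : ℕ × W => ob a.2) C.cod (ctx ++ Q') perm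
  typ : CTyp α ctx.toCtx N A e

/-- Derivations of `Q ⊢ (C, V) : A; Q'` for configurations consisting of a circuit and a value. -/
structure ConfVTyp (Q : LabCtx W) (C : LCirc ob) (V : Val ob E) (A : Ty W E)
    (Q' : LabCtx W) where
  ctx : LabCtx W
  dom_eq : Q = C.dom
  perm : C.cod.obj ob ⟶ LabCtx.obj ob (ctx ++ Q')
  isPerm : IsPerm (fun a : ℕ × W => ob a.2) C.cod (ctx ++ Q') perm
  typ : VTyp α ctx.toCtx V A

variable {α}

section Configurations

variable {Q : LabCtx W} {C : LCirc ob} {N : Tm ob E} {V : Val ob E} {A : Ty W E}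
  {Q' : LabCtx W} {e : Eff E}

theorem LabCtx.obj_append_toCtx (L Q' : LabCtx W) :
    LabCtx.obj ob (L ++ Q') = Ctx.obj ob (L.toCtx : Ctx W E) ⊗ₚ Q'.obj ob := by
  rw [LabCtx.toCtx_obj]
  exact listObj_append _ _ _

/-- The circuit of a configuration, as a morphism `⟦Q⟧ ⟶ ♯⟦L⟧ ⊗ ⟦Q'⟧`. -/
def ConfTyp.circuit (d : ConfTyp α Q C N A Q' e) :
    Q.obj ob ⟶ Ctx.obj ob (d.ctx.toCtx : Ctx W E) ⊗ₚ Q'.obj ob :=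
  eqToHom (congrArg (LabCtx.obj ob) d.dom_eq) ≫ C.hom ≫ d.perm ≫
    eqToHom (LabCtx.obj_append_toCtx d.ctx Q')

theorem ConfTyp.eff_dom (d : ConfTyp α Q C N A Q' e) :
    α.obj (Ctx.obj ob (d.ctx.toCtx : Ctx W E) ⊗ₚ Q'.obj ob) = e.dom ⊗ₚ α.obj (Q'.obj ob) := by
  rw [α.obj_tensor, (d.typ.wf (LabCtx.toCtx_wf d.ctx)).2.1]

/-- The effect `α(C); (e ⋉ α⟦Q'⟧)` of a configuration. -/
def ConfTyp.eff (d : ConfTyp α Q C N A Q' e) : Eff E :=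
  ⟨α.obj (Q.obj ob), e.cod ⊗ₚ α.obj (Q'.obj ob),
    α.map d.circuit ≫ eqToHom d.eff_dom ≫ rw e.hom (α.obj (Q'.obj ob))⟩

/-- The interpretation `J(id, C); (⟦N⟧ ⋉ ⟦Q'⟧)` of a configuration. -/
def ConfTyp.interp (d : ConfTyp α Q C N A Q' e) (_ : PUnit.{v + 1}) :
    CircMonad α d.eff (Q.obj ob) (A.obj ob ⊗ₚ Q'.obj ob) (A.flat ob α) :=
  let r := d.typ.interp (LabCtx.pt d.ctx)
  (r.1, (Circs.pure d.circuit).comp (r.2.rwhisk (Q'.obj ob)) d.eff_dom)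

/-- The function part of the interpretation of a configuration `(C, V)`. -/
def ConfVTyp.fn (d : ConfVTyp α Q C V A Q') (_ : PUnit.{v + 1}) : A.flat ob α :=
  d.typ.interp (LabCtx.pt d.ctx)

/-- The circuit part of the interpretation of a configuration `(C, V)`. -/
def ConfVTyp.circuit (d : ConfVTyp α Q C V A Q') :
    Q.obj ob ⟶ A.obj ob ⊗ₚ Q'.obj ob :=
  eqToHom (congrArg (LabCtx.obj ob) d.dom_eq) ≫ C.hom ≫ d.perm ≫
    eqToHom ((LabCtx.obj_append_toCtx d.ctx Q').trans
      (congrArg (· ⊗ₚ LabCtx.obj ob Q') d.typ.obj_eq))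

/-- The effect `α(C)` of a configuration `(C, V)`. -/
def ConfVTyp.eff (d : ConfVTyp α Q C V A Q') : Eff E :=
  ⟨α.obj (Q.obj ob), α.obj (A.obj ob ⊗ₚ Q'.obj ob), α.map d.circuit⟩

/-- The computation `J(⟦(C, V)⟧)`. -/
def ConfVTyp.interpJ (d : ConfVTyp α Q C V A Q') :
    PUnit.{v + 1} → CircMonad α d.eff (Q.obj ob) (A.obj ob ⊗ₚ Q'.obj ob) (A.flat ob α) :=
  J d.fn d.circuit

end Configurations

end Typing

end ProtoQuipperR

/-!
Soundness is proved by induction on the evaluation, for all closed derivations of the computation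
and up to a permutation of the outputs of the circuit.

* A permutation of a list of distinct labels determines the circuit that realizes it, because every
  composite of adjacent symmetries has a normal form that depends only on its source and target.
* The meaning of a derivation is invariant under translations that replace every entry of the
  context by a block of entries: weakening and the substitution lemma are the instances. The cases
  of binders need renamings, and the case of the exchange rule needs exchanges of blocks of entries,
  which are composites of adjacent exchanges.
* A closed derivation is, up to a permutation of its labels, interpreted like one that ends with the
  rule of the computation, so that each evaluation rule meets the corresponding typing rule.
* For `let x = M in N`, the induction hypothesis is applied to `M` with the labels of `N` among the
  remaining outputs. Naturality of the symmetry, which turns `X ⋊ C` into `C ⋉ X` between two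
  symmetries, identifies its circuit with the one prescribed by the typing rule.
* For `apply`, the two circuits differ by a permutation of the remaining outputs, which commutes
  with the applied circuit because the symmetry is central.
-/

namespace ProtoQuipperR

open StrictSymPremonoidal

/-! ### Packaged morphisms -/

namespace Eff

section Category

variable {C : Type u} [Category.{v} C]

/-- A morphism packaged with its domain and codomain.  Equalities of packaged morphisms replace
equalities of morphisms up to `eqToHom`, since strictness only gives equalities of objects. -/
abbrev of {X Y : C} (f : X ⟶ Y) : Eff C := ⟨X, Y, f⟩

theorem of_injective {X Y : C} {f g : X ⟶ Y} (h : of f = of g) : f = g := by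
  injection h

theorem of_id_congr {X Y : C} (h : X = Y) : of (𝟙 X) = of (𝟙 Y) := by rw [h]

@[simp] theorem of_eqToHom_comp {X Y Z : C} (h : X = Y) (f : Y ⟶ Z) :
    of (eqToHom h ≫ f) = of f := by
  subst h; simp

@[simp] theorem of_comp_eqToHom {X Y Z : C} (f : X ⟶ Y) (h : Y = Z) :
    of (f ≫ eqToHom h) = of f := by
  subst h; simp

open Classical in
/-- Composition of packaged morphisms.  The second one is ignored if it is not composable; this
choice makes `comp_id` and `comp_assoc` need fewer hypotheses. -/
noncomputable def comp (e d : Eff C) : Eff C :=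
  if h : e.cod = d.dom then ⟨e.dom, d.cod, e.hom ≫ eqToHom h ≫ d.hom⟩ else e

infixl:80 " ⋆ " => Eff.comp

theorem comp_eq {e d : Eff C} (h : e.cod = d.dom) :
    e ⋆ d = ⟨e.dom, d.cod, e.hom ≫ eqToHom h ≫ d.hom⟩ := dif_pos h

theorem of_comp {X Y Z : C} (f : X ⟶ Y) (g : Y ⟶ Z) : of (f ≫ g) = of f ⋆ of g := by
  rw [comp_eq rfl]; simp

@[simp] theorem comp_dom (e d : Eff C) : (e ⋆ d).dom = e.dom := by
  unfold comp; split <;> rfl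

@[simp] theorem comp_cod {e d : Eff C} (h : e.cod = d.dom) : (e ⋆ d).cod = d.cod := by
  rw [comp_eq h]

theorem comp_assoc {e d c : Eff C} (h : e.cod = d.dom) : e ⋆ d ⋆ c = e ⋆ (d ⋆ c) := by
  by_cases h' : d.cod = c.dom
  · obtain ⟨X, Y, e⟩ := e
    obtain ⟨Y', Z, d⟩ := d
    obtain ⟨Z', T, c⟩ := c
    dsimp only at h h'
    subst h h'
    simp only [← of_comp, Category.assoc]
  · rw [show d ⋆ c = d from dif_neg h']
    exact dif_neg (by rwa [comp_cod h])

@[simp] theorem id_comp {X : C} {e : Eff C} (h : X = e.dom) : of (𝟙 X) ⋆ e = e := by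
  subst h
  rw [comp_eq rfl]
  simp

@[simp] theorem comp_id (X : C) (e : Eff C) : e ⋆ of (𝟙 X) = e := by
  by_cases h : e.cod = X
  · subst h
    rw [comp_eq rfl]
    simp
  · exact dif_neg h

theorem right_inv_unique {e d d' : Eff C} (h : e.cod = d.dom) (h' : d'.cod = e.dom)
    (hd : e ⋆ d = of (𝟙 e.dom)) (hd' : d' ⋆ e = of (𝟙 e.cod)) : d = d' := by
  have assoc : d' ⋆ e ⋆ d = d' ⋆ (e ⋆ d) := comp_assoc h'
  rwa [hd, hd', comp_id, id_comp h] at assoc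

end Category

section Premonoidal

variable {C : Type u} [Category.{v} C] [StrictSymPremonoidal C]

/-- The functor `X ⋊ -` on packaged morphisms. -/
def lwhisk (X : C) (e : Eff C) : Eff C := of (lw X e.hom)

/-- The functor `- ⋉ X` on packaged morphisms. -/
def rwhisk (e : Eff C) (X : C) : Eff C := of (rw e.hom X)

/-- The packaged symmetry. -/
def braid (X Y : C) : Eff C := of (StrictSymPremonoidal.braid X Y)

@[simp] theorem lwhisk_dom (X : C) (e : Eff C) : (e.lwhisk X).dom = X ⊗ₚ e.dom := rfl
@[simp] theorem lwhisk_cod (X : C) (e : Eff C) : (e.lwhisk X).cod = X ⊗ₚ e.cod := rfl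
@[simp] theorem rwhisk_dom (X : C) (e : Eff C) : (e.rwhisk X).dom = e.dom ⊗ₚ X := rfl
@[simp] theorem rwhisk_cod (X : C) (e : Eff C) : (e.rwhisk X).cod = e.cod ⊗ₚ X := rfl
@[simp] theorem braid_dom (X Y : C) : (braid X Y).dom = X ⊗ₚ Y := rfl
@[simp] theorem braid_cod (X Y : C) : (braid X Y).cod = Y ⊗ₚ X := rfl

theorem of_lw (X : C) {Y Z : C} (f : Y ⟶ Z) : of (lw X f) = (of f).lwhisk X := rfl

theorem of_rw {Y Z : C} (f : Y ⟶ Z) (X : C) : of (rw f X) = (of f).rwhisk X := rfl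

@[simp] theorem lwhisk_id (X Y : C) : lwhisk X (of (𝟙 Y)) = of (𝟙 (X ⊗ₚ Y)) := by
  simp only [lwhisk, lw_id]

@[simp] theorem rwhisk_id (X Y : C) : rwhisk (of (𝟙 Y)) X = of (𝟙 (Y ⊗ₚ X)) := by
  simp only [rwhisk, rw_id]

theorem lwhisk_comp (X : C) {e d : Eff C} (h : e.cod = d.dom) :
    (e ⋆ d).lwhisk X = e.lwhisk X ⋆ d.lwhisk X := by
  obtain ⟨Y, Z, e⟩ := e
  obtain ⟨Z', T, d⟩ := d
  dsimp only at h
  subst h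
  simp only [← of_comp, ← of_lw, lw_comp]

theorem rwhisk_comp (X : C) {e d : Eff C} (h : e.cod = d.dom) :
    (e ⋆ d).rwhisk X = e.rwhisk X ⋆ d.rwhisk X := by
  obtain ⟨Y, Z, e⟩ := e
  obtain ⟨Z', T, d⟩ := d
  dsimp only at h
  subst h
  simp only [← of_comp, ← of_rw, rw_comp]

theorem lwhisk_tensor (X X' : C) (e : Eff C) :
    e.lwhisk (X ⊗ₚ X') = (e.lwhisk X').lwhisk X := by
  simp only [lwhisk, lw_tensor, of_eqToHom_comp, of_comp_eqToHom]

theorem rwhisk_tensor (X X' : C) (e : Eff C) :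
    e.rwhisk (X ⊗ₚ X') = (e.rwhisk X).rwhisk X' := by
  simp only [rwhisk, rw_tensor, of_eqToHom_comp, of_comp_eqToHom]

theorem rwhisk_lwhisk (X X' : C) (e : Eff C) :
    (e.lwhisk X).rwhisk X' = (e.rwhisk X').lwhisk X := by
  simp only [lwhisk, rwhisk, rw_lw, of_eqToHom_comp, of_comp_eqToHom]

@[simp] theorem lwhisk_unit (e : Eff C) : e.lwhisk unit = e := by
  simp only [lwhisk, lw_unit, of_eqToHom_comp, of_comp_eqToHom]

@[simp] theorem rwhisk_unit (e : Eff C) : e.rwhisk unit = e := by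
  simp only [rwhisk, rw_unit, of_eqToHom_comp, of_comp_eqToHom]

@[simp] theorem braid_comp_braid (X Y : C) : braid X Y ⋆ braid Y X = of (𝟙 (X ⊗ₚ Y)) := by
  rw [braid, braid, ← of_comp, braid_braid]

theorem rwhisk_comp_braid (e : Eff C) (X : C) :
    e.rwhisk X ⋆ braid e.cod X = braid e.dom X ⋆ e.lwhisk X := by
  simp only [braid, rwhisk, lwhisk, ← of_comp, braid_natural]

theorem lwhisk_comp_braid (e : Eff C) (X : C) :
    e.lwhisk X ⋆ braid X e.cod = braid X e.dom ⋆ e.rwhisk X := by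
  have h := congrArg (fun d => braid X e.dom ⋆ (d ⋆ braid X e.cod)) (rwhisk_comp_braid e X)
  rw [comp_assoc (by simp), braid_comp_braid, comp_id, comp_assoc (by simp),
    ← comp_assoc (by simp), braid_comp_braid, id_comp (by simp)] at h
  exact h.symm

theorem braid_tensor_right (X Y Z : C) :
    braid X (Y ⊗ₚ Z) = (braid X Y).rwhisk Z ⋆ (braid X Z).lwhisk Y := by
  rw [braid, braid_tensor, of_eqToHom_comp, of_comp, of_eqToHom_comp, of_comp_eqToHom]
  rfl

theorem braid_tensor_left (X Y Z : C) :
    braid (X ⊗ₚ Y) Z = (braid Y Z).lwhisk X ⋆ (braid X Z).rwhisk Y := by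
  refine right_inv_unique (e := braid Z (X ⊗ₚ Y)) (by simp)
    (by rw [comp_cod (by simp [tensor_assoc])]; simp [tensor_assoc]) (by simp) ?_
  rw [braid_tensor_right, comp_assoc (by simp [tensor_assoc]),
    ← comp_assoc (e := (braid X Z).rwhisk Y) (by simp), ← rwhisk_comp _ (by simp),
    braid_comp_braid, rwhisk_id, id_comp (by simp [tensor_assoc]),
    ← lwhisk_comp _ (by simp), braid_comp_braid, lwhisk_id]
  exact of_id_congr (by rw [comp_cod (by simp [tensor_assoc])]; simp)

@[simp] theorem braid_unit_right (X : C) : braid X unit = of (𝟙 X) := by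
  have idempotent : braid X unit ⋆ braid X unit = braid X unit := by
    conv_rhs => rw [← unit_tensor (unit : C), braid_tensor_right]
    simp
  have h := congrArg (· ⋆ braid unit X) idempotent
  rw [comp_assoc (by simp [unit_tensor, tensor_unit]), braid_comp_braid, comp_id] at h
  exact h.trans (of_id_congr (tensor_unit _))

@[simp] theorem braid_unit_left (X : C) : braid unit X = of (𝟙 X) := by
  have h := braid_comp_braid X (unit : C)
  rwa [braid_unit_right, id_comp (by simp [unit_tensor]), tensor_unit] at h

theorem braid_rwhisk_comp_lwhisk (X Y : C) (e : Eff C) :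
    (braid X Y).rwhisk e.dom ⋆ e.lwhisk (Y ⊗ₚ X) =
      e.lwhisk (X ⊗ₚ Y) ⋆ (braid X Y).rwhisk e.cod := by
  simp only [braid, lwhisk, rwhisk, ← of_comp, braid_central_left]

theorem braid_lwhisk_comp_rwhisk (X Y : C) (e : Eff C) :
    (braid X Y).lwhisk e.dom ⋆ e.rwhisk (Y ⊗ₚ X) =
      e.rwhisk (X ⊗ₚ Y) ⋆ (braid X Y).lwhisk e.cod := by
  simp only [braid, lwhisk, rwhisk, ← of_comp, braid_central_right]

end Premonoidal

end Eff

/-! ### Coherence for permutation isomorphisms -/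

section Perm

variable {C : Type u} [Category.{v} C] [StrictSymPremonoidal C] {X : Type w} {f : X → C}

@[simp] theorem listObj_nil : listObj f [] = unit := rfl

@[simp] theorem listObj_cons (a : X) (l : List X) : listObj f (a :: l) = f a ⊗ₚ listObj f l := rfl

variable (f) in
/-- The symmetry exchanging two adjacent entries of a list, as a packaged morphism. -/
def swapEff (l : List X) (a b : X) (l' : List X) : Eff C :=
  ((Eff.braid (f a) (f b)).rwhisk (listObj f l')).lwhisk (listObj f l)

theorem of_swapHom (l : List X) (a b : X) (l' : List X) :
    Eff.of (swapHom f l a b l') = swapEff f l a b l' := by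
  induction l with
  | nil =>
    rw [swapEff, listObj_nil, Eff.lwhisk_unit]
    exact (Eff.of_eqToHom_comp _ _).trans (Eff.of_comp_eqToHom _ _)
  | cons c l ih =>
    rw [swapEff, listObj_cons, Eff.lwhisk_tensor, ← swapEff, ← ih]
    rfl

@[simp] theorem swapEff_dom (l : List X) (a b : X) (l' : List X) :
    (swapEff f l a b l').dom = listObj f (l ++ a :: b :: l') := by
  simp [swapEff, listObj_append, tensor_assoc]

@[simp] theorem swapEff_cod (l : List X) (a b : X) (l' : List X) :
    (swapEff f l a b l').cod = listObj f (l ++ b :: a :: l') := by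
  simp [swapEff, listObj_append, tensor_assoc]

theorem lwhisk_swapEff (m l : List X) (a b : X) (l' : List X) :
    (swapEff f l a b l').lwhisk (listObj f m) = swapEff f (m ++ l) a b l' := by
  rw [swapEff, swapEff, listObj_append, Eff.lwhisk_tensor]

theorem rwhisk_swapEff (l : List X) (a b : X) (l' m : List X) :
    (swapEff f l a b l').rwhisk (listObj f m) = swapEff f l a b (l' ++ m) := by
  rw [swapEff, swapEff, listObj_append, Eff.rwhisk_tensor, Eff.rwhisk_lwhisk]

@[simp] theorem swapEff_comp_swapEff (l : List X) (a b : X) (l' : List X) :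
    swapEff f l a b l' ⋆ swapEff f l b a l' = Eff.of (𝟙 (listObj f (l ++ a :: b :: l'))) := by
  rw [swapEff, swapEff, ← Eff.lwhisk_comp _ (by simp), ← Eff.rwhisk_comp _ (by simp),
    Eff.braid_comp_braid, Eff.rwhisk_id, Eff.lwhisk_id]
  exact Eff.of_id_congr (by simp [listObj_append, tensor_assoc])

variable (f) in
/-- The relation `IsPerm` for packaged morphisms, see `permEff_iff`. -/
inductive PermEff : (l l' : List X) → Eff C → Prop
  | refl (l : List X) : PermEff l l (Eff.of (𝟙 (listObj f l)))
  | swap (l : List X) (a b : X) (l' : List X) :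
      PermEff (l ++ a :: b :: l') (l ++ b :: a :: l') (swapEff f l a b l')
  | trans {l₁ l₂ l₃ : List X} {P P' : Eff C} :
      PermEff l₁ l₂ P → PermEff l₂ l₃ P' → PermEff l₁ l₃ (P ⋆ P')

theorem permEff_iff {l l' : List X} {P : Eff C} :
    PermEff f l l' P ↔ ∃ p, IsPerm f l l' p ∧ Eff.of p = P := by
  constructor
  · intro h
    induction h with
    | refl l => exact ⟨_, .refl l, rfl⟩
    | swap l a b l' => exact ⟨_, .swap l a b l', of_swapHom _ _ _ _⟩
    | trans _ _ ih ih' =>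
      obtain ⟨p, hp, rfl⟩ := ih
      obtain ⟨p', hp', rfl⟩ := ih'
      exact ⟨_, hp.trans hp', Eff.of_comp _ _⟩
  · rintro ⟨p, hp, rfl⟩
    induction hp with
    | refl l => exact .refl l
    | swap l a b l' => rw [of_swapHom]; exact .swap l a b l'
    | trans _ _ ih ih' => rw [Eff.of_comp]; exact ih.trans ih'

theorem IsPerm.permEff {l l' : List X} {p : listObj f l ⟶ listObj f l'} (h : IsPerm f l l' p) :
    PermEff f l l' (Eff.of p) :=
  permEff_iff.2 ⟨p, h, rfl⟩

namespace PermEff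

theorem dom_eq_and_cod_eq {l l' : List X} {P : Eff C} (h : PermEff f l l' P) :
    P.dom = listObj f l ∧ P.cod = listObj f l' := by
  obtain ⟨p, -, rfl⟩ := permEff_iff.1 h
  exact ⟨rfl, rfl⟩

theorem dom_eq {l l' : List X} {P : Eff C} (h : PermEff f l l' P) : P.dom = listObj f l :=
  h.dom_eq_and_cod_eq.1

theorem cod_eq {l l' : List X} {P : Eff C} (h : PermEff f l l' P) : P.cod = listObj f l' :=
  h.dom_eq_and_cod_eq.2

theorem of_eq {l l' : List X} {Y : C} (h : l = l') (hY : Y = listObj f l) :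
    PermEff f l l' (Eff.of (𝟙 Y)) := by
  subst h hY
  exact .refl _

theorem congr {l l' m m' : List X} {P P' : Eff C} (h : PermEff f l l' P) (hm : l = m)
    (hm' : l' = m') (hP : P = P') : PermEff f m m' P' := by
  subst hm hm' hP; exact h

theorem perm {l l' : List X} {P : Eff C} (h : PermEff f l l' P) : l.Perm l' := by
  induction h with
  | refl l => exact .refl _
  | swap l a b l' => exact (List.Perm.swap _ _ _).append_left _
  | trans _ _ ih ih' => exact ih.trans ih'

theorem append_left (m : List X) {l l' : List X} {P : Eff C} (h : PermEff f l l' P) :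
    PermEff f (m ++ l) (m ++ l') (P.lwhisk (listObj f m)) := by
  induction h with
  | refl l => rw [Eff.lwhisk_id, ← listObj_append]; exact .refl _
  | swap l a b l' =>
    exact (swap (m ++ l) a b l').congr (by simp) (by simp) (lwhisk_swapEff _ _ _ _ _).symm
  | trans h h' ih ih' =>
    rw [Eff.lwhisk_comp _ (h.cod_eq.trans h'.dom_eq.symm)]
    exact ih.trans ih'

theorem append_right (m : List X) {l l' : List X} {P : Eff C} (h : PermEff f l l' P) :
    PermEff f (l ++ m) (l' ++ m) (P.rwhisk (listObj f m)) := by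
  induction h with
  | refl l => rw [Eff.rwhisk_id, ← listObj_append]; exact .refl _
  | swap l a b l' =>
    exact (swap l a b (l' ++ m)).congr (by simp) (by simp) (rwhisk_swapEff _ _ _ _ _).symm
  | trans h h' ih ih' =>
    rw [Eff.rwhisk_comp _ (h.cod_eq.trans h'.dom_eq.symm)]
    exact ih.trans ih'

theorem cons_block (a : X) (m : List X) :
    PermEff f (a :: m) (m ++ [a]) (Eff.braid (f a) (listObj f m)) := by
  induction m with
  | nil => exact (refl [a]).congr rfl rfl (by simpa using Eff.of_id_congr (tensor_unit _))
  | cons b m ih =>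
    refine ((swap [] a b m).trans (ih.append_left [b])).congr rfl rfl ?_
    simp [swapEff, Eff.braid_tensor_right, tensor_unit]

theorem block (l m : List X) :
    PermEff f (l ++ m) (m ++ l) (Eff.braid (listObj f l) (listObj f m)) := by
  induction l with
  | nil => exact (refl m).congr rfl (by simp) (by simp)
  | cons a l ih =>
    refine ((ih.append_left [a]).trans ((cons_block a m).append_right l)).congr rfl (by simp) ?_
    simp [Eff.braid_tensor_left, tensor_unit]

theorem map {Y : Type*} {f' : Y → C} {g : X → Y} (hg : ∀ a, f' (g a) = f a) {l l' : List X}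
    {P : Eff C} (h : PermEff f l l' P) : PermEff f' (l.map g) (l'.map g) P := by
  have hl (l : List X) : listObj f' (l.map g) = listObj f l := by
    induction l with
    | nil => rfl
    | cons a l ih => simp [ih, hg]
  induction h with
  | refl l => exact .of_eq rfl (hl l).symm
  | swap l a b l' =>
    exact (swap (f := f') (l.map g) (g a) (g b) (l'.map g)).congr (by simp) (by simp)
      (by simp [swapEff, hl, hg])
  | trans _ _ ih ih' => exact ih.trans ih'

theorem exists_of_perm {l l' : List X} (h : l.Perm l') : ∃ P, PermEff f l l' P := by
  induction h with
  | nil => exact ⟨_, refl _⟩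
  | cons a _ ih =>
    obtain ⟨P, hP⟩ := ih
    exact ⟨_, hP.append_left [a]⟩
  | swap a b l => exact ⟨_, swap [] b a l⟩
  | trans _ _ ih ih' =>
    obtain ⟨P, hP⟩ := ih
    obtain ⟨P', hP'⟩ := ih'
    exact ⟨_, hP.trans hP'⟩

theorem lwhisk_comp_rwhisk {l l' : List X} {P : Eff C} (h : PermEff f l l' P) (e : Eff C) :
    P.lwhisk e.dom ⋆ e.rwhisk (listObj f l') = e.rwhisk (listObj f l) ⋆ P.lwhisk e.cod := by
  induction h with
  | refl l => rw [Eff.lwhisk_id, Eff.lwhisk_id, Eff.comp_id, Eff.id_comp (by simp)]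
  | swap l a b l' =>
    have h := congrArg (fun P => P.rwhisk (listObj f l'))
      (Eff.braid_lwhisk_comp_rwhisk (f a) (f b) (e.rwhisk (listObj f l)))
    rw [Eff.rwhisk_comp _ (by simp), Eff.rwhisk_comp _ (by simp)] at h
    simpa [swapEff, listObj_append, Eff.rwhisk_tensor, Eff.lwhisk_tensor, Eff.rwhisk_lwhisk]
      using h
  | trans h h' ih ih' =>
    have hc := h.cod_eq.trans h'.dom_eq.symm
    rw [Eff.lwhisk_comp _ hc, Eff.lwhisk_comp _ hc, Eff.comp_assoc (by simp [hc]), ih',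
      ← Eff.comp_assoc (by simp [h.cod_eq]), ih, Eff.comp_assoc (by simp [h.dom_eq])]

end PermEff

variable (f) in
/-- The symmetry that moves the head of `a :: l₁ ++ l₂` to its place between `l₁` and `l₂`. -/
def insertEff (a : X) (l₁ l₂ : List X) : Eff C :=
  (Eff.braid (f a) (listObj f l₁)).rwhisk (listObj f l₂)

@[simp] theorem insertEff_dom (a : X) (l₁ l₂ : List X) :
    (insertEff f a l₁ l₂).dom = listObj f (a :: (l₁ ++ l₂)) := by
  simp [insertEff, listObj_append, tensor_assoc]

@[simp] theorem insertEff_cod (a : X) (l₁ l₂ : List X) :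
    (insertEff f a l₁ l₂).cod = listObj f (l₁ ++ a :: l₂) := by
  simp [insertEff, listObj_append, tensor_assoc]

@[simp] theorem insertEff_nil (a : X) (l : List X) :
    insertEff f a [] l = Eff.of (𝟙 (listObj f (a :: l))) := by
  simp [insertEff]

theorem insertEff_comp_swapEff_right (a b : X) (l₁ l₂ : List X) :
    insertEff f a l₁ (b :: l₂) ⋆ swapEff f l₁ a b l₂ = insertEff f a (l₁ ++ [b]) l₂ := by
  rw [insertEff, insertEff, swapEff, listObj_append, Eff.braid_tensor_right,
    Eff.rwhisk_comp _ (by simp [tensor_assoc])]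
  simp [Eff.rwhisk_tensor, Eff.rwhisk_lwhisk, tensor_unit]

theorem insertEff_comp_swapEff_left (a b : X) (l₁ l₂ : List X) :
    insertEff f a (l₁ ++ [b]) l₂ ⋆ swapEff f l₁ b a l₂ = insertEff f a l₁ (b :: l₂) := by
  rw [← insertEff_comp_swapEff_right, Eff.comp_assoc (by simp), swapEff_comp_swapEff, Eff.comp_id]

theorem insertEff_comp_swapEff_append_right (a b c : X) (l₁ m m' : List X) :
    insertEff f a l₁ (m ++ b :: c :: m') ⋆ swapEff f (l₁ ++ a :: m) b c m' =
      (swapEff f (l₁ ++ m) b c m').lwhisk (f a) ⋆ insertEff f a l₁ (m ++ c :: b :: m') := by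
  have central := Eff.braid_rwhisk_comp_lwhisk (f a) (listObj f l₁) (swapEff f m b c m')
  simpa only [swapEff, insertEff, listObj_append, listObj_cons, Eff.lwhisk_tensor,
    Eff.lwhisk_dom, Eff.lwhisk_cod, Eff.rwhisk_dom, Eff.rwhisk_cod, Eff.braid_dom, Eff.braid_cod,
    tensor_assoc] using central

theorem insertEff_comp_swapEff_append_left (a b c : X) (m m' l₂ : List X) :
    insertEff f a (m ++ b :: c :: m') l₂ ⋆ swapEff f m b c (m' ++ a :: l₂) =
      (swapEff f m b c (m' ++ l₂)).lwhisk (f a) ⋆ insertEff f a (m ++ c :: b :: m') l₂ := by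
  have natural := congrArg (fun P => P.rwhisk (listObj f l₂))
    (Eff.lwhisk_comp_braid (swapEff f m b c m') (f a))
  rw [Eff.rwhisk_comp _ (by simp), Eff.rwhisk_comp _ (by simp)] at natural
  simpa only [swapEff, insertEff, listObj_append, listObj_cons, Eff.rwhisk_tensor,
    Eff.rwhisk_lwhisk, Eff.lwhisk_dom, Eff.lwhisk_cod, Eff.rwhisk_dom, Eff.rwhisk_cod,
    Eff.braid_dom, Eff.braid_cod, tensor_assoc] using natural.symm

variable (f) in
/-- The normal forms of permutation isomorphisms: the tail of the source is permuted first, and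
then the head is moved to its place. -/
inductive CanonPerm : List X → List X → Eff C → Prop
  | nil : CanonPerm [] [] (Eff.of (𝟙 unit))
  | cons (a : X) {t : List X} (l₁ l₂ : List X) {K : Eff C} : CanonPerm t (l₁ ++ l₂) K →
      CanonPerm (a :: t) (l₁ ++ a :: l₂) (K.lwhisk (f a) ⋆ insertEff f a l₁ l₂)

namespace CanonPerm

theorem cod_eq {l l' : List X} {K : Eff C} (h : CanonPerm f l l' K) : K.cod = listObj f l' := by
  induction h with
  | nil => rfl
  | cons _ _ _ _ ih => rw [Eff.comp_cod (by simp [ih]), insertEff_cod]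

theorem congr {l l' m : List X} {K K' : Eff C} (h : CanonPerm f l l' K) (hm : l' = m)
    (hK : K = K') : CanonPerm f l m K' := by
  subst hm hK; exact h

theorem perm {l l' : List X} {K : Eff C} (h : CanonPerm f l l' K) : l.Perm l' := by
  induction h with
  | nil => exact .refl _
  | cons a _ _ _ ih => exact (ih.cons a).trans List.perm_middle.symm

theorem refl (l : List X) : CanonPerm f l l (Eff.of (𝟙 (listObj f l))) := by
  induction l with
  | nil => exact .nil
  | cons a l ih => exact (cons a [] l ih).congr rfl (by simp)

theorem unique {l l' : List X} {K K' : Eff C} (hl : l.Nodup) (h : CanonPerm f l l' K)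
    (h' : CanonPerm f l l' K') : K = K' := by
  induction h generalizing K' with
  | nil => cases h'; rfl
  | @cons a t l₁ l₂ K h ih =>
    generalize hm : l₁ ++ a :: l₂ = m at h'
    cases h' with
    | @cons _ _ m₁ m₂ K' h' =>
      obtain ⟨ha, ht⟩ := List.nodup_cons.1 hl
      rw [h.perm.mem_iff, List.mem_append, not_or] at ha
      obtain ⟨rfl, -, rfl⟩ := (List.append_cons_inj_of_notMem ha.1 ha.2).1 hm
      rw [ih ht h']

theorem comp_swapEff {l m m' : List X} {b c : X} {K : Eff C}
    (h : CanonPerm f l (m ++ b :: c :: m') K) :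
    CanonPerm f l (m ++ c :: b :: m') (K ⋆ swapEff f m b c m') := by
  generalize hl : m ++ b :: c :: m' = l' at h
  induction h generalizing m m' b c with
  | nil => simp at hl
  | @cons a t l₁ l₂ K h ih =>
    have hK := h.cod_eq
    rw [Eff.comp_assoc (by simp [hK])]
    rcases List.append_eq_append_iff.1 hl.symm with ⟨n, rfl, hn⟩ | ⟨n, rfl, hn⟩
    · rcases n with - | ⟨a', n⟩
      · obtain ⟨rfl, rfl⟩ : a = b ∧ l₂ = c :: m' := by simpa using hn
        rw [List.append_nil, insertEff_comp_swapEff_right]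
        exact (cons a (l₁ ++ [c]) m' (by simpa using h)).congr (by simp) rfl
      · obtain ⟨rfl, rfl⟩ : a = a' ∧ l₂ = n ++ b :: c :: m' := by simpa using hn
        rw [insertEff_comp_swapEff_append_right, ← Eff.comp_assoc (by simp [hK]),
          ← Eff.lwhisk_comp _ (by simp [hK])]
        exact (cons a l₁ (n ++ c :: b :: m')
          ((ih (m := l₁ ++ n) (by simp)).congr (by simp) rfl)).congr (by simp) rfl
    · rcases n with - | ⟨b', - | ⟨c', n⟩⟩
      · obtain ⟨rfl, rfl⟩ : b = a ∧ c :: m' = l₂ := by simpa using hn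
        rw [List.append_nil, insertEff_comp_swapEff_right]
        exact (cons b (m ++ [c]) m' (by simpa using h)).congr (by simp) rfl
      · obtain ⟨rfl, rfl, rfl⟩ : b = b' ∧ c = a ∧ m' = l₂ := by simpa using hn
        rw [insertEff_comp_swapEff_left]
        exact cons c m (b :: m') (by simpa using h)
      · obtain ⟨rfl, rfl, rfl⟩ : b = b' ∧ c = c' ∧ m' = n ++ a :: l₂ := by simpa using hn
        rw [insertEff_comp_swapEff_append_left, ← Eff.comp_assoc (by simp [hK]),
          ← Eff.lwhisk_comp _ (by simp [hK])]
        exact (cons a (m ++ c :: b :: n) l₂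
          ((ih (m' := n ++ l₂) (by simp)).congr (by simp) rfl)).congr (by simp) rfl

theorem comp_permEff {l l' l'' : List X} {K P : Eff C} (hK : CanonPerm f l l' K)
    (hP : PermEff f l' l'' P) : CanonPerm f l l'' (K ⋆ P) := by
  induction hP generalizing K with
  | refl l => rwa [Eff.comp_id]
  | swap => exact hK.comp_swapEff
  | trans h _ ih ih' =>
    rw [← Eff.comp_assoc (hK.cod_eq.trans h.dom_eq.symm)]
    exact ih' (ih hK)

end CanonPerm

theorem PermEff.canonPerm {l l' : List X} {P : Eff C} (h : PermEff f l l' P) :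
    CanonPerm f l l' P := by
  simpa [h.dom_eq] using (CanonPerm.refl l).comp_permEff h

theorem PermEff.unique {l l' : List X} {P P' : Eff C} (hl : l.Nodup) (h : PermEff f l l' P)
    (h' : PermEff f l l' P') : P = P' :=
  h.canonPerm.unique hl h'.canonPerm

end Perm

/-! ### Simultaneous substitution -/

section Terms

variable {W : Type w} {M : Type u} [Category.{v} M] [StrictSymPremonoidal M] {ob : W → M}
  {E : Type u'} [Category.{v'} E]

mutual

/-- Simultaneous substitution of values for the free variables of a value. -/
def Val.msubst (σ : ℕ → Val ob E) : Val ob E → Val ob E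
  | .unit => .unit
  | .nat n => .nat n
  | .lab l => .lab l
  | .bvar i => .bvar i
  | .fvar x => σ x
  | .lam A N => .lam A (Tm.msubst σ N)
  | .lift N => .lift (Tm.msubst σ N)
  | .boxed b C c => .boxed b C c
  | .pair V V' => .pair (Val.msubst σ V) (Val.msubst σ V')

/-- Simultaneous substitution of values for the free variables of a computation. -/
def Tm.msubst (σ : ℕ → Val ob E) : Tm ob E → Tm ob E
  | .app V V' => .app (Val.msubst σ V) (Val.msubst σ V')
  | .force V => .force (Val.msubst σ V)
  | .box T V => .box T (Val.msubst σ V)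
  | .apply V V' => .apply (Val.msubst σ V) (Val.msubst σ V')
  | .dest V N => .dest (Val.msubst σ V) (Tm.msubst σ N)
  | .ifz V N N' => .ifz (Val.msubst σ V) (Tm.msubst σ N) (Tm.msubst σ N')
  | .ret V => .ret (Val.msubst σ V)
  | .lett N N' => .lett (Tm.msubst σ N) (Tm.msubst σ N')

end

/-- A value without loose indices, characterized by the fact that instantiation does nothing. -/
def Val.LocallyClosed (V : Val ob E) : Prop := ∀ k U, Val.inst k U V = V

/-- A computation without loose indices, characterized by the fact that instantiation does
nothing. -/
def Tm.LocallyClosed (N : Tm ob E) : Prop := ∀ k U, N.inst k U = N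

mutual

theorem Val.inst_eq_of_inst_inst {U U' : Val ob E} : ∀ (V : Val ob E) {i j : ℕ}, i ≠ j →
    Val.inst j U' (Val.inst i U V) = Val.inst i U V → Val.inst j U' V = V
  | .unit, _, _, _, _ => rfl
  | .nat _, _, _, _, _ => rfl
  | .lab _, _, _, _, _ => rfl
  | .bvar n, i, j, hij, h => by
    by_cases hn : n = i
    · subst hn
      simp [Val.inst, hij]
    · simpa [Val.inst, hn] using h
  | .fvar _, _, _, _, _ => rfl
  | .lam A N, i, j, hij, h => by
    simp only [Val.inst, Val.lam.injEq, true_and] at h ⊢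
    exact Tm.inst_eq_of_inst_inst N (by omega) h
  | .lift N, i, j, hij, h => by
    simp only [Val.inst, Val.lift.injEq] at h ⊢
    exact Tm.inst_eq_of_inst_inst N hij h
  | .boxed _ _ _, _, _, _, _ => rfl
  | .pair V V', i, j, hij, h => by
    simp only [Val.inst, Val.pair.injEq] at h ⊢
    exact ⟨Val.inst_eq_of_inst_inst V hij h.1, Val.inst_eq_of_inst_inst V' hij h.2⟩

theorem Tm.inst_eq_of_inst_inst {U U' : Val ob E} : ∀ (N : Tm ob E) {i j : ℕ}, i ≠ j →
    (N.inst i U).inst j U' = N.inst i U → N.inst j U' = N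
  | .app V V', i, j, hij, h => by
    simp only [Tm.inst, Tm.app.injEq] at h ⊢
    exact ⟨Val.inst_eq_of_inst_inst V hij h.1, Val.inst_eq_of_inst_inst V' hij h.2⟩
  | .force V, i, j, hij, h => by
    simp only [Tm.inst, Tm.force.injEq] at h ⊢
    exact Val.inst_eq_of_inst_inst V hij h
  | .box T V, i, j, hij, h => by
    simp only [Tm.inst, Tm.box.injEq, true_and] at h ⊢
    exact Val.inst_eq_of_inst_inst V hij h
  | .apply V V', i, j, hij, h => by
    simp only [Tm.inst, Tm.apply.injEq] at h ⊢
    exact ⟨Val.inst_eq_of_inst_inst V hij h.1, Val.inst_eq_of_inst_inst V' hij h.2⟩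
  | .dest V N, i, j, hij, h => by
    simp only [Tm.inst, Tm.dest.injEq] at h ⊢
    exact ⟨Val.inst_eq_of_inst_inst V hij h.1, Tm.inst_eq_of_inst_inst N (by omega) h.2⟩
  | .ifz V N N', i, j, hij, h => by
    simp only [Tm.inst, Tm.ifz.injEq] at h ⊢
    exact ⟨Val.inst_eq_of_inst_inst V hij h.1, Tm.inst_eq_of_inst_inst N hij h.2.1,
      Tm.inst_eq_of_inst_inst N' hij h.2.2⟩
  | .ret V, i, j, hij, h => by
    simp only [Tm.inst, Tm.ret.injEq] at h ⊢
    exact Val.inst_eq_of_inst_inst V hij h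
  | .lett N N', i, j, hij, h => by
    simp only [Tm.inst, Tm.lett.injEq] at h ⊢
    exact ⟨Tm.inst_eq_of_inst_inst N hij h.1, Tm.inst_eq_of_inst_inst N' (by omega) h.2⟩

end

mutual

theorem Val.msubst_inst {σ : ℕ → Val ob E} (hσ : ∀ x, (σ x).LocallyClosed) (U : Val ob E) :
    ∀ (V : Val ob E) (k : ℕ), (Val.inst k U V).msubst σ = Val.inst k (U.msubst σ) (V.msubst σ)
  | .unit, _ => rfl
  | .nat _, _ => rfl
  | .lab _, _ => rfl
  | .bvar n, k => by simp only [Val.inst, Val.msubst]; split <;> rfl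
  | .fvar x, k => (hσ x k _).symm
  | .lam A N, k => by simp only [Val.inst, Val.msubst, Tm.msubst_inst hσ U N]
  | .lift N, k => by simp only [Val.inst, Val.msubst, Tm.msubst_inst hσ U N]
  | .boxed _ _ _, _ => rfl
  | .pair V V', k => by
    simp only [Val.inst, Val.msubst, Val.msubst_inst hσ U V, Val.msubst_inst hσ U V']

theorem Tm.msubst_inst {σ : ℕ → Val ob E} (hσ : ∀ x, (σ x).LocallyClosed) (U : Val ob E) :
    ∀ (N : Tm ob E) (k : ℕ), (N.inst k U).msubst σ = (N.msubst σ).inst k (U.msubst σ)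
  | .app V V', k => by
    simp only [Tm.inst, Tm.msubst, Val.msubst_inst hσ U V, Val.msubst_inst hσ U V']
  | .force V, k => by simp only [Tm.inst, Tm.msubst, Val.msubst_inst hσ U V]
  | .box T V, k => by simp only [Tm.inst, Tm.msubst, Val.msubst_inst hσ U V]
  | .apply V V', k => by
    simp only [Tm.inst, Tm.msubst, Val.msubst_inst hσ U V, Val.msubst_inst hσ U V']
  | .dest V N, k => by
    simp only [Tm.inst, Tm.msubst, Val.msubst_inst hσ U V, Tm.msubst_inst hσ U N]
  | .ifz V N N', k => by
    simp only [Tm.inst, Tm.msubst, Val.msubst_inst hσ U V, Tm.msubst_inst hσ U N,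
      Tm.msubst_inst hσ U N']
  | .ret V, k => by simp only [Tm.inst, Tm.msubst, Val.msubst_inst hσ U V]
  | .lett N N', k => by
    simp only [Tm.inst, Tm.msubst, Tm.msubst_inst hσ U N, Tm.msubst_inst hσ U N']

end

mutual

theorem Val.msubst_congr {σ σ' : ℕ → Val ob E} : ∀ V : Val ob E, (∀ x ∈ V.fv, σ x = σ' x) →
    V.msubst σ = V.msubst σ'
  | .unit, _ => rfl
  | .nat _, _ => rfl
  | .lab _, _ => rfl
  | .bvar _, _ => rfl
  | .fvar x, h => h x rfl
  | .lam A N, h => by simp only [Val.msubst, Tm.msubst_congr N h]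
  | .lift N, h => by simp only [Val.msubst, Tm.msubst_congr N h]
  | .boxed _ _ _, _ => rfl
  | .pair V V', h => by
    simp only [Val.msubst, Val.msubst_congr V fun x hx => h x (Or.inl hx),
      Val.msubst_congr V' fun x hx => h x (Or.inr hx)]

theorem Tm.msubst_congr {σ σ' : ℕ → Val ob E} : ∀ N : Tm ob E, (∀ x ∈ N.fv, σ x = σ' x) →
    N.msubst σ = N.msubst σ'
  | .app V V', h => by
    simp only [Tm.msubst, Val.msubst_congr V fun x hx => h x (Or.inl hx),
      Val.msubst_congr V' fun x hx => h x (Or.inr hx)]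
  | .force V, h => by simp only [Tm.msubst, Val.msubst_congr V h]
  | .box T V, h => by simp only [Tm.msubst, Val.msubst_congr V h]
  | .apply V V', h => by
    simp only [Tm.msubst, Val.msubst_congr V fun x hx => h x (Or.inl hx),
      Val.msubst_congr V' fun x hx => h x (Or.inr hx)]
  | .dest V N, h => by
    simp only [Tm.msubst, Val.msubst_congr V fun x hx => h x (Or.inl hx),
      Tm.msubst_congr N fun x hx => h x (Or.inr hx)]
  | .ifz V N N', h => by
    simp only [Tm.msubst, Val.msubst_congr V fun x hx => h x (Or.inl (Or.inl hx)),
      Tm.msubst_congr N fun x hx => h x (Or.inl (Or.inr hx)),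
      Tm.msubst_congr N' fun x hx => h x (Or.inr hx)]
  | .ret V, h => by simp only [Tm.msubst, Val.msubst_congr V h]
  | .lett N N', h => by
    simp only [Tm.msubst, Tm.msubst_congr N fun x hx => h x (Or.inl hx),
      Tm.msubst_congr N' fun x hx => h x (Or.inr hx)]

end

mutual

theorem Val.msubst_fvar : ∀ V : Val ob E, V.msubst .fvar = V
  | .unit => rfl
  | .nat _ => rfl
  | .lab _ => rfl
  | .bvar _ => rfl
  | .fvar x => rfl
  | .lam A N => by simp only [Val.msubst, Tm.msubst_fvar N]
  | .lift N => by simp only [Val.msubst, Tm.msubst_fvar N]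
  | .boxed _ _ _ => rfl
  | .pair V V' => by simp only [Val.msubst, Val.msubst_fvar V, Val.msubst_fvar V']

theorem Tm.msubst_fvar : ∀ N : Tm ob E, N.msubst .fvar = N
  | .app V V' => by simp only [Tm.msubst, Val.msubst_fvar V, Val.msubst_fvar V']
  | .force V => by simp only [Tm.msubst, Val.msubst_fvar V]
  | .box T V => by simp only [Tm.msubst, Val.msubst_fvar V]
  | .apply V V' => by simp only [Tm.msubst, Val.msubst_fvar V, Val.msubst_fvar V']
  | .dest V N => by simp only [Tm.msubst, Val.msubst_fvar V, Tm.msubst_fvar N]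
  | .ifz V N N' => by
    simp only [Tm.msubst, Val.msubst_fvar V, Tm.msubst_fvar N, Tm.msubst_fvar N']
  | .ret V => by simp only [Tm.msubst, Val.msubst_fvar V]
  | .lett N N' => by simp only [Tm.msubst, Tm.msubst_fvar N, Tm.msubst_fvar N']

end

mutual

theorem Val.finite_fv : ∀ V : Val ob E, V.fv.Finite
  | .unit => Set.finite_empty
  | .nat _ => Set.finite_empty
  | .lab _ => Set.finite_empty
  | .bvar _ => Set.finite_empty
  | .fvar x => Set.finite_singleton x
  | .lam _ N => Tm.finite_fv N
  | .lift N => Tm.finite_fv N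
  | .boxed _ _ _ => Set.finite_empty
  | .pair V V' => (Val.finite_fv V).union (Val.finite_fv V')

theorem Tm.finite_fv : ∀ N : Tm ob E, N.fv.Finite
  | .app V V' => (Val.finite_fv V).union (Val.finite_fv V')
  | .force V => Val.finite_fv V
  | .box _ V => Val.finite_fv V
  | .apply V V' => (Val.finite_fv V).union (Val.finite_fv V')
  | .dest V N => (Val.finite_fv V).union (Tm.finite_fv N)
  | .ifz V N N' => ((Val.finite_fv V).union (Tm.finite_fv N)).union (Tm.finite_fv N')
  | .ret V => Val.finite_fv V
  | .lett N N' => (Tm.finite_fv N).union (Tm.finite_fv N')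

end

theorem Val.locallyClosed_fvar (x : ℕ) : (Val.fvar x : Val ob E).LocallyClosed := fun _ _ => rfl

theorem locallyClosed_update {σ : ℕ → Val ob E} (hσ : ∀ x, (σ x).LocallyClosed) {U : Val ob E}
    (hU : U.LocallyClosed) (x y : ℕ) : (Function.update σ x U y).LocallyClosed := by
  by_cases h : y = x
  · subst h; simpa using hU
  · simpa [h] using hσ y

theorem Tm.msubst_update {σ : ℕ → Val ob E} {N : Tm ob E} {x : ℕ} (hx : x ∉ N.fv)
    (U : Val ob E) : N.msubst (Function.update σ x U) = N.msubst σ :=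
  N.msubst_congr fun _ hy => Function.update_of_ne (ne_of_mem_of_not_mem hy hx) _ _

theorem Tm.msubst_inst_update {σ : ℕ → Val ob E} (hσ : ∀ x, (σ x).LocallyClosed) {N : Tm ob E}
    {x : ℕ} {U : Val ob E} (hU : U.LocallyClosed) (hx : x ∉ N.fv) (k : ℕ) :
    (N.inst k (.fvar x)).msubst (Function.update σ x U) = (N.msubst σ).inst k U := by
  rw [Tm.msubst_inst (locallyClosed_update hσ hU x), Tm.msubst_update hx]
  simp only [Val.msubst, Function.update_self]

theorem Tm.msubst_inst_inst_update {σ : ℕ → Val ob E} (hσ : ∀ x, (σ x).LocallyClosed)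
    {N : Tm ob E} {x y : ℕ} {U U' : Val ob E} (hU : U.LocallyClosed) (hU' : U'.LocallyClosed)
    (hxy : x ≠ y) (hx : x ∉ N.fv) (hy : y ∉ N.fv) (k k' : ℕ) :
    ((N.inst k (.fvar x)).inst k' (.fvar y)).msubst
      (Function.update (Function.update σ x U) y U') = ((N.msubst σ).inst k U).inst k' U' := by
  have h := locallyClosed_update (locallyClosed_update hσ hU x) hU' y
  rw [Tm.msubst_inst h, Tm.msubst_inst h, Tm.msubst_update hy, Tm.msubst_update hx]
  simp [Val.msubst, hxy]

theorem Ctx.finite_setOf_not_fresh (Γ : Ctx W E) : {y | ¬ Γ.Fresh y}.Finite := by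
  refine ((List.finite_toSet Γ).image fun
    | .lab l _ => l
    | .var x _ => x).subset fun y hy => ?_
  obtain ⟨A, hA⟩ : ∃ A, Entry.var y A ∈ Γ := by simpa [Ctx.Fresh] using hy
  exact ⟨_, hA, rfl⟩

theorem Ctx.exists_fresh (Γ : Ctx W E) (N : Tm ob E) : ∃ y, Γ.Fresh y ∧ y ∉ N.fv := by
  obtain ⟨y, hy⟩ := (Γ.finite_setOf_not_fresh.union N.finite_fv).exists_notMem
  exact ⟨y, by simpa [not_or] using hy⟩

end Terms

/-! ### Typed terms -/

section Contexts

variable {W : Type w} {E : Type u'} [Category.{v'} E] {M : Type u} [Category.{v} M]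
  [StrictSymPremonoidal M] {ob : W → M}

theorem Ctx.wires_append (Γ Δ : Ctx W E) : Ctx.wires (Γ ++ Δ) = Γ.wires ++ Δ.wires := by
  induction Γ with
  | nil => rfl
  | cons a Γ ih => simp only [List.cons_append, Ctx.wires, ih, List.append_assoc]

theorem Ty.IsParam.wires_eq {A : Ty W E} (h : A.IsParam) : A.wires = [] := by
  induction A with
  | wire a => exact h.elim
  | tensor A B ihA ihB => simp [Ty.wires, ihA h.1, ihB h.2]
  | arrow A B T e _ _ => exact h.elim
  | _ => rfl

theorem Ctx.IsParam.wires_eq {Φ : Ctx W E} (h : Φ.IsParam) : Φ.wires = [] := by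
  induction Φ with
  | nil => rfl
  | cons a Φ ih =>
    obtain ⟨x, A, rfl, hA⟩ := h a (by simp)
    simp [Ctx.wires, Entry.ty, hA.wires_eq, ih fun b hb => h b (by simp [hb])]

theorem Ctx.IsParam.append_wires {Φ : Ctx W E} (h : Φ.IsParam) (Γ : Ctx W E) :
    Ctx.wires (Φ ++ Γ) = Γ.wires := by
  rw [Ctx.wires_append, h.wires_eq, List.nil_append]

theorem Ctx.IsParam.append {Φ Φ' : Ctx W E} (h : Φ.IsParam) (h' : Φ'.IsParam) :
    Ctx.IsParam (Φ ++ Φ') :=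
  fun a ha => (List.mem_append.1 ha).elim (h a) (h' a)

theorem Ctx.obj_congr {Γ Δ : Ctx W E} (h : Γ.wires = Δ.wires) : Γ.obj ob = Δ.obj ob := by
  rw [Ctx.obj_eq, Ctx.obj_eq, h]

theorem Ctx.obj_cons (ob : W → M) (a : Entry W E) (Γ : Ctx W E) :
    Ctx.obj ob (a :: Γ) = a.ty.obj ob ⊗ₚ Γ.obj ob := rfl

theorem Ctx.Fresh.append_var {Γ : Ctx W E} {x y : ℕ} (hy : Γ.Fresh y) (hxy : x ≠ y) (A : Ty W E) :
    Ctx.Fresh y (Γ ++ [.var x A]) := by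
  intro B hB
  rcases List.mem_append.1 hB with hB | hB
  · exact hy B hB
  · simp [hxy.symm] at hB

end Contexts

section Typed

variable {W : Type w} {E : Type u'} [Category.{v'} E] [CircuitAlgebra E]
  {M : Type u} [Category.{v} M] [StrictSymPremonoidal M] {ob : W → M} {α : Abstraction M E}

mutual

theorem VTyp.locallyClosed : {Γ : Ctx W E} → {V : Val ob E} → {A : Ty W E} → VTyp α Γ V A →
    V.LocallyClosed
  | _, _, _, .unit _ => fun _ _ => rfl
  | _, _, _, .nat _ _ => fun _ _ => rfl
  | _, _, _, .lab _ _ _ => fun _ _ => rfl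
  | _, _, _, .var _ _ _ => fun _ _ => rfl
  | _, _, _, .abs _ _ _ _ _ d => fun k U => congrArg (Val.lam _)
      (Tm.inst_eq_of_inst_inst _ (Nat.succ_ne_zero k).symm (d.locallyClosed (k + 1) U))
  | _, _, _, .lift _ d => fun k U => congrArg Val.lift (d.locallyClosed k U)
  | _, _, _, .circ _ _ _ _ _ _ _ _ => fun _ _ => rfl
  | _, _, _, .pair _ d d' => fun k U =>
    congrArg₂ Val.pair (d.locallyClosed k U) (d'.locallyClosed k U)

theorem CTyp.locallyClosed : {Γ : Ctx W E} → {N : Tm ob E} → {A : Ty W E} → {e : Eff E} →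
    CTyp α Γ N A e → N.LocallyClosed
  | _, _, _, _, .app _ d d' => fun k U =>
    congrArg₂ Tm.app (d.locallyClosed k U) (d'.locallyClosed k U)
  | _, _, _, _, .force _ d => fun k U => congrArg Tm.force (d.locallyClosed k U)
  | _, _, _, _, .box _ d => fun k U => congrArg (Tm.box _) (d.locallyClosed k U)
  | _, _, _, _, .apply _ d d' => fun k U =>
    congrArg₂ Tm.apply (d.locallyClosed k U) (d'.locallyClosed k U)
  | _, _, _, _, .dest _ _ _ _ _ _ _ _ d d' => fun k U => congrArg₂ Tm.dest (d.locallyClosed k U)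
      (Tm.inst_eq_of_inst_inst _ (by omega)
        (Tm.inst_eq_of_inst_inst _ (by omega) (d'.locallyClosed (k + 2) U)))
  | _, _, _, _, .ifz _ d d' d'' => fun k U => by
    simp only [Tm.inst, d.locallyClosed k U, d'.locallyClosed k U, d''.locallyClosed k U]
  | _, _, _, _, .ret d => fun k U => congrArg Tm.ret (d.locallyClosed k U)
  | _, _, _, _, .lett _ _ _ _ d d' _ => fun k U => congrArg₂ Tm.lett (d.locallyClosed k U)
      (Tm.inst_eq_of_inst_inst _ (Nat.succ_ne_zero k).symm (d'.locallyClosed (k + 1) U))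
  | _, _, _, _, .sub d _ => d.locallyClosed
  | _, _, _, _, .ex d _ => d.locallyClosed

end

theorem VTyp.wires_eq : {Γ : Ctx W E} → {V : Val ob E} → {A : Ty W E} → VTyp α Γ V A →
    Γ.wires = A.wires
  | _, _, _, .unit h => h.wires_eq
  | _, _, _, .nat _ h => h.wires_eq
  | _, _, _, .lab _ _ h => by simp [Ctx.wires_append, h.wires_eq, Ctx.wires, Entry.ty]
  | _, _, _, .var _ _ h => by simp [Ctx.wires_append, h.wires_eq, Ctx.wires, Entry.ty]
  | _, _, _, .abs _ _ _ _ h _ => h.symm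
  | _, _, _, .lift h _ => h.wires_eq
  | _, _, _, .circ _ _ h _ _ _ _ _ => h.wires_eq
  | _, _, _, .pair h d d' => by
    simpa [Ctx.wires_append, h.wires_eq, Ty.wires] using
      congrArg₂ (· ++ ·) d.wires_eq d'.wires_eq

end Typed

/-! ### Environments as lists -/

section Environments

variable {W : Type w} {E : Type u'} [Category.{v'} E] [CircuitAlgebra E]
  {M : Type u} [Category.{v} M] [StrictSymPremonoidal M] {ob : W → M} {α : Abstraction M E}

variable (ob α) in
/-- An entry of a context together with a value for it. -/
abbrev EnvEntry : Type (max w u' v' v) := Σ a : Entry W E, a.ty.flat ob α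

/-- The list of the entries of an environment. -/
def Ctx.envList : {Γ : Ctx W E} → Γ.flat ob α → List (EnvEntry ob α)
  | [], _ => []
  | a :: _, g => ⟨a, g.1⟩ :: Ctx.envList g.2

theorem Ctx.envList_fst : ∀ {Γ : Ctx W E} (g : Γ.flat ob α),
    (Ctx.envList g).map Sigma.fst = Γ
  | [], _ => rfl
  | _ :: _, g => congrArg (List.cons _) (Ctx.envList_fst g.2)

@[simp] theorem Ctx.length_envList {Γ : Ctx W E} (g : Γ.flat ob α) :
    (Ctx.envList g).length = Γ.length := by
  conv_rhs => rw [← Ctx.envList_fst g, List.length_map]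

@[simp] theorem Ctx.envList_join : ∀ {Γ Δ : Ctx W E} (g : Γ.flat ob α) (d : Δ.flat ob α),
    Ctx.envList (Ctx.join g d) = Ctx.envList g ++ Ctx.envList d
  | [], _, _, _ => rfl
  | _ :: _, _, g, d => congrArg (List.cons _) (Ctx.envList_join g.2 d)

theorem Ctx.envList_split : ∀ {Γ Δ : Ctx W E} (g : Ctx.flat ob α (Γ ++ Δ)),
    Ctx.envList g = Ctx.envList (Ctx.split Γ g).1 ++ Ctx.envList (Ctx.split Γ g).2
  | [], _, _ => rfl
  | _ :: _, _, g => congrArg (List.cons _) (Ctx.envList_split g.2)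

theorem Ctx.envList_split_eq {Γ Δ : Ctx W E} {g : Ctx.flat ob α (Γ ++ Δ)}
    {ρ ρ' : List (EnvEntry ob α)} (h : Ctx.envList g = ρ ++ ρ') (hρ : ρ.length = Γ.length) :
    Ctx.envList (Ctx.split Γ g).1 = ρ ∧ Ctx.envList (Ctx.split Γ g).2 = ρ' := by
  rw [Ctx.envList_split] at h
  exact List.append_inj h (by simp [hρ])

theorem Ctx.envList_swapFlat : ∀ {Γ Δ : Ctx W E} {a b : Entry W E}
    {g : Ctx.flat ob α (Γ ++ a :: b :: Δ)} {ρ ρ' : List (EnvEntry ob α)} {s t : EnvEntry ob α},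
    Ctx.envList g = ρ ++ s :: t :: ρ' → ρ.length = Γ.length →
    Ctx.envList (Ctx.swapFlat Γ g) = ρ ++ t :: s :: ρ'
  | [], _, _, _, g, ρ, ρ', s, t, h, hρ => by
    obtain rfl := List.eq_nil_of_length_eq_zero hρ
    injection h with h₁ h₂
    injection h₂ with h₂ h₃
    subst h₁ h₂ h₃
    rfl
  | c :: Γ, _, _, _, g, ρ, ρ', s, t, h, hρ => by
    cases ρ with
    | nil => simp at hρ
    | cons r ρ =>
      injection h with h₁ h₂
      have := Ctx.envList_swapFlat (Γ := Γ) (g := g.2) h₂ (by simpa using hρ)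
      subst h₁
      exact congrArg (List.cons _) this

end Environments

/-! ### Exchange of blocks -/

section BlockSwap

variable {W : Type w} {E : Type u'} [Category.{v'} E] {M : Type u} [Category.{v} M]
  [StrictSymPremonoidal M] {ob : W → M}

variable (ob) in
/-- The symmetry exchanging the adjacent blocks `Δ` and `Δ'` of a context. -/
def Ctx.blockSwap (Γ₁ Δ Δ' Γ₂ : Ctx W E) : Eff M :=
  ((Eff.braid (Δ.obj ob) (Δ'.obj ob)).rwhisk (Γ₂.obj ob)).lwhisk (Γ₁.obj ob)

theorem Ctx.blockSwap_nil_left (Γ₁ Δ Γ₂ : Ctx W E) :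
    Ctx.blockSwap ob Γ₁ [] Δ Γ₂ = Eff.of (𝟙 (Ctx.obj ob (Γ₁ ++ (Δ ++ Γ₂)))) := by
  simp only [Ctx.blockSwap, listObj_nil, Eff.braid_unit_left, Eff.rwhisk_id, Eff.lwhisk_id]
  exact Eff.of_id_congr (by rw [Ctx.obj_append, Ctx.obj_append])

theorem Ctx.blockSwap_nil_right (Γ₁ Δ Γ₂ : Ctx W E) :
    Ctx.blockSwap ob Γ₁ Δ [] Γ₂ = Eff.of (𝟙 (Ctx.obj ob (Γ₁ ++ (Δ ++ Γ₂)))) := by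
  simp only [Ctx.blockSwap, listObj_nil, Eff.braid_unit_right, Eff.rwhisk_id, Eff.lwhisk_id]
  exact Eff.of_id_congr (by rw [Ctx.obj_append, Ctx.obj_append])

theorem Ctx.blockSwap_singleton (Γ₁ : Ctx W E) (a b : Entry W E) (Γ₂ : Ctx W E) :
    Ctx.blockSwap ob Γ₁ [a] [b] Γ₂ = swapEff (fun c : Entry W E => c.ty.obj ob) Γ₁ a b Γ₂ := by
  simp only [Ctx.blockSwap, Ctx.obj_single, swapEff]

theorem Ctx.blockSwap_cons_left (Γ₁ : Ctx W E) (b : Entry W E) (Δ' Δ Γ₂ : Ctx W E) :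
    Ctx.blockSwap ob Γ₁ (b :: Δ') Δ Γ₂ =
      Ctx.blockSwap ob (Γ₁ ++ [b]) Δ' Δ Γ₂ ⋆ Ctx.blockSwap ob Γ₁ [b] Δ (Δ' ++ Γ₂) := by
  rw [Ctx.blockSwap, Ctx.obj_cons, Eff.braid_tensor_left,
    Eff.rwhisk_comp _ (by simp [tensor_assoc]), Eff.lwhisk_comp _ (by simp [tensor_assoc])]
  simp only [Ctx.blockSwap, Ctx.obj_append, Ctx.obj_single, Eff.rwhisk_tensor,
    Eff.lwhisk_tensor, Eff.rwhisk_lwhisk]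

theorem Ctx.blockSwap_cons_right (Γ₁ Δ' : Ctx W E) (a : Entry W E) (Δ Γ₂ : Ctx W E) :
    Ctx.blockSwap ob Γ₁ Δ' (a :: Δ) Γ₂ =
      Ctx.blockSwap ob Γ₁ Δ' [a] (Δ ++ Γ₂) ⋆ Ctx.blockSwap ob (Γ₁ ++ [a]) Δ' Δ Γ₂ := by
  rw [Ctx.blockSwap, Ctx.obj_cons, Eff.braid_tensor_right,
    Eff.rwhisk_comp _ (by simp [tensor_assoc]), Eff.lwhisk_comp _ (by simp [tensor_assoc])]
  simp only [Ctx.blockSwap, Ctx.obj_append, Ctx.obj_single, Eff.rwhisk_tensor,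
    Eff.lwhisk_tensor, Eff.rwhisk_lwhisk]

end BlockSwap

section Exchange

variable {W : Type w} {E : Type u'} [Category.{v'} E] [CircuitAlgebra E]
  {M : Type u} [Category.{v} M] [StrictSymPremonoidal M] {ob : W → M} {α : Abstraction M E}

/-- The image of a packaged circuit under an abstraction. -/
def Abstraction.mapEff (α : Abstraction M E) (P : Eff M) : Eff E := Eff.of (α.map P.hom)

@[simp] theorem Abstraction.mapEff_dom (P : Eff M) : (α.mapEff P).dom = α.obj P.dom := rfl
@[simp] theorem Abstraction.mapEff_cod (P : Eff M) : (α.mapEff P).cod = α.obj P.cod := rfl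

theorem Abstraction.mapEff_of {X Y : M} (f : X ⟶ Y) : α.mapEff (Eff.of f) = Eff.of (α.map f) := rfl

theorem Abstraction.mapEff_comp {P P' : Eff M} (h : P.cod = P'.dom) :
    α.mapEff (P ⋆ P') = α.mapEff P ⋆ α.mapEff P' := by
  obtain ⟨X, Y, f⟩ := P
  obtain ⟨Y', Z, g⟩ := P'
  dsimp only at h
  subst h
  rw [← Eff.of_comp]
  simp only [Abstraction.mapEff, α.map_comp, Eff.of_comp]

variable (α) in
/-- Derivations in the context `Γ` can be turned into derivations in the context `Γ'`, by
composing their environments with `F` and their circuits with `P`. -/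
structure Exchange (Γ Γ' : Ctx W E) (F : Γ'.flat ob α → Γ.flat ob α) (P : Eff M) : Prop where
  dom_eq : P.dom = Γ'.obj ob
  cod_eq : P.cod = Γ.obj ob
  exists_derivation {N : Tm ob E} {A : Ty W E} {e e' : Eff E} (d : CTyp α Γ N A e) :
    α.obj (Γ.obj ob) = e.dom → e' = α.mapEff P ⋆ e →
    ∃ d' : CTyp α Γ' N A e', ∀ g, (d'.interp g).1 = (d.interp (F g)).1 ∧
      Eff.of (d'.interp g).2.1 = P ⋆ Eff.of (d.interp (F g)).2.1

theorem Exchange.refl (Γ : Ctx W E) :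
    Exchange (ob := ob) α Γ Γ id (Eff.of (𝟙 (Γ.obj ob))) := by
  refine ⟨rfl, rfl, fun {N A e e'} d h he => ?_⟩
  obtain rfl : e' = e := by
    rw [he, Abstraction.mapEff_of, α.map_id]
    exact Eff.id_comp h
  exact ⟨d, fun g => ⟨rfl, (Eff.id_comp rfl).symm⟩⟩

theorem Exchange.trans {Γ Γ' Γ'' : Ctx W E} {F : Γ'.flat ob α → Γ.flat ob α}
    {F' : Γ''.flat ob α → Γ'.flat ob α} {P P' : Eff M} (h : Exchange α Γ Γ' F P)
    (h' : Exchange α Γ' Γ'' F' P') : Exchange α Γ Γ'' (F ∘ F') (P' ⋆ P) := by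
  have hP : P'.cod = P.dom := h'.cod_eq.trans h.dom_eq.symm
  refine ⟨by simp [h'.dom_eq], by rw [Eff.comp_cod hP, h.cod_eq], fun {N A e e'} d hd he => ?_⟩
  obtain ⟨d₁, hd₁⟩ := h.exists_derivation d hd rfl
  obtain ⟨d₂, hd₂⟩ := h'.exists_derivation (e' := e') d₁ (by simp [h.dom_eq])
    (by rw [he, Abstraction.mapEff_comp hP, Eff.comp_assoc (by simp [hP])])
  refine ⟨d₂, fun g => ⟨(hd₂ g).1.trans (hd₁ _).1, ?_⟩⟩
  rw [(hd₂ g).2, (hd₁ _).2, Eff.comp_assoc hP]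
  rfl

theorem Exchange.swap (Γ : Ctx W E) (a b : Entry W E) (Δ : Ctx W E) :
    Exchange (ob := ob) α (Γ ++ a :: b :: Δ) (Γ ++ b :: a :: Δ) (Ctx.swapFlat Γ)
      (Ctx.blockSwap ob Γ [b] [a] Δ) := by
  rw [Ctx.blockSwap_singleton, ← of_swapHom]
  refine ⟨rfl, rfl, fun {N A e e'} d h he => ?_⟩
  obtain rfl := he.trans (Eff.comp_eq h)
  exact ⟨.ex d h, fun g => ⟨rfl, Eff.of_comp _ _⟩⟩

/-- The function `F` between environments exchanges the blocks of lengths `m` and `n` that follow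
the first `k` entries. -/
def SwapsBlocks (k m n : ℕ) {Γ Γ' : Ctx W E} (F : Γ'.flat ob α → Γ.flat ob α) : Prop :=
  ∀ g ρ₁ δ' δ ρ₂, Ctx.envList g = ρ₁ ++ (δ' ++ (δ ++ ρ₂)) → ρ₁.length = k → δ'.length = m →
    δ.length = n → Ctx.envList (F g) = ρ₁ ++ (δ ++ (δ' ++ ρ₂))

theorem swapsBlocks_id_left (k n : ℕ) (Γ : Ctx W E) :
    SwapsBlocks k 0 n (id : Γ.flat ob α → Γ.flat ob α) := by
  intro g ρ₁ δ' δ ρ₂ hg _ hδ' _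
  obtain rfl := List.eq_nil_of_length_eq_zero hδ'
  exact hg

theorem swapsBlocks_id_right (k m : ℕ) (Γ : Ctx W E) :
    SwapsBlocks k m 0 (id : Γ.flat ob α → Γ.flat ob α) := by
  intro g ρ₁ δ' δ ρ₂ hg _ _ hδ
  obtain rfl := List.eq_nil_of_length_eq_zero hδ
  exact hg

theorem swapsBlocks_swapFlat (Γ : Ctx W E) (a b : Entry W E) (Δ : Ctx W E) :
    SwapsBlocks Γ.length 1 1
      (Ctx.swapFlat Γ : Ctx.flat ob α (Γ ++ b :: a :: Δ) → Ctx.flat ob α (Γ ++ a :: b :: Δ)) := by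
  intro g ρ₁ δ' δ ρ₂ hg hρ₁ hδ' hδ
  obtain ⟨s, rfl⟩ := List.length_eq_one_iff.1 hδ'
  obtain ⟨t, rfl⟩ := List.length_eq_one_iff.1 hδ
  exact Ctx.envList_swapFlat hg hρ₁

theorem SwapsBlocks.succ_left {k m n : ℕ} {Γ Γ' Γ'' : Ctx W E} {F : Γ'.flat ob α → Γ.flat ob α}
    {F' : Γ''.flat ob α → Γ'.flat ob α} (hF : SwapsBlocks k 1 n F)
    (hF' : SwapsBlocks (k + 1) m n F') : SwapsBlocks k (m + 1) n (F ∘ F') := by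
  intro g ρ₁ δ' δ ρ₂ hg hρ₁ hδ' hδ
  obtain ⟨s, δ', rfl⟩ := List.exists_cons_of_length_eq_add_one hδ'
  have h := hF' g (ρ₁ ++ [s]) δ' δ ρ₂ (by simpa using hg) (by simp [hρ₁]) (by simpa using hδ') hδ
  exact hF _ ρ₁ [s] δ (δ' ++ ρ₂) (by simpa using h) hρ₁ rfl hδ

theorem SwapsBlocks.succ_right {k m n : ℕ} {Γ Γ' Γ'' : Ctx W E} {F : Γ'.flat ob α → Γ.flat ob α}
    {F' : Γ''.flat ob α → Γ'.flat ob α} (hF : SwapsBlocks (k + 1) m n F)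
    (hF' : SwapsBlocks k m 1 F') : SwapsBlocks k m (n + 1) (F ∘ F') := by
  intro g ρ₁ δ' δ ρ₂ hg hρ₁ hδ' hδ
  obtain ⟨t, δ, rfl⟩ := List.exists_cons_of_length_eq_add_one hδ
  have h := hF' g ρ₁ δ' [t] (δ ++ ρ₂) hg hρ₁ hδ' rfl
  simpa using hF _ (ρ₁ ++ [t]) δ' δ ρ₂ (by simpa using h) (by simp [hρ₁]) hδ' (by simpa using hδ)

theorem exists_exchange_singleton (b : Entry W E) (Δ Γ₂ : Ctx W E) : ∀ (Γ₁ Γ Γ' : Ctx W E),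
    Γ = Γ₁ ++ (Δ ++ ([b] ++ Γ₂)) → Γ' = Γ₁ ++ ([b] ++ (Δ ++ Γ₂)) →
    ∃ F : Γ'.flat ob α → Γ.flat ob α, Exchange α Γ Γ' F (Ctx.blockSwap ob Γ₁ [b] Δ Γ₂) ∧
      SwapsBlocks Γ₁.length 1 Δ.length F := by
  induction Δ with
  | nil =>
    rintro Γ₁ _ Γ' rfl rfl
    exact ⟨id, by rw [Ctx.blockSwap_nil_right]; exact .refl _, swapsBlocks_id_right _ _ _⟩
  | cons a Δ ih =>
    rintro Γ₁ Γ _ hΓ rfl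
    obtain ⟨F, hF, hF'⟩ := ih (Γ₁ ++ [a]) Γ (Γ₁ ++ a :: b :: (Δ ++ Γ₂)) (by simp [hΓ]) (by simp)
    refine ⟨F ∘ Ctx.swapFlat Γ₁, ?_, ?_⟩
    · rw [Ctx.blockSwap_cons_right]
      exact hF.trans (.swap Γ₁ a b (Δ ++ Γ₂))
    · exact .succ_right (by simpa using hF') (swapsBlocks_swapFlat Γ₁ a b (Δ ++ Γ₂))

theorem exists_exchange (Δ Δ' Γ₂ : Ctx W E) : ∀ (Γ₁ Γ Γ' : Ctx W E),
    Γ = Γ₁ ++ (Δ ++ (Δ' ++ Γ₂)) → Γ' = Γ₁ ++ (Δ' ++ (Δ ++ Γ₂)) →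
    ∃ F : Γ'.flat ob α → Γ.flat ob α, Exchange α Γ Γ' F (Ctx.blockSwap ob Γ₁ Δ' Δ Γ₂) ∧
      SwapsBlocks Γ₁.length Δ'.length Δ.length F := by
  induction Δ' with
  | nil =>
    rintro Γ₁ _ Γ' rfl rfl
    exact ⟨id, by rw [Ctx.blockSwap_nil_left]; exact .refl _, swapsBlocks_id_left _ _ _⟩
  | cons b Δ' ih =>
    rintro Γ₁ Γ Γ' hΓ hΓ'
    obtain ⟨F, hF, hF₁⟩ := exists_exchange_singleton (ob := ob) (α := α) b Δ (Δ' ++ Γ₂) Γ₁ Γ _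
      (by simp [hΓ]) rfl
    obtain ⟨F', hF', hF₁'⟩ := ih (Γ₁ ++ [b]) (Γ₁ ++ ([b] ++ (Δ ++ (Δ' ++ Γ₂)))) Γ' (by simp)
      (by simp [hΓ'])
    exact ⟨F ∘ F', by rw [Ctx.blockSwap_cons_left]; exact hF.trans hF',
      hF₁.succ_left (by simpa using hF₁')⟩

end Exchange

/-! ### Translations of contexts -/

section Translation

variable {W : Type w} {E : Type u'} [Category.{v'} E] [CircuitAlgebra E]
  {M : Type u} [Category.{v} M] [StrictSymPremonoidal M] (ob : W → M) (α : Abstraction M E)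

/-- A translation replaces the variables of a term by values and, accordingly, every entry of a
context or of an environment by a block of entries. Renaming of bound variables, weakening and
substitution are the instances that are needed. -/
structure Translation where
  σ : ℕ → Val ob E
  block : Entry W E → Ctx W E
  envBlock : EnvEntry ob α → List (EnvEntry ob α)
  /-- Replacing a variable by a value preserves meanings only in the environments that assign the
  meaning of the value to the variable; this predicate excludes the others. -/
  Admissible : EnvEntry ob α → Prop
  locallyClosed : ∀ x, (σ x).LocallyClosed

variable {ob α}

/-- The value by which the substitution `σ` replaces the label or variable of an entry. -/
def Entry.val (σ : ℕ → Val ob E) : Entry W E → Val ob E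
  | .lab l _ => .lab l
  | .var x _ => σ x

/-- For every environment that consists of an environment of `Φ` and of `f v`, the meaning of the
derivation `t` is `v`, provided that `P v` holds. -/
def VTyp.EvaluatesTo {Φ Δ : Ctx W E} {V : Val ob E} {A : Ty W E} (t : VTyp α (Φ ++ Δ) V A)
    (f : A.flat ob α → List (EnvEntry ob α)) (P : A.flat ob α → Prop) : Prop :=
  ∀ g φ v, P v → Ctx.envList g = φ ++ f v → φ.length = Φ.length → t.interp g = v

theorem VTyp.evaluatesTo_var {Φ : Ctx W E} (hΦ : Φ.IsParam) (x : ℕ) (A : Ty W E)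
    (P : A.flat ob α → Prop) :
    (VTyp.var x A hΦ : VTyp α (Φ ++ [.var x A]) (.fvar x) A).EvaluatesTo
      (fun v => [⟨.var x A, v⟩]) P := by
  intro g φ v _ hg hφ
  have h := (List.cons.inj (Ctx.envList_split_eq hg hφ).2).1
  injection h with _ h

namespace Translation

/-- The block of the entry `a` types the value replacing `a`, and evaluates it correctly in all
admissible environments. -/
structure CorrectAt (τ : Translation ob α) (a : Entry W E) : Prop where
  wires_block : (τ.block a).wires = a.ty.wires
  isParam_block : ∀ x A, a = .var x A → A.IsParam → (τ.block a).IsParam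
  fst_envBlock : ∀ v, (τ.envBlock ⟨a, v⟩).map Sigma.fst = τ.block a
  exists_typing : ∀ Φ : Ctx W E, Φ.IsParam → ∃ t : VTyp α (Φ ++ τ.block a) (a.val τ.σ) a.ty,
    t.EvaluatesTo (fun v => τ.envBlock ⟨a, v⟩) (fun v => τ.Admissible ⟨a, v⟩)

/-- The environment `ρ'` is the translation of the admissible environment `ρ`, preceded by `n`
further entries. -/
def Rel (τ : Translation ob α) (n : ℕ) (ρ ρ' : List (EnvEntry ob α)) : Prop :=
  (∀ s ∈ ρ, τ.Admissible s) ∧ ∃ ψ, ψ.length = n ∧ ρ' = ψ ++ ρ.flatMap τ.envBlock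

section Basic

variable {τ : Translation ob α}

theorem CorrectAt.length_envBlock {a : Entry W E} (h : τ.CorrectAt a) (v : a.ty.flat ob α) :
    (τ.envBlock ⟨a, v⟩).length = (τ.block a).length := by
  rw [← h.fst_envBlock v, List.length_map]

theorem CorrectAt.obj_block {a : Entry W E} (h : τ.CorrectAt a) :
    Ctx.obj ob (τ.block a) = a.ty.obj ob := by
  rw [Ctx.obj_eq, h.wires_block, Ty.obj_eq]

theorem wires_flatMap_block {Γ : Ctx W E} (h : ∀ a ∈ Γ, τ.CorrectAt a) :
    Ctx.wires (Γ.flatMap τ.block) = Γ.wires := by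
  induction Γ with
  | nil => rfl
  | cons a Γ ih =>
    obtain ⟨ha, hΓ⟩ := List.forall_mem_cons.1 h
    rw [List.flatMap_cons, Ctx.wires_append, ha.wires_block, ih hΓ]
    rfl

theorem isParam_flatMap_block {Φ : Ctx W E} (h : ∀ a ∈ Φ, τ.CorrectAt a) (hΦ : Φ.IsParam) :
    Ctx.IsParam (Φ.flatMap τ.block) := by
  intro b hb
  obtain ⟨a, ha, hb⟩ := List.mem_flatMap.1 hb
  obtain ⟨x, A, hx, hA⟩ := hΦ a ha
  exact (h a ha).isParam_block x A hx hA b hb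

theorem length_flatMap_envBlock {Γ : Ctx W E} (h : ∀ a ∈ Γ, τ.CorrectAt a) (g : Γ.flat ob α) :
    ((Ctx.envList g).flatMap τ.envBlock).length = (Γ.flatMap τ.block).length := by
  induction Γ with
  | nil => rfl
  | cons a Γ ih =>
    obtain ⟨ha, hΓ⟩ := List.forall_mem_cons.1 h
    rw [Ctx.envList, List.flatMap_cons, List.flatMap_cons, List.length_append,
      List.length_append, ih hΓ, ha.length_envBlock]

theorem Rel.append {n : ℕ} {ρ₁ ρ₂ ρ₁' ρ₂' : List (EnvEntry ob α)} (h : τ.Rel n ρ₁ ρ₁')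
    (h' : τ.Rel 0 ρ₂ ρ₂') : τ.Rel n (ρ₁ ++ ρ₂) (ρ₁' ++ ρ₂') := by
  obtain ⟨hρ₁, ψ, hψ, rfl⟩ := h
  obtain ⟨hρ₂, ψ', hψ', rfl⟩ := h'
  obtain rfl := List.eq_nil_of_length_eq_zero hψ'
  exact ⟨List.forall_mem_append.2 ⟨hρ₁, hρ₂⟩, ψ, hψ, by simp⟩

theorem Rel.join {Γ Δ Γ' Δ' : Ctx W E} {n : ℕ} {g : Γ.flat ob α} {d : Δ.flat ob α}
    {g' : Γ'.flat ob α} {d' : Δ'.flat ob α} (h : τ.Rel n (Ctx.envList g) (Ctx.envList g'))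
    (h' : τ.Rel 0 (Ctx.envList d) (Ctx.envList d')) :
    τ.Rel n (Ctx.envList (Ctx.join g d)) (Ctx.envList (Ctx.join g' d')) := by
  rw [Ctx.envList_join, Ctx.envList_join]
  exact h.append h'

theorem Rel.split {Γ Δ Γ' Δ' : Ctx W E} {n : ℕ} {g : Ctx.flat ob α (Γ ++ Δ)}
    {g' : Ctx.flat ob α (Γ' ++ Δ')} (h : τ.Rel n (Ctx.envList g) (Ctx.envList g'))
    (hΓ : ∀ a ∈ Γ, τ.CorrectAt a) (hΓ' : Γ'.length = n + (Γ.flatMap τ.block).length) :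
    τ.Rel n (Ctx.envList (Ctx.split Γ g).1) (Ctx.envList (Ctx.split Γ' g').1) ∧
      τ.Rel 0 (Ctx.envList (Ctx.split Γ g).2) (Ctx.envList (Ctx.split Γ' g').2) := by
  obtain ⟨hρ, ψ, hψ, h⟩ := h
  rw [Ctx.envList_split (Γ := Γ)] at hρ h
  rw [List.flatMap_append, ← List.append_assoc] at h
  obtain ⟨h₁, h₂⟩ := Ctx.envList_split_eq h
    (by rw [List.length_append, length_flatMap_envBlock hΓ, hψ, hΓ'])
  obtain ⟨hρ₁, hρ₂⟩ := List.forall_mem_append.1 hρ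
  exact ⟨⟨hρ₁, ψ, hψ, h₁⟩, ⟨hρ₂, [], rfl, h₂⟩⟩

theorem Rel.split_append {Φ Γ Δ Φ' : Ctx W E} {n : ℕ} {g : Ctx.flat ob α (Φ ++ (Γ ++ Δ))}
    {g' : Ctx.flat ob α (Φ' ++ (Γ.flatMap τ.block ++ Δ.flatMap τ.block))}
    (h : τ.Rel n (Ctx.envList g) (Ctx.envList g')) (hΦ : ∀ a ∈ Φ, τ.CorrectAt a)
    (hΓ : ∀ a ∈ Γ, τ.CorrectAt a) (hΦ' : Φ'.length = n + (Φ.flatMap τ.block).length) :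
    τ.Rel n (Ctx.envList (Ctx.join (Ctx.split Φ g).1 (Ctx.split Γ (Ctx.split Φ g).2).1))
        (Ctx.envList (Ctx.join (Ctx.split Φ' g').1 (Ctx.split _ (Ctx.split Φ' g').2).1)) ∧
      τ.Rel n (Ctx.envList (Ctx.join (Ctx.split Φ g).1 (Ctx.split Γ (Ctx.split Φ g).2).2))
        (Ctx.envList (Ctx.join (Ctx.split Φ' g').1 (Ctx.split _ (Ctx.split Φ' g').2).2)) := by
  obtain ⟨hφ, hγδ⟩ := h.split hΦ hΦ'
  obtain ⟨hγ, hδ⟩ := hγδ.split hΓ (Nat.zero_add _).symm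
  exact ⟨hφ.join hγ, hφ.join hδ⟩

end Basic

/-- The translations `τ'` and `τ` treat the entry `a` in the same way. -/
structure AgreeAt (τ' τ : Translation ob α) (a : Entry W E) : Prop where
  val_eq : a.val τ'.σ = a.val τ.σ
  block_eq : τ'.block a = τ.block a
  envBlock_eq : ∀ v, τ'.envBlock ⟨a, v⟩ = τ.envBlock ⟨a, v⟩
  admissible_eq : ∀ v, τ'.Admissible ⟨a, v⟩ = τ.Admissible ⟨a, v⟩

section Agree

variable {τ τ' : Translation ob α}

theorem AgreeAt.correctAt {a : Entry W E} (h : τ'.AgreeAt τ a) (ha : τ.CorrectAt a) :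
    τ'.CorrectAt a where
  wires_block := by rw [h.block_eq, ha.wires_block]
  isParam_block := by rw [h.block_eq]; exact ha.isParam_block
  fst_envBlock v := by rw [h.envBlock_eq, h.block_eq, ha.fst_envBlock]
  exists_typing Φ hΦ := by
    rw [h.block_eq, h.val_eq]
    simpa only [h.envBlock_eq, h.admissible_eq] using ha.exists_typing Φ hΦ

theorem flatMap_block_congr {Γ : Ctx W E} (h : ∀ a ∈ Γ, τ'.AgreeAt τ a) :
    Γ.flatMap τ'.block = Γ.flatMap τ.block :=
  List.flatMap_congr fun a ha => (h a ha).block_eq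

theorem Rel.congr {n : ℕ} {ρ ρ' : List (EnvEntry ob α)} (hρ : τ.Rel n ρ ρ')
    (h : ∀ s ∈ ρ, τ'.AgreeAt τ s.1) : τ'.Rel n ρ ρ' := by
  obtain ⟨hρ, ψ, hψ, rfl⟩ := hρ
  exact ⟨fun s hs => (h s hs).admissible_eq s.2 ▸ hρ s hs, ψ, hψ,
    congrArg _ (List.flatMap_congr fun s hs => ((h s hs).envBlock_eq s.2).symm)⟩

end Agree

section Update

open Classical in
/-- The translation `τ`, changed at the variable `x` of type `A`: it is replaced by the value `U`,
its block is `Δ`, and a value `v` of `x` is translated to the environment `f v` if `P v` holds. -/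
noncomputable def update (τ : Translation ob α) (x : ℕ) (A : Ty W E) {U : Val ob E}
    (hU : U.LocallyClosed) (Δ : Ctx W E) (f : A.flat ob α → List (EnvEntry ob α))
    (P : A.flat ob α → Prop) : Translation ob α where
  σ := Function.update τ.σ x U
  block a := if a = .var x A then Δ else τ.block a
  envBlock s := if h : s.1 = .var x A then f (h ▸ s.2 : (Entry.var x A).ty.flat ob α)
    else τ.envBlock s
  Admissible s := if h : s.1 = .var x A then P (h ▸ s.2 : (Entry.var x A).ty.flat ob α)
    else τ.Admissible s
  locallyClosed := locallyClosed_update τ.locallyClosed hU x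

variable {τ : Translation ob α} {x : ℕ} {A : Ty W E} {U : Val ob E} {hU : U.LocallyClosed}
  {Δ : Ctx W E} {f : A.flat ob α → List (EnvEntry ob α)} {P : A.flat ob α → Prop}

theorem update_val_self : (Entry.var x A).val (τ.update x A hU Δ f P).σ = U := by
  simp only [Entry.val, update, Function.update_self]

theorem update_block_self : (τ.update x A hU Δ f P).block (.var x A) = Δ := if_pos rfl

theorem update_envBlock_self (v : (Entry.var x A).ty.flat ob α) :
    (τ.update x A hU Δ f P).envBlock ⟨.var x A, v⟩ = f v := dif_pos rfl

theorem update_admissible_self (v : (Entry.var x A).ty.flat ob α) :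
    (τ.update x A hU Δ f P).Admissible ⟨.var x A, v⟩ = P v := dif_pos rfl

theorem agreeAt_update {a : Entry W E} (ha : ∀ B, a ≠ .var x B) :
    (τ.update x A hU Δ f P).AgreeAt τ a where
  val_eq := by
    cases a with
    | lab l c => rfl
    | var y B =>
      have hy : y ≠ x := fun h => ha B (h ▸ rfl)
      exact Function.update_of_ne hy U τ.σ
  block_eq := if_neg (ha A)
  envBlock_eq _ := dif_neg (ha A)
  admissible_eq _ := dif_neg (ha A)

theorem agreeAt_update_of_fresh {Γ : Ctx W E} (hx : Γ.Fresh x) :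
    ∀ a ∈ Γ, (τ.update x A hU Δ f P).AgreeAt τ a :=
  fun _ ha => agreeAt_update fun B hB => hx B (hB ▸ ha)

theorem correctAt_update_self (hΔ : Δ.wires = A.wires) (hA : A.IsParam → Δ.IsParam)
    (hf : ∀ v, (f v).map Sigma.fst = Δ)
    (ht : ∀ Φ : Ctx W E, Φ.IsParam → ∃ t : VTyp α (Φ ++ Δ) U A, t.EvaluatesTo f P) :
    (τ.update x A hU Δ f P).CorrectAt (.var x A) where
  wires_block := by rw [update_block_self]; exact hΔ
  isParam_block := by
    rintro _ _ ⟨⟩ h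
    rw [update_block_self]
    exact hA h
  fst_envBlock v := by
    rw [update_envBlock_self, update_block_self]
    exact hf v
  exists_typing Φ hΦ := by
    rw [update_block_self, update_val_self]
    obtain ⟨t, ht⟩ := ht Φ hΦ
    exact ⟨t, fun g φ v hv hg => ht g φ v ((update_admissible_self v).mp hv)
      (hg.trans (congrArg (φ ++ ·) (update_envBlock_self v)))⟩

theorem correctAt_update_append {Γ : Ctx W E} (hΓ : ∀ a ∈ Γ, τ.CorrectAt a) (hx : Γ.Fresh x)
    (h : (τ.update x A hU Δ f P).CorrectAt (.var x A)) :
    ∀ a ∈ Γ ++ [Entry.var x A], (τ.update x A hU Δ f P).CorrectAt a :=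
  List.forall_mem_append.2 ⟨fun a ha => (agreeAt_update_of_fresh hx a ha).correctAt (hΓ a ha),
    List.forall_mem_singleton.2 h⟩

theorem flatMap_update_append {Γ : Ctx W E} (hx : Γ.Fresh x) :
    (Γ ++ [Entry.var x A]).flatMap (τ.update x A hU Δ f P).block = Γ.flatMap τ.block ++ Δ := by
  rw [List.flatMap_append, flatMap_block_congr (agreeAt_update_of_fresh hx),
    List.flatMap_singleton, update_block_self]

theorem Rel.update_append {n : ℕ} {ρ ρ' : List (EnvEntry ob α)} (h : τ.Rel n ρ ρ')
    (hx : Ctx.Fresh x (ρ.map Sigma.fst)) {v : A.flat ob α} (hv : P v) :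
    (τ.update x A hU Δ f P).Rel n (ρ ++ [⟨.var x A, v⟩]) (ρ' ++ f v) := by
  refine (h.congr fun s hs => agreeAt_update_of_fresh hx _ (List.mem_map_of_mem hs)).append
    ⟨?_, [], rfl, ?_⟩
  · exact List.forall_mem_singleton.2 ((update_admissible_self v).symm ▸ hv)
  · exact (update_envBlock_self v).symm.trans (List.flatMap_singleton _ _).symm

end Update

section Bind

/-- The translation `τ`, extended to a bound variable `x` of type `A`, which is renamed to `y`. -/
noncomputable def bind (τ : Translation ob α) (x y : ℕ) (A : Ty W E) : Translation ob α :=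
  τ.update x A (Val.locallyClosed_fvar y) [.var y A] (fun v => [⟨.var y A, v⟩]) fun _ => True

variable {τ : Translation ob α} {x : ℕ} {A : Ty W E} {Γ : Ctx W E}

theorem correctAt_bind_append (hΓ : ∀ a ∈ Γ, τ.CorrectAt a) (hx : Γ.Fresh x) (y : ℕ) :
    ∀ a ∈ Γ ++ [Entry.var x A], (τ.bind x y A).CorrectAt a := by
  refine correctAt_update_append hΓ hx (correctAt_update_self ?_ ?_ ?_ ?_)
  · exact List.append_nil _
  · exact fun hA => List.forall_mem_singleton.2 ⟨y, A, rfl, hA⟩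
  · exact fun _ => rfl
  · exact fun Φ hΦ => ⟨.var y A hΦ, VTyp.evaluatesTo_var hΦ y A _⟩

theorem flatMap_bind_append (hx : Γ.Fresh x) (y : ℕ) :
    (Γ ++ [Entry.var x A]).flatMap (τ.bind x y A).block = Γ.flatMap τ.block ++ [.var y A] :=
  flatMap_update_append hx

theorem Rel.bind_append {n : ℕ} {ρ ρ' : List (EnvEntry ob α)} (h : τ.Rel n ρ ρ')
    (hx : Ctx.Fresh x (ρ.map Sigma.fst)) (y : ℕ) (v : A.flat ob α) :
    (τ.bind x y A).Rel n (ρ ++ [⟨.var x A, v⟩]) (ρ' ++ [⟨.var y A, v⟩]) :=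
  h.update_append hx trivial

end Bind

end Translation

end Translation

/-! ### Translations of derivations -/

section BoundedCircuits

variable {M : Type u} [Category.{v} M] [StrictSymPremonoidal M]
  {E : Type u'} [Category.{v'} E] [CircuitAlgebra E] {α : Abstraction M E}

theorem Circs.of_cast {e : Eff E} {X X' Y Y' : M} (hX : X' = X) (hY : Y = Y')
    (C : Circs α e X Y) : Eff.of (C.cast hX hY).1 = Eff.of C.1 :=
  (Eff.of_eqToHom_comp _ _).trans (Eff.of_comp_eqToHom _ _)

theorem Circs.of_comp {e d : Eff E} {X Y Z : M} (C : Circs α e X Y) (D : Circs α d Y Z)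
    (h : e.cod = d.dom) : Eff.of (C.comp D h).1 = Eff.of C.1 ⋆ Eff.of D.1 :=
  Eff.of_comp _ _

theorem Circs.ext_of {e : Eff E} {X Y : M} {C D : Circs α e X Y}
    (h : Eff.of C.1 = Eff.of D.1) : C = D :=
  Subtype.ext (Eff.of_injective h)

end BoundedCircuits

section Translates

variable {W : Type w} {E : Type u'} [Category.{v'} E] [CircuitAlgebra E]
  {M : Type u} [Category.{v} M] [StrictSymPremonoidal M] {ob : W → M} {α : Abstraction M E}

/-- The value derivation `d` can be translated along every correct translation, and after the
addition of parameters, to a derivation with the same meaning. -/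
def VTyp.Translates {Γ : Ctx W E} {V : Val ob E} {A : Ty W E} (d : VTyp α Γ V A) : Prop :=
  ∀ (τ : Translation ob α) (Ψ Γ' : Ctx W E), (∀ a ∈ Γ, τ.CorrectAt a) → Ψ.IsParam →
    Γ' = Ψ ++ Γ.flatMap τ.block → ∃ d' : VTyp α Γ' (V.msubst τ.σ) A, ∀ g g',
      τ.Rel Ψ.length (Ctx.envList g) (Ctx.envList g') → d'.interp g' = d.interp g

/-- The computation derivation `d` can be translated along every correct translation, and after the
addition of parameters, to a derivation with the same meaning. The circuits live in hom-sets that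
are only propositionally equal, and are compared as elements of `Eff M`. -/
def CTyp.Translates {Γ : Ctx W E} {N : Tm ob E} {A : Ty W E} {e : Eff E} (d : CTyp α Γ N A e) :
    Prop :=
  ∀ (τ : Translation ob α) (Ψ Γ' : Ctx W E), (∀ a ∈ Γ, τ.CorrectAt a) → Ψ.IsParam →
    Γ' = Ψ ++ Γ.flatMap τ.block → ∃ d' : CTyp α Γ' (N.msubst τ.σ) A e, ∀ g g',
      τ.Rel Ψ.length (Ctx.envList g) (Ctx.envList g') →
        (d'.interp g').1 = (d.interp g).1 ∧ Eff.of (d'.interp g').2.1 = Eff.of (d.interp g).2.1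

section Contexts

variable {τ : Translation ob α}

theorem Ctx.Fresh.map_fst_envList {Γ : Ctx W E} {x : ℕ} (hx : Γ.Fresh x) (g : Γ.flat ob α) :
    Ctx.Fresh x ((Ctx.envList g).map Sigma.fst) := by
  rwa [Ctx.envList_fst]

theorem Translation.isParam_append_flatMap_block {Ψ Φ : Ctx W E} (hΨ : Ψ.IsParam)
    (hΦ : Φ.IsParam) (h : ∀ a ∈ Φ, τ.CorrectAt a) : Ctx.IsParam (Ψ ++ Φ.flatMap τ.block) :=
  hΨ.append (isParam_flatMap_block h hΦ)

theorem Ctx.envList_join_var {Γ : Ctx W E} (g : Γ.flat ob α) (x : ℕ) (A : Ty W E)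
    (v : A.flat ob α) : Ctx.envList (Ctx.join (Δ := [.var x A]) g (v, PUnit.unit)) =
      Ctx.envList g ++ [⟨.var x A, v⟩] :=
  Ctx.envList_join _ _

theorem Ctx.envList_join_var_var {Γ : Ctx W E} (g : Γ.flat ob α) (x y : ℕ) (A B : Ty W E)
    (v : A.flat ob α) (v' : B.flat ob α) :
    Ctx.envList (Ctx.join (Δ := [.var x A, .var y B]) g (v, v', PUnit.unit)) =
      Ctx.envList g ++ [⟨.var x A, v⟩] ++ [⟨.var y B, v'⟩] := by
  rw [List.append_assoc]
  exact Ctx.envList_join _ _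

theorem Translation.Rel.join_var {Γ Γ' : Ctx W E} {n : ℕ} {g : Γ.flat ob α} {g' : Γ'.flat ob α}
    (h : τ.Rel n (Ctx.envList g) (Ctx.envList g')) {x : ℕ} (hx : Γ.Fresh x) (y : ℕ)
    {A : Ty W E} (v : A.flat ob α) :
    (τ.bind x y A).Rel n (Ctx.envList (Ctx.join (Δ := [.var x A]) g (v, PUnit.unit)))
      (Ctx.envList (Ctx.join (Δ := [.var y A]) g' (v, PUnit.unit))) := by
  rw [Ctx.envList_join_var, Ctx.envList_join_var]
  exact h.bind_append (hx.map_fst_envList g) y v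

theorem Translation.Rel.join_join_var {Φ Γ Φ' Γ' : Ctx W E} {n : ℕ} {f : Φ.flat ob α}
    {g : Γ.flat ob α} {f' : Φ'.flat ob α} {g' : Γ'.flat ob α}
    (h : τ.Rel n (Ctx.envList (Ctx.join f g)) (Ctx.envList (Ctx.join f' g')))
    {x : ℕ} (hx : Ctx.Fresh x (Φ ++ Γ)) (y : ℕ) {A : Ty W E} (v : A.flat ob α) :
    (τ.bind x y A).Rel n
      (Ctx.envList (Ctx.join f (Ctx.join (Δ := [.var x A]) g (v, PUnit.unit))))
      (Ctx.envList (Ctx.join f' (Ctx.join (Δ := [.var y A]) g' (v, PUnit.unit)))) := by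
  have h := h.bind_append (hx.map_fst_envList (Ctx.join f g)) y v
  rw [Ctx.envList_join, Ctx.envList_join, List.append_assoc, List.append_assoc] at h
  rwa [Ctx.envList_join, Ctx.envList_join, Ctx.envList_join_var, Ctx.envList_join_var]

theorem Translation.Rel.join_join_var_var {Φ Γ Φ' Γ' : Ctx W E} {n : ℕ} {f : Φ.flat ob α}
    {g : Γ.flat ob α} {f' : Φ'.flat ob α} {g' : Γ'.flat ob α}
    (h : τ.Rel n (Ctx.envList (Ctx.join f g)) (Ctx.envList (Ctx.join f' g')))
    {x y : ℕ} (hx : Ctx.Fresh x (Φ ++ Γ)) (hy : Ctx.Fresh y (Φ ++ Γ)) (hxy : x ≠ y)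
    (x' y' : ℕ) {A B : Ty W E} (v : A.flat ob α) (v' : B.flat ob α) :
    ((τ.bind x x' A).bind y y' B).Rel n
      (Ctx.envList (Ctx.join f (Ctx.join (Δ := [.var x A, .var y B]) g (v, v', PUnit.unit))))
      (Ctx.envList
        (Ctx.join f' (Ctx.join (Δ := [.var x' A, .var y' B]) g' (v, v', PUnit.unit)))) := by
  have h := h.join_join_var hx x' v
  have hy : Ctx.Fresh y (Φ ++ (Γ ++ [.var x A])) := by
    rw [← List.append_assoc]
    exact hy.append_var hxy A
  have h := h.bind_append (hy.map_fst_envList _) y' v'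
  simpa only [Ctx.envList_join, Ctx.envList_join_var, Ctx.envList_join_var_var,
    List.append_assoc] using h

theorem Translation.Rel.swapFlat {Γ₁ Γ₂ Γ Γ' : Ctx W E} {a b : Entry W E} {n : ℕ}
    {g : Ctx.flat ob α (Γ₁ ++ b :: a :: Γ₂)} {g' : Γ'.flat ob α} {F : Γ'.flat ob α → Γ.flat ob α}
    (h : τ.Rel n (Ctx.envList g) (Ctx.envList g')) (hΓ₁ : ∀ c ∈ Γ₁, τ.CorrectAt c)
    (ha : τ.CorrectAt a) (hb : τ.CorrectAt b)
    (hF : SwapsBlocks (n + (Γ₁.flatMap τ.block).length) (τ.block b).length (τ.block a).length F) :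
    τ.Rel n (Ctx.envList (Ctx.swapFlat Γ₁ g)) (Ctx.envList (F g')) := by
  obtain ⟨hρ, ψ, hψ, hg'⟩ := h
  have hg : Ctx.envList g = Ctx.envList (Ctx.split Γ₁ g).1 ++ ⟨b, (Ctx.split Γ₁ g).2.1⟩ ::
      ⟨a, (Ctx.split Γ₁ g).2.2.1⟩ :: Ctx.envList (Ctx.split Γ₁ g).2.2.2 := Ctx.envList_split g
  rw [hg] at hρ hg'
  rw [Ctx.envList_swapFlat hg (Ctx.length_envList _)]
  refine ⟨fun s hs => hρ s ?_, ψ, hψ, ?_⟩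
  · simpa only [List.mem_append, List.mem_cons, or_left_comm (a := s = ⟨a, _⟩)] using hs
  · rw [hF g' (ψ ++ (Ctx.envList (Ctx.split Γ₁ g).1).flatMap τ.envBlock) _ _ _
      (by simpa using hg') (by simp [hψ, Translation.length_flatMap_envBlock hΓ₁])
      (hb.length_envBlock _) (ha.length_envBlock _)]
    simp

end Contexts

section Values

theorem VTyp.Translates.unit {Φ : Ctx W E} (hΦ : Φ.IsParam) :
    (VTyp.unit hΦ : VTyp α Φ (.unit : Val ob E) _).Translates := by
  rintro τ Ψ _ hτ hΨ rfl
  exact ⟨.unit (Translation.isParam_append_flatMap_block hΨ hΦ hτ), fun _ _ _ => rfl⟩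

theorem VTyp.Translates.nat {Φ : Ctx W E} (n : ℕ) (hΦ : Φ.IsParam) :
    (VTyp.nat n hΦ : VTyp α Φ (.nat n : Val ob E) _).Translates := by
  rintro τ Ψ _ hτ hΨ rfl
  exact ⟨.nat n (Translation.isParam_append_flatMap_block hΨ hΦ hτ), fun _ _ _ => rfl⟩

theorem VTyp.Translates.lab {Φ : Ctx W E} (l : ℕ) (c : W) (hΦ : Φ.IsParam) :
    (VTyp.lab l c hΦ : VTyp α _ (.lab l : Val ob E) _).Translates := by
  intro τ Ψ Γ' hτ hΨ hΓ'
  obtain ⟨hτΦ, hl⟩ := List.forall_mem_append.1 hτ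
  obtain ⟨t, -⟩ := (List.forall_mem_singleton.1 hl).exists_typing _
    (Translation.isParam_append_flatMap_block hΨ hΦ hτΦ)
  obtain rfl : Γ' = Ψ ++ Φ.flatMap τ.block ++ τ.block (.lab l c) := by simp [hΓ']
  exact ⟨t, fun _ _ _ => rfl⟩

theorem VTyp.Translates.var {Φ : Ctx W E} (x : ℕ) (A : Ty W E) (hΦ : Φ.IsParam) :
    (VTyp.var x A hΦ : VTyp α _ (.fvar x : Val ob E) _).Translates := by
  intro τ Ψ Γ' hτ hΨ hΓ'
  obtain ⟨hτΦ, hx⟩ := List.forall_mem_append.1 hτ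
  obtain ⟨t, ht⟩ := (List.forall_mem_singleton.1 hx).exists_typing _
    (Translation.isParam_append_flatMap_block hΨ hΦ hτΦ)
  obtain rfl : Γ' = Ψ ++ Φ.flatMap τ.block ++ τ.block (.var x A) := by simp [hΓ']
  refine ⟨t, fun g g' ⟨hρ, ψ, hψ, hg'⟩ => ?_⟩
  rw [Ctx.envList_split (Γ := Φ)] at hρ hg'
  refine ht g' (ψ ++ (Ctx.envList (Ctx.split Φ g).1).flatMap τ.envBlock) (Ctx.split Φ g).2.1
    ((List.forall_mem_append.1 hρ).2 _ (List.mem_singleton_self _)) ?_ ?_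
  · rw [hg']; simp [Ctx.envList]
  · simp [hψ, Translation.length_flatMap_envBlock hτΦ]

theorem VTyp.Translates.abs {Γ : Ctx W E} {A B : Ty W E} {T : Bundle W} {e : Eff E} {N : Tm ob E}
    {x : ℕ} {d : CTyp α (Γ ++ [.var x A]) (N.inst 0 (.fvar x)) B e} (hd : d.Translates)
    (hx : Γ.Fresh x) (hxN : x ∉ N.fv) (hA : A.WF ob α) (hT : T.wires = Γ.wires) :
    (VTyp.abs x hx hxN hA hT d).Translates := by
  intro τ Ψ Γ' hτ hΨ hΓ'
  obtain ⟨y, hy, hyN⟩ := Γ'.exists_fresh (N.msubst τ.σ)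
  have hd := hd (τ.bind x y A) Ψ (Γ' ++ [.var y A]) (Translation.correctAt_bind_append hτ hx y) hΨ
    (by rw [Translation.flatMap_bind_append hx, hΓ', List.append_assoc])
  rw [Translation.bind, Translation.update, Tm.msubst_inst_update τ.locallyClosed
    (Val.locallyClosed_fvar y) hxN] at hd
  obtain ⟨d', hd'⟩ := hd
  refine ⟨.abs y hy hyN hA ?_ d', fun g g' h => ?_⟩
  · rw [hT, hΓ', hΨ.append_wires, Translation.wires_flatMap_block hτ]
  · funext a
    obtain ⟨h₁, h₂⟩ := hd' _ _ (h.join_var hx y a)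
    refine Prod.ext h₁ (Circs.ext_of ?_)
    simpa only [VTyp.interp, Circs.of_cast] using h₂

theorem VTyp.Translates.lift {Φ : Ctx W E} {A : Ty W E} {e : Eff E} {N : Tm ob E}
    {d : CTyp α Φ N A e} (hd : d.Translates) (hΦ : Φ.IsParam) :
    (VTyp.lift hΦ d).Translates := by
  rintro τ Ψ _ hτ hΨ rfl
  obtain ⟨d', hd'⟩ := hd τ Ψ _ hτ hΨ rfl
  refine ⟨.lift (Translation.isParam_append_flatMap_block hΨ hΦ hτ) d', fun g g' h => ?_⟩
  funext a
  obtain ⟨h₁, h₂⟩ := hd' g g' h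
  refine Prod.ext h₁ (Circs.ext_of ?_)
  simpa only [VTyp.interp, Circs.of_cast] using h₂

theorem VTyp.Translates.circ {Φ : Ctx W E} {T U : Bundle W} {e : Eff E} {C : LCirc ob}
    {b c : WBundle} {Q L : LabCtx W} {p : Q.obj ob ⟶ C.dom.obj ob} {q : C.cod.obj ob ⟶ L.obj ob}
    (hΦ : Φ.IsParam) (hp : IsPerm (fun a : ℕ × W => ob a.2) Q C.dom p)
    (hq : IsPerm (fun a : ℕ × W => ob a.2) C.cod L q) (hb : WBundle.HasType Q b T)
    (hc : WBundle.HasType L c U) (h : Bounded α (p ≫ C.hom ≫ q) e) :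
    (VTyp.circ p q hΦ hp hq hb hc h).Translates := by
  rintro τ Ψ _ hτ hΨ rfl
  exact ⟨.circ p q (Translation.isParam_append_flatMap_block hΨ hΦ hτ) hp hq hb hc h,
    fun _ _ _ => rfl⟩

theorem VTyp.Translates.pair {Φ Γ₁ Γ₂ : Ctx W E} {V V' : Val ob E} {A B : Ty W E}
    {d₁ : VTyp α (Φ ++ Γ₁) V A} {d₂ : VTyp α (Φ ++ Γ₂) V' B} (hd₁ : d₁.Translates)
    (hd₂ : d₂.Translates) (hΦ : Φ.IsParam) : (VTyp.pair hΦ d₁ d₂).Translates := by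
  intro τ Ψ Γ' hτ hΨ hΓ'
  obtain ⟨hτΦ, hτ₁, hτ₂⟩ : _ ∧ _ ∧ _ := by simpa only [List.forall_mem_append] using hτ
  obtain ⟨d₁', h₁⟩ := hd₁ τ Ψ (Ψ ++ Φ.flatMap τ.block ++ Γ₁.flatMap τ.block)
    (List.forall_mem_append.2 ⟨hτΦ, hτ₁⟩) hΨ (by simp)
  obtain ⟨d₂', h₂⟩ := hd₂ τ Ψ (Ψ ++ Φ.flatMap τ.block ++ Γ₂.flatMap τ.block)
    (List.forall_mem_append.2 ⟨hτΦ, hτ₂⟩) hΨ (by simp)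
  obtain rfl : Γ' = Ψ ++ Φ.flatMap τ.block ++ (Γ₁.flatMap τ.block ++ Γ₂.flatMap τ.block) := by
    simp [hΓ']
  refine ⟨.pair (Translation.isParam_append_flatMap_block hΨ hΦ hτΦ) d₁' d₂', fun g g' h => ?_⟩
  obtain ⟨hr₁, hr₂⟩ := h.split_append hτΦ hτ₁ List.length_append
  exact Prod.ext (h₁ _ _ hr₁) (h₂ _ _ hr₂)

end Values

section Computations

theorem CTyp.Translates.app {Φ Γ₁ Γ₂ : Ctx W E} {V V' : Val ob E} {A B : Ty W E} {T : Bundle W}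
    {e : Eff E} {d₁ : VTyp α (Φ ++ Γ₁) V (.arrow A B T e)} {d₂ : VTyp α (Φ ++ Γ₂) V' A}
    (hd₁ : d₁.Translates) (hd₂ : d₂.Translates) (hΦ : Φ.IsParam) :
    (CTyp.app hΦ d₁ d₂).Translates := by
  intro τ Ψ Γ' hτ hΨ hΓ'
  obtain ⟨hτΦ, hτ₁, hτ₂⟩ : _ ∧ _ ∧ _ := by simpa only [List.forall_mem_append] using hτ
  obtain ⟨d₁', h₁⟩ := hd₁ τ Ψ (Ψ ++ Φ.flatMap τ.block ++ Γ₁.flatMap τ.block)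
    (List.forall_mem_append.2 ⟨hτΦ, hτ₁⟩) hΨ (by simp)
  obtain ⟨d₂', h₂⟩ := hd₂ τ Ψ (Ψ ++ Φ.flatMap τ.block ++ Γ₂.flatMap τ.block)
    (List.forall_mem_append.2 ⟨hτΦ, hτ₂⟩) hΨ (by simp)
  obtain rfl : Γ' = Ψ ++ Φ.flatMap τ.block ++ (Γ₁.flatMap τ.block ++ Γ₂.flatMap τ.block) := by
    simp [hΓ']
  refine ⟨.app (Translation.isParam_append_flatMap_block hΨ hΦ hτΦ) d₁' d₂', fun g g' h => ?_⟩
  obtain ⟨hr₁, hr₂⟩ := h.split_append hτΦ hτ₁ List.length_append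
  simp only [CTyp.interp, Circs.of_cast]
  rw [h₁ _ _ hr₁, h₂ _ _ hr₂]
  exact ⟨rfl, rfl⟩

theorem CTyp.Translates.force {Φ : Ctx W E} {V : Val ob E} {A : Ty W E} {e : Eff E}
    {d : VTyp α Φ V (.bang A e)} (hd : d.Translates) (hΦ : Φ.IsParam) :
    (CTyp.force hΦ d).Translates := by
  rintro τ Ψ _ hτ hΨ rfl
  obtain ⟨d', hd'⟩ := hd τ Ψ _ hτ hΨ rfl
  refine ⟨.force (Translation.isParam_append_flatMap_block hΨ hΦ hτ) d', fun g g' h => ?_⟩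
  simp only [CTyp.interp, Circs.of_cast]
  rw [hd' g g' h]
  exact ⟨rfl, rfl⟩

theorem CTyp.Translates.box {Φ : Ctx W E} {V : Val ob E} {T U : Bundle W} {e : Eff E}
    {d : VTyp α Φ V (.arrow T.toTy U.toTy .unit e)} (hd : d.Translates) (hΦ : Φ.IsParam) :
    (CTyp.box hΦ d).Translates := by
  rintro τ Ψ _ hτ hΨ rfl
  obtain ⟨d', hd'⟩ := hd τ Ψ _ hτ hΨ rfl
  refine ⟨.box (Translation.isParam_append_flatMap_block hΨ hΦ hτ) d', fun g g' h => ?_⟩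
  simp only [CTyp.interp, hd' g g' h, true_and]
  exact (Circs.of_cast _ _ _).trans (Circs.of_cast _ _ _).symm

theorem CTyp.Translates.apply {Φ Γ₁ Γ₂ : Ctx W E} {V V' : Val ob E} {T U : Bundle W} {e : Eff E}
    {d₁ : VTyp α (Φ ++ Γ₁) V (.circ T U e)} {d₂ : VTyp α (Φ ++ Γ₂) V' T.toTy}
    (hd₁ : d₁.Translates) (hd₂ : d₂.Translates) (hΦ : Φ.IsParam) :
    (CTyp.apply hΦ d₁ d₂).Translates := by
  intro τ Ψ Γ' hτ hΨ hΓ'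
  obtain ⟨hτΦ, hτ₁, hτ₂⟩ : _ ∧ _ ∧ _ := by simpa only [List.forall_mem_append] using hτ
  obtain ⟨d₁', h₁⟩ := hd₁ τ Ψ (Ψ ++ Φ.flatMap τ.block ++ Γ₁.flatMap τ.block)
    (List.forall_mem_append.2 ⟨hτΦ, hτ₁⟩) hΨ (by simp)
  obtain ⟨d₂', -⟩ := hd₂ τ Ψ (Ψ ++ Φ.flatMap τ.block ++ Γ₂.flatMap τ.block)
    (List.forall_mem_append.2 ⟨hτΦ, hτ₂⟩) hΨ (by simp)
  obtain rfl : Γ' = Ψ ++ Φ.flatMap τ.block ++ (Γ₁.flatMap τ.block ++ Γ₂.flatMap τ.block) := by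
    simp [hΓ']
  refine ⟨.apply (Translation.isParam_append_flatMap_block hΨ hΦ hτΦ) d₁' d₂', fun g g' h => ?_⟩
  obtain ⟨hr₁, -⟩ := h.split_append hτΦ hτ₁ List.length_append
  simp only [CTyp.interp, h₁ _ _ hr₁, true_and]
  exact (Circs.of_cast _ _ _).trans (Circs.of_cast _ _ _).symm

theorem CTyp.Translates.ifz {Φ Γ : Ctx W E} {V : Val ob E} {N N' : Tm ob E} {A : Ty W E}
    {e : Eff E} {d : VTyp α Φ V .nat} {d₁ : CTyp α (Φ ++ Γ) N A e} {d₂ : CTyp α (Φ ++ Γ) N' A e}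
    (hd : d.Translates) (hd₁ : d₁.Translates) (hd₂ : d₂.Translates) (hΦ : Φ.IsParam) :
    (CTyp.ifz hΦ d d₁ d₂).Translates := by
  intro τ Ψ Γ' hτ hΨ hΓ'
  obtain ⟨hτΦ, -⟩ := List.forall_mem_append.1 hτ
  obtain rfl : Γ' = Ψ ++ Φ.flatMap τ.block ++ Γ.flatMap τ.block := by simp [hΓ']
  obtain ⟨d', hd⟩ := hd τ Ψ _ hτΦ hΨ rfl
  obtain ⟨d₁', h₁⟩ := hd₁ τ Ψ _ hτ hΨ hΓ'
  obtain ⟨d₂', h₂⟩ := hd₂ τ Ψ _ hτ hΨ hΓ'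
  refine ⟨.ifz (Translation.isParam_append_flatMap_block hΨ hΦ hτΦ) d' d₁' d₂', fun g g' h => ?_⟩
  obtain ⟨hφ, -⟩ := h.split hτΦ List.length_append
  simp only [CTyp.interp, hd _ _ hφ]
  split
  · exact h₁ _ _ h
  · exact h₂ _ _ h

theorem CTyp.Translates.ret {Γ : Ctx W E} {V : Val ob E} {A : Ty W E} {d : VTyp α Γ V A}
    (hd : d.Translates) : (CTyp.ret d).Translates := by
  intro τ Ψ Γ' hτ hΨ hΓ'
  obtain ⟨d', hd'⟩ := hd τ Ψ Γ' hτ hΨ hΓ'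
  refine ⟨.ret d', fun g g' h => ⟨hd' g g' h, ?_⟩⟩
  simp only [CTyp.interp, Circs.of_cast]

theorem CTyp.Translates.sub {Γ : Ctx W E} {N : Tm ob E} {A : Ty W E} {t u : E} {e₁ e₂ : t ⟶ u}
    {d : CTyp α Γ N A ⟨t, u, e₁⟩} (hd : d.Translates) (h : e₁ ≤ e₂) :
    (CTyp.sub d h).Translates := by
  intro τ Ψ Γ' hτ hΨ hΓ'
  obtain ⟨d', hd'⟩ := hd τ Ψ Γ' hτ hΨ hΓ'
  exact ⟨.sub d' h, hd'⟩

theorem CTyp.Translates.dest {Φ Γ₁ Γ₂ : Ctx W E} {V : Val ob E} {N : Tm ob E} {A B A' : Ty W E}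
    {e : Eff E} {x y : ℕ} {d₁ : VTyp α (Φ ++ Γ₁) V (.tensor A B)}
    {d₂ : CTyp α (Φ ++ (Γ₂ ++ [.var x A, .var y B]))
      ((N.inst 1 (.fvar x)).inst 0 (.fvar y)) A' e}
    (hd₁ : d₁.Translates) (hd₂ : d₂.Translates) (hΦ : Φ.IsParam) (hxy : x ≠ y)
    (hx : Ctx.Fresh x (Φ ++ Γ₂)) (hy : Ctx.Fresh y (Φ ++ Γ₂)) (hxN : x ∉ N.fv) (hyN : y ∉ N.fv) :
    (CTyp.dest x y hΦ hxy hx hy hxN hyN d₁ d₂).Translates := by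
  intro τ Ψ Γ' hτ hΨ hΓ'
  obtain ⟨hτΦ, hτ₂, hτ₁⟩ : _ ∧ _ ∧ _ := by simpa only [List.forall_mem_append] using hτ
  have hτΦ₂ := List.forall_mem_append.2 ⟨hτΦ, hτ₂⟩
  let Δ : Ctx W E := Ψ ++ Φ.flatMap τ.block ++ Γ₂.flatMap τ.block
  obtain ⟨x', hx', hxN'⟩ := Δ.exists_fresh (N.msubst τ.σ)
  obtain ⟨y', hy', hyN'⟩ := Ctx.exists_fresh (Δ ++ [.var x' A]) (N.msubst τ.σ)
  have hxy' : x' ≠ y' := by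
    rintro rfl
    exact hy' A (by simp)
  obtain ⟨d₁', h₁⟩ := hd₁ τ Ψ (Ψ ++ Φ.flatMap τ.block ++ Γ₁.flatMap τ.block)
    (List.forall_mem_append.2 ⟨hτΦ, hτ₁⟩) hΨ (by simp)
  have hyx := hy.append_var hxy A
  have hτ₂' := Translation.correctAt_bind_append
    (Translation.correctAt_bind_append hτΦ₂ hx x' (A := A)) hyx y' (A := B)
  have hd₂ := hd₂ ((τ.bind x x' A).bind y y' B) Ψ
    (Ψ ++ Φ.flatMap τ.block ++ (Γ₂.flatMap τ.block ++ [.var x' A, .var y' B]))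
    (by simpa using hτ₂') hΨ
    (by
      rw [show Φ ++ (Γ₂ ++ [Entry.var x A, Entry.var y B]) =
          Φ ++ Γ₂ ++ [Entry.var x A] ++ [Entry.var y B] by simp,
        Translation.flatMap_bind_append hyx, Translation.flatMap_bind_append hx]
      simp)
  rw [Translation.bind, Translation.bind, Translation.update, Translation.update,
    Tm.msubst_inst_inst_update τ.locallyClosed (Val.locallyClosed_fvar x')
      (Val.locallyClosed_fvar y') hxy hxN hyN] at hd₂
  obtain ⟨d₂', h₂⟩ := hd₂
  obtain rfl : Γ' = Ψ ++ Φ.flatMap τ.block ++ (Γ₂.flatMap τ.block ++ Γ₁.flatMap τ.block) := by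
    simp [hΓ']
  refine ⟨.dest x' y' (Translation.isParam_append_flatMap_block hΨ hΦ hτΦ) hxy' hx'
    (fun C hC => hy' C (List.mem_append_left _ hC)) hxN' hyN' d₁' d₂', fun g g' h => ?_⟩
  obtain ⟨hr₂, hr₁⟩ := h.split_append hτΦ hτ₂ List.length_append
  simp only [CTyp.interp, Circs.of_cast, h₁ _ _ hr₁]
  exact h₂ _ _ (hr₂.join_join_var_var hx hy hxy x' y' _ _)

theorem CTyp.exists_lett {Φ Γ₁ Γ₂ : Ctx W E} {N N' : Tm ob E} {A B : Ty W E} {e₁ e₂ : Eff E}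
    {x : ℕ} (hΦ : Φ.IsParam) (hx : Ctx.Fresh x (Φ ++ Γ₂)) (hxN : x ∉ N'.fv)
    (d₁ : CTyp α (Φ ++ Γ₁) N A e₁)
    (d₂ : CTyp α (Φ ++ (Γ₂ ++ [.var x A])) (N'.inst 0 (.fvar x)) B e₂)
    {X : E} (hX : X = α.obj (Γ₂.obj ob)) (h : X ⊗ₚ e₁.cod = e₂.dom) :
    ∃ d : CTyp α (Φ ++ (Γ₂ ++ Γ₁)) (.lett N N') B
        ⟨X ⊗ₚ e₁.dom, e₂.cod, lw X e₁.hom ≫ eqToHom h ≫ e₂.hom⟩,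
      ∀ g : Ctx.flat ob α (Φ ++ (Γ₂ ++ Γ₁)),
        let s := Ctx.split Φ g
        let r := d₁.interp (Ctx.join s.1 (Ctx.split Γ₂ s.2).2)
        let r' := d₂.interp (Ctx.join s.1 (Ctx.join (Δ := [.var x A]) (Ctx.split Γ₂ s.2).1
          (r.1, PUnit.unit)))
        (d.interp g).1 = r'.1 ∧ Eff.of (d.interp g).2.1 =
          Eff.lwhisk (Γ₂.obj ob) (Eff.of r.2.1) ⋆ Eff.of r'.2.1 := by
  subst hX
  refine ⟨.lett x hΦ hx hxN d₁ d₂ h, fun g => ⟨rfl, ?_⟩⟩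
  simp only [CTyp.interp, Circs.of_cast, Circs.of_comp]
  rfl

theorem CTyp.Translates.lett {Φ Γ₁ Γ₂ : Ctx W E} {N N' : Tm ob E} {A B : Ty W E} {e₁ e₂ : Eff E}
    {x : ℕ} {d₁ : CTyp α (Φ ++ Γ₁) N A e₁}
    {d₂ : CTyp α (Φ ++ (Γ₂ ++ [.var x A])) (N'.inst 0 (.fvar x)) B e₂}
    (hd₁ : d₁.Translates) (hd₂ : d₂.Translates) (hΦ : Φ.IsParam) (hx : Ctx.Fresh x (Φ ++ Γ₂))
    (hxN : x ∉ N'.fv) (h : α.obj (Γ₂.obj ob) ⊗ₚ e₁.cod = e₂.dom) :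
    (CTyp.lett x hΦ hx hxN d₁ d₂ h).Translates := by
  intro τ Ψ Γ' hτ hΨ hΓ'
  obtain ⟨hτΦ, hτ₂, hτ₁⟩ : _ ∧ _ ∧ _ := by simpa only [List.forall_mem_append] using hτ
  have hτΦ₂ := List.forall_mem_append.2 ⟨hτΦ, hτ₂⟩
  obtain ⟨y, hy, hyN⟩ := (Ψ ++ Φ.flatMap τ.block ++ Γ₂.flatMap τ.block).exists_fresh
    (N'.msubst τ.σ)
  obtain ⟨d₁', h₁⟩ := hd₁ τ Ψ (Ψ ++ Φ.flatMap τ.block ++ Γ₁.flatMap τ.block)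
    (List.forall_mem_append.2 ⟨hτΦ, hτ₁⟩) hΨ (by simp)
  have hd₂ := hd₂ (τ.bind x y A) Ψ
    (Ψ ++ Φ.flatMap τ.block ++ (Γ₂.flatMap τ.block ++ [.var y A]))
    (by simpa using Translation.correctAt_bind_append hτΦ₂ hx y) hΨ
    (by rw [← List.append_assoc Φ, Translation.flatMap_bind_append hx]; simp)
  rw [Translation.bind, Translation.update, Tm.msubst_inst_update τ.locallyClosed
    (Val.locallyClosed_fvar y) hxN] at hd₂
  obtain ⟨d₂', h₂⟩ := hd₂
  obtain rfl : Γ' = Ψ ++ Φ.flatMap τ.block ++ (Γ₂.flatMap τ.block ++ Γ₁.flatMap τ.block) := by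
    simp [hΓ']
  have hobj : Ctx.obj ob (Γ₂.flatMap τ.block) = Γ₂.obj ob :=
    Ctx.obj_congr (Translation.wires_flatMap_block hτ₂)
  obtain ⟨d', hd'⟩ := CTyp.exists_lett (Translation.isParam_append_flatMap_block hΨ hΦ hτΦ) hy hyN
    d₁' d₂' (congrArg α.obj hobj.symm) h
  refine ⟨d', fun g g' hr => ?_⟩
  obtain ⟨hr₂, hr₁⟩ := hr.split_append hτΦ hτ₂ List.length_append
  obtain ⟨h₁, h₁'⟩ := h₁ _ _ hr₁
  obtain ⟨h₂, h₂'⟩ := h₂ _ _ (hr₂.join_join_var hx y _)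
  obtain ⟨h₃, h₃'⟩ := hd' g'
  rw [h₁] at h₃ h₃'
  refine ⟨h₃.trans h₂, h₃'.trans ?_⟩
  rw [h₁', h₂', hobj]
  simp only [CTyp.interp, Circs.of_cast, Circs.of_comp]
  rfl

theorem CTyp.Translates.ex {Γ₁ Γ₂ : Ctx W E} {a b : Entry W E} {N : Tm ob E} {A : Ty W E}
    {e : Eff E} {d : CTyp α (Γ₁ ++ a :: b :: Γ₂) N A e} (hd : d.Translates)
    (h : α.obj (Ctx.obj ob (Γ₁ ++ a :: b :: Γ₂)) = e.dom) : (CTyp.ex d h).Translates := by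
  intro τ Ψ Γ' hτ hΨ hΓ'
  obtain ⟨hτ₁, hb, ha, hτ₂⟩ : _ ∧ _ ∧ _ ∧ _ := by
    simpa only [List.forall_mem_append, List.forall_mem_cons] using hτ
  obtain ⟨d', hd'⟩ := hd τ Ψ
    (Ψ ++ Γ₁.flatMap τ.block ++ (τ.block a ++ (τ.block b ++ Γ₂.flatMap τ.block)))
    (by simp only [List.forall_mem_append, List.forall_mem_cons]; exact ⟨hτ₁, ha, hb, hτ₂⟩) hΨ
    (by simp)
  obtain ⟨F, hF, hF'⟩ := exists_exchange (ob := ob) (α := α) (τ.block a) (τ.block b)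
    (Γ₂.flatMap τ.block) (Ψ ++ Γ₁.flatMap τ.block) _ Γ' rfl (by simp [hΓ'])
  have hswap : Ctx.blockSwap ob (Ψ ++ Γ₁.flatMap τ.block) (τ.block b) (τ.block a)
      (Γ₂.flatMap τ.block) = Eff.of (swapHom (fun c : Entry W E => c.ty.obj ob) Γ₁ b a Γ₂) := by
    have h₁ : Ctx.obj ob (Ψ ++ Γ₁.flatMap τ.block) = Γ₁.obj ob :=
      Ctx.obj_congr (by rw [hΨ.append_wires, Translation.wires_flatMap_block hτ₁])
    have h₂ : Ctx.obj ob (Γ₂.flatMap τ.block) = Γ₂.obj ob :=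
      Ctx.obj_congr (Translation.wires_flatMap_block hτ₂)
    rw [Ctx.blockSwap, h₁, h₂, ha.obj_block, hb.obj_block, of_swapHom]
    rfl
  rw [hswap] at hF
  obtain ⟨d'', hd''⟩ := hF.exists_derivation d' ((congrArg α.obj hF.cod_eq.symm).trans h)
    (Eff.comp_eq (e := α.mapEff (Eff.of _)) h).symm
  refine ⟨d'', fun g g' hr => ?_⟩
  obtain ⟨h₁, h₂⟩ := hd' _ _ (hr.swapFlat hτ₁ ha hb (by rwa [← List.length_append]))
  obtain ⟨h₁', h₂'⟩ := hd'' g'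
  refine ⟨h₁'.trans h₁, h₂'.trans ?_⟩
  rw [h₂]
  simp only [CTyp.interp, Circs.of_comp]
  rfl

end Computations

mutual

theorem VTyp.translates : {Γ : Ctx W E} → {V : Val ob E} → {A : Ty W E} → (d : VTyp α Γ V A) →
    d.Translates
  | _, _, _, .unit hΦ => .unit hΦ
  | _, _, _, .nat n hΦ => .nat n hΦ
  | _, _, _, .lab l c hΦ => .lab l c hΦ
  | _, _, _, .var x A hΦ => .var x A hΦ
  | _, _, _, .abs _ hx hxN hA hT d => .abs d.translates hx hxN hA hT
  | _, _, _, .lift hΦ d => .lift d.translates hΦ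
  | _, _, _, .circ _ _ hΦ hp hq hb hc h => .circ hΦ hp hq hb hc h
  | _, _, _, .pair hΦ d₁ d₂ => .pair d₁.translates d₂.translates hΦ

theorem CTyp.translates : {Γ : Ctx W E} → {N : Tm ob E} → {A : Ty W E} → {e : Eff E} →
    (d : CTyp α Γ N A e) → d.Translates
  | _, _, _, _, .app hΦ d₁ d₂ => .app d₁.translates d₂.translates hΦ
  | _, _, _, _, .force hΦ d => .force d.translates hΦ
  | _, _, _, _, .box hΦ d => .box d.translates hΦ
  | _, _, _, _, .apply hΦ d₁ d₂ => .apply d₁.translates d₂.translates hΦ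
  | _, _, _, _, .dest _ _ hΦ hxy hx hy hxN hyN d₁ d₂ =>
    .dest d₁.translates d₂.translates hΦ hxy hx hy hxN hyN
  | _, _, _, _, .ifz hΦ d d₁ d₂ => .ifz d.translates d₁.translates d₂.translates hΦ
  | _, _, _, _, .ret d => .ret d.translates
  | _, _, _, _, .lett _ hΦ hx hxN d₁ d₂ h => .lett d₁.translates d₂.translates hΦ hx hxN h
  | _, _, _, _, .sub d h => .sub d.translates h
  | _, _, _, _, .ex d h => .ex d.translates h

end

end Translates

/-! ### Weakening and substitution -/

section Substitution

variable {W : Type w} {E : Type u'} [Category.{v'} E] [CircuitAlgebra E]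
  {M : Type u} [Category.{v} M] [StrictSymPremonoidal M] {ob : W → M} {α : Abstraction M E}

namespace Translation

variable (ob α) in
/-- The identical translation. -/
def id : Translation ob α where
  σ := .fvar
  block a := [a]
  envBlock s := [s]
  Admissible _ := True
  locallyClosed := Val.locallyClosed_fvar

theorem correctAt_id : (a : Entry W E) → (id ob α).CorrectAt a
  | .lab l c => {
      wires_block := List.append_nil _
      isParam_block := by rintro _ _ ⟨⟩
      fst_envBlock := fun _ => rfl
      exists_typing := fun _ hΦ => ⟨.lab l c hΦ, fun _ _ _ _ _ _ => rfl⟩ }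
  | .var x A => {
      wires_block := List.append_nil _
      isParam_block := by
        rintro _ _ ⟨⟩ hA b hb
        exact ⟨x, A, List.mem_singleton.1 hb, hA⟩
      fst_envBlock := fun _ => rfl
      exists_typing := fun _ hΦ => ⟨.var x A hΦ, VTyp.evaluatesTo_var hΦ x A _⟩ }

theorem val_msubst_id (V : Val ob E) : V.msubst (id ob α).σ = V :=
  Val.msubst_fvar V

theorem tm_msubst_id (N : Tm ob E) : N.msubst (id ob α).σ = N :=
  Tm.msubst_fvar N

theorem flatMap_id (Γ : Ctx W E) : Γ.flatMap (id ob α).block = Γ :=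
  List.flatMap_singleton' Γ

theorem rel_id {n : ℕ} {ρ ψ : List (EnvEntry ob α)} (h : ψ.length = n) :
    (id ob α).Rel n ρ (ψ ++ ρ) :=
  ⟨fun _ _ => trivial, ψ, h, congrArg (ψ ++ ·) (List.flatMap_singleton' ρ).symm⟩

end Translation

theorem VTyp.exists_weakening {Γ : Ctx W E} {V : Val ob E} {A : Ty W E} (d : VTyp α Γ V A)
    {Φ : Ctx W E} (hΦ : Φ.IsParam) : ∃ d' : VTyp α (Φ ++ Γ) V A, ∀ g φ l,
      Ctx.envList g = φ ++ Ctx.envList l → φ.length = Φ.length → d'.interp g = d.interp l := by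
  have hd := d.translates (Translation.id ob α) Φ (Φ ++ Γ) (fun a _ => Translation.correctAt_id a)
    hΦ (by rw [Translation.flatMap_id])
  rw [Translation.val_msubst_id] at hd
  obtain ⟨d', hd'⟩ := hd
  exact ⟨d', fun g φ l hg hφ => hd' l g (hg ▸ Translation.rel_id hφ)⟩

namespace Translation

variable {τ : Translation ob α} {Γ Δ : Ctx W E} {x : ℕ} {A : Ty W E} {U : Val ob E}

/-- The extension of a translation by the replacement of the variable `x` by the value `U` typed by
`d`, in the environments that assign to `x` the meaning of `U` in the environment `l`. -/
noncomputable def replace (τ : Translation ob α) (x : ℕ) (d : VTyp α Δ U A) (l : Δ.flat ob α) :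
    Translation ob α :=
  τ.update x A d.locallyClosed Δ (fun _ => Ctx.envList l) (· = d.interp l)

variable {d : VTyp α Δ U A} {l : Δ.flat ob α} {N : Tm ob E}

theorem msubst_inst_replace (hxN : x ∉ N.fv) (k : ℕ) :
    (N.inst k (.fvar x)).msubst (τ.replace x d l).σ = (N.msubst τ.σ).inst k U :=
  Tm.msubst_inst_update τ.locallyClosed d.locallyClosed hxN k

theorem msubst_inst_inst_replace {Δ' : Ctx W E} {y : ℕ} {A' : Ty W E} {U' : Val ob E}
    {d' : VTyp α Δ' U' A'} {l' : Δ'.flat ob α} (hxy : x ≠ y) (hxN : x ∉ N.fv) (hyN : y ∉ N.fv)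
    (k k' : ℕ) :
    ((N.inst k (.fvar x)).inst k' (.fvar y)).msubst ((τ.replace x d l).replace y d' l').σ =
      ((N.msubst τ.σ).inst k U).inst k' U' :=
  Tm.msubst_inst_inst_update τ.locallyClosed d.locallyClosed d'.locallyClosed hxy hxN hyN k k'

theorem correctAt_replace_append (hΓ : ∀ a ∈ Γ, τ.CorrectAt a) (hx : Γ.Fresh x)
    (hΔ : A.IsParam → Δ.IsParam) : ∀ a ∈ Γ ++ [Entry.var x A], (τ.replace x d l).CorrectAt a := by
  refine correctAt_update_append hΓ hx (correctAt_update_self d.wires_eq hΔ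
    (fun _ => Ctx.envList_fst l) fun Φ hΦ => ?_)
  obtain ⟨d', hd'⟩ := d.exists_weakening hΦ
  exact ⟨d', fun g φ v hv hg hφ => (hd' g φ l hg hφ).trans hv.symm⟩

theorem flatMap_replace_append (hx : Γ.Fresh x) :
    (Γ ++ [Entry.var x A]).flatMap (τ.replace x d l).block = Γ.flatMap τ.block ++ Δ :=
  flatMap_update_append hx

theorem Rel.replace_append {n : ℕ} {ρ ρ' : List (EnvEntry ob α)} (h : τ.Rel n ρ ρ')
    (hx : Ctx.Fresh x (ρ.map Sigma.fst)) :
    (τ.replace x d l).Rel n (ρ ++ [⟨.var x A, d.interp l⟩]) (ρ' ++ Ctx.envList l) :=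
  h.update_append hx rfl

end Translation

theorem CTyp.exists_subst {Γ Δ : Ctx W E} {x : ℕ} {A B : Ty W E} {e : Eff E} {N : Tm ob E}
    {U : Val ob E} (d : CTyp α (Γ ++ [.var x A]) (N.inst 0 (.fvar x)) B e) (dU : VTyp α Δ U A)
    (l : Δ.flat ob α) (hΔ : A.IsParam → Δ.IsParam) (hx : Γ.Fresh x) (hxN : x ∉ N.fv) :
    ∃ d' : CTyp α (Γ ++ Δ) (N.inst 0 U) B e, ∀ g : Γ.flat ob α,
      let r := d.interp (Ctx.join (Δ := [.var x A]) g (dU.interp l, PUnit.unit))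
      (d'.interp (Ctx.join g l)).1 = r.1 ∧
        Eff.of (d'.interp (Ctx.join g l)).2.1 = Eff.of r.2.1 := by
  have hd := d.translates ((Translation.id ob α).replace x dU l) [] (Γ ++ Δ)
    (Translation.correctAt_replace_append (fun a _ => Translation.correctAt_id a) hx hΔ)
    (List.forall_mem_nil _)
    (by rw [Translation.flatMap_replace_append hx, Translation.flatMap_id, List.nil_append])
  rw [Translation.msubst_inst_replace hxN, Translation.tm_msubst_id] at hd
  obtain ⟨d', hd'⟩ := hd
  refine ⟨d', fun g => hd' _ _ ?_⟩
  rw [Ctx.envList_join_var, Ctx.envList_join]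
  exact (Translation.rel_id (ψ := []) rfl).replace_append (hx.map_fst_envList g)

theorem CTyp.exists_subst_subst {Γ Δ Δ' : Ctx W E} {x y : ℕ} {A A' B : Ty W E} {e : Eff E}
    {N : Tm ob E} {U U' : Val ob E}
    (d : CTyp α (Γ ++ [.var x A, .var y A']) ((N.inst 1 (.fvar x)).inst 0 (.fvar y)) B e)
    (dU : VTyp α Δ U A) (dU' : VTyp α Δ' U' A') (l : Δ.flat ob α) (l' : Δ'.flat ob α)
    (hΔ : A.IsParam → Δ.IsParam) (hΔ' : A'.IsParam → Δ'.IsParam) (hxy : x ≠ y) (hx : Γ.Fresh x)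
    (hy : Γ.Fresh y) (hxN : x ∉ N.fv) (hyN : y ∉ N.fv) :
    ∃ d' : CTyp α (Γ ++ (Δ ++ Δ')) ((N.inst 1 U).inst 0 U') B e, ∀ g : Γ.flat ob α,
      let r := d.interp (Ctx.join (Δ := [.var x A, .var y A']) g
        (dU.interp l, dU'.interp l', PUnit.unit))
      (d'.interp (Ctx.join g (Ctx.join l l'))).1 = r.1 ∧
        Eff.of (d'.interp (Ctx.join g (Ctx.join l l'))).2.1 = Eff.of r.2.1 := by
  have hy := hy.append_var hxy A
  have hΓ : Γ ++ [Entry.var x A, Entry.var y A'] = Γ ++ [Entry.var x A] ++ [Entry.var y A'] := by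
    simp
  have hd := d.translates (((Translation.id ob α).replace x dU l).replace y dU' l') []
    (Γ ++ (Δ ++ Δ'))
    (by
      rw [hΓ]
      exact Translation.correctAt_replace_append (Translation.correctAt_replace_append
        (fun a _ => Translation.correctAt_id a) hx hΔ) hy hΔ')
    (List.forall_mem_nil _)
    (by
      rw [hΓ, Translation.flatMap_replace_append hy, Translation.flatMap_replace_append hx,
        Translation.flatMap_id, List.nil_append, List.append_assoc])
  rw [Translation.msubst_inst_inst_replace hxy hxN hyN, Translation.tm_msubst_id] at hd
  obtain ⟨d', hd'⟩ := hd
  refine ⟨d', fun g => hd' _ _ ?_⟩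
  rw [Ctx.envList_join_var_var, Ctx.envList_join, Ctx.envList_join, ← List.append_assoc]
  refine ((Translation.rel_id (ψ := []) rfl).replace_append
    (hx.map_fst_envList g)).replace_append ?_
  rw [← Ctx.envList_join_var]
  exact hy.map_fst_envList _

end Substitution

/-! ### Label contexts and closed values -/

section LabelContexts

variable {W : Type w} {E : Type u'} [Category.{v'} E]

theorem LabCtx.toCtx_append (L L' : LabCtx W) :
    (LabCtx.toCtx (L ++ L') : Ctx W E) = L.toCtx ++ L'.toCtx :=
  List.map_append

theorem LabCtx.exists_of_toCtx_eq_append {L : LabCtx W} {Γ Δ : Ctx W E} (h : L.toCtx = Γ ++ Δ) :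
    ∃ L₁ L₂ : LabCtx W, L = L₁ ++ L₂ ∧ L₁.toCtx = Γ ∧ L₂.toCtx = Δ :=
  List.map_eq_append_iff.1 h

theorem LabCtx.toCtx_injective : Function.Injective (LabCtx.toCtx : LabCtx W → Ctx W E) := by
  refine List.map_injective_iff.2 ?_
  rintro ⟨l, a⟩ ⟨l', a'⟩ h
  cases h
  rfl

theorem LabCtx.eq_nil_of_isParam {L : LabCtx W} (h : (L.toCtx : Ctx W E).IsParam) : L = [] := by
  refine List.eq_nil_iff_forall_not_mem.2 fun a ha => ?_
  obtain ⟨_, _, ⟨⟩, _⟩ := h _ (List.mem_map_of_mem ha)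

theorem LabCtx.fresh (L : LabCtx W) (x : ℕ) : (L.toCtx : Ctx W E).Fresh x := by
  rintro A hA
  obtain ⟨_, _, ⟨⟩⟩ := List.mem_map.1 hA

theorem LabCtx.length_wires (L : LabCtx W) : (L.toCtx : Ctx W E).wires.length = L.length := by
  induction L with
  | nil => rfl
  | cons _ L ih => exact congrArg (· + 1) ih

theorem Ctx.IsParam.exists_of_toCtx_eq {Φ Γ₁ Γ₂ : Ctx W E} (hΦ : Φ.IsParam) {L : LabCtx W}
    (h : L.toCtx = Φ ++ (Γ₁ ++ Γ₂)) :
    Φ = [] ∧ ∃ L₁ L₂ : LabCtx W, L = L₁ ++ L₂ ∧ L₁.toCtx = Γ₁ ∧ L₂.toCtx = Γ₂ := by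
  obtain ⟨L₀, L', rfl, rfl, h'⟩ := LabCtx.exists_of_toCtx_eq_append h
  obtain rfl := LabCtx.eq_nil_of_isParam hΦ
  exact ⟨rfl, LabCtx.exists_of_toCtx_eq_append h'⟩

theorem LabCtx.exists_of_toCtx_eq_append_cons_cons {L : LabCtx W}
    {Γ₁ Γ₂ : Ctx W E} {a b : Entry W E} (hL : L.toCtx = Γ₁ ++ b :: a :: Γ₂) :
    ∃ (L₁ L₂ : LabCtx W) (l m : ℕ × W), L = L₁ ++ l :: m :: L₂ ∧ L₁.toCtx = Γ₁ ∧
      L₂.toCtx = Γ₂ ∧ b = .lab l.1 l.2 ∧ a = .lab m.1 m.2 := by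
  obtain ⟨L₁, L', rfl, h₁, hL'⟩ := LabCtx.exists_of_toCtx_eq_append hL
  rcases L' with _ | ⟨l, _ | ⟨m, L₂⟩⟩ <;> cases hL'
  exact ⟨L₁, L₂, l, m, rfl, h₁, rfl, rfl, rfl⟩

variable {M : Type u} [Category.{v} M] [StrictSymPremonoidal M] (ob : W → M)

theorem LabCtx.of_swapHom_toCtx (L₁ L₂ : LabCtx W) (l m : ℕ × W) :
    Eff.of (swapHom (fun c : Entry W E => c.ty.obj ob) L₁.toCtx (.lab l.1 l.2) (.lab m.1 m.2)
      L₂.toCtx) = swapEff (fun a : ℕ × W => ob a.2) L₁ l m L₂ := by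
  have hobj (L : LabCtx W) : listObj (fun c : Entry W E => c.ty.obj ob) L.toCtx =
      listObj (fun a : ℕ × W => ob a.2) L := LabCtx.toCtx_obj ob L
  rw [of_swapHom, swapEff, swapEff, hobj, hobj]
  rfl

end LabelContexts

section ClosedValues

variable {W : Type w} {E : Type u'} [Category.{v'} E] [CircuitAlgebra E]
  {M : Type u} [Category.{v} M] [StrictSymPremonoidal M] {ob : W → M} {α : Abstraction M E}

theorem LabCtx.flat_subsingleton (L : LabCtx W) :
    Subsingleton (Ctx.flat ob α (L.toCtx : Ctx W E)) := by
  induction L with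
  | nil => exact inferInstanceAs (Subsingleton PUnit)
  | cons a L ih => exact ⟨fun g g' => Prod.ext rfl (ih.elim g.2 g'.2)⟩

theorem LabCtx.eq_pt {L : LabCtx W} (g : Ctx.flat ob α (L.toCtx : Ctx W E)) : g = L.pt :=
  L.flat_subsingleton.elim _ _

theorem Bundle.flat_subsingleton (T : Bundle W) :
    Subsingleton ((T.toTy : Ty W E).flat ob α) := by
  induction T with
  | unit => exact inferInstanceAs (Subsingleton PUnit)
  | wire a => exact inferInstanceAs (Subsingleton PUnit)
  | tensor T U ih ih' => exact ⟨fun g g' => Prod.ext (ih.elim g.1 g'.1) (ih'.elim g.2 g'.2)⟩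

theorem VTyp.isParam_toCtx {L : LabCtx W} {V : Val ob E} {A : Ty W E} (d : VTyp α L.toCtx V A)
    (hA : A.IsParam) : (L.toCtx : Ctx W E).IsParam := by
  have hL : L.length = 0 := by rw [← L.length_wires (E := E), d.wires_eq, hA.wires_eq]; rfl
  rw [List.eq_nil_of_length_eq_zero hL]
  exact List.forall_mem_nil _

section Substitution

variable {L Δ Δ' : LabCtx W} {x y : ℕ} {A A' B : Ty W E} {e : Eff E} {N : Tm ob E} {U U' : Val ob E}

theorem CTyp.exists_subst_toCtx (d : CTyp α (L.toCtx ++ [.var x A]) (N.inst 0 (.fvar x)) B e)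
    (dU : VTyp α Δ.toCtx U A) (hxN : x ∉ N.fv) :
    ∃ d' : CTyp α (LabCtx.toCtx (L ++ Δ)) (N.inst 0 U) B e,
      let r := d.interp (Ctx.join (Δ := [.var x A]) L.pt (dU.interp Δ.pt, PUnit.unit))
      (d'.interp (LabCtx.pt _)).1 = r.1 ∧ Eff.of (d'.interp (LabCtx.pt _)).2.1 = Eff.of r.2.1 := by
  obtain ⟨d', hd'⟩ := d.exists_subst dU Δ.pt dU.isParam_toCtx (L.fresh x) hxN
  replace hd' := hd' L.pt
  revert d'
  generalize Ctx.join (LabCtx.pt (ob := ob) (α := α) L) Δ.pt = l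
  revert l
  rw [← LabCtx.toCtx_append]
  intro l d' h
  rw [← LabCtx.eq_pt l]
  exact ⟨d', h⟩

theorem CTyp.exists_subst_subst_toCtx
    (d : CTyp α (L.toCtx ++ [.var x A, .var y A']) ((N.inst 1 (.fvar x)).inst 0 (.fvar y)) B e)
    (dU : VTyp α Δ.toCtx U A) (dU' : VTyp α Δ'.toCtx U' A') (hxy : x ≠ y) (hxN : x ∉ N.fv)
    (hyN : y ∉ N.fv) :
    ∃ d' : CTyp α (LabCtx.toCtx (L ++ (Δ ++ Δ'))) ((N.inst 1 U).inst 0 U') B e,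
      let r := d.interp (Ctx.join (Δ := [.var x A, .var y A']) L.pt
        (dU.interp Δ.pt, dU'.interp Δ'.pt, PUnit.unit))
      (d'.interp (LabCtx.pt _)).1 = r.1 ∧ Eff.of (d'.interp (LabCtx.pt _)).2.1 = Eff.of r.2.1 := by
  obtain ⟨d', hd'⟩ := d.exists_subst_subst dU dU' Δ.pt Δ'.pt dU.isParam_toCtx dU'.isParam_toCtx hxy
    (L.fresh x) (L.fresh y) hxN hyN
  replace hd' := hd' L.pt
  revert d'
  generalize Ctx.join (LabCtx.pt (ob := ob) (α := α) L) (Ctx.join Δ.pt Δ'.pt) = l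
  revert l
  rw [← LabCtx.toCtx_append, ← LabCtx.toCtx_append]
  intro l d' h
  rw [← LabCtx.eq_pt l]
  exact ⟨d', h⟩

end Substitution

theorem VTyp.exists_of_pair {L : LabCtx W} {V V' : Val ob E} {A B : Ty W E}
    (d : VTyp α L.toCtx (.pair V V') (.tensor A B)) :
    ∃ (L₁ L₂ : LabCtx W) (d₁ : VTyp α L₁.toCtx V A) (d₂ : VTyp α L₂.toCtx V' B), L = L₁ ++ L₂ ∧
      d.interp L.pt = (d₁.interp L₁.pt, d₂.interp L₂.pt) := by
  generalize LabCtx.pt (ob := ob) (α := α) L = g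
  generalize hL : (L.toCtx : Ctx W E) = Γ at d g
  cases d with
  | pair hΦ d₁ d₂ =>
    obtain ⟨rfl, L₁, L₂, rfl, rfl, rfl⟩ := hΦ.exists_of_toCtx_eq hL
    exact ⟨L₁, L₂, d₁, d₂, rfl, Prod.ext (congrArg d₁.interp (LabCtx.eq_pt _))
      (congrArg d₂.interp (LabCtx.eq_pt _))⟩

theorem VTyp.eq_of_lam {Γ : Ctx W E} {N : Tm ob E} {A A' B : Ty W E} {T : Bundle W} {e : Eff E}
    (d : VTyp α Γ (.lam A' N) (.arrow A B T e)) : A = A' := by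
  cases d; rfl

theorem VTyp.exists_of_lam {Γ : Ctx W E} {N : Tm ob E} {A A' B : Ty W E} {T : Bundle W} {e : Eff E}
    (d : VTyp α Γ (.lam A' N) (.arrow A B T e)) :
    ∃ (x : ℕ) (d' : CTyp α (Γ ++ [.var x A]) (N.inst 0 (.fvar x)) B e), x ∉ N.fv ∧ ∀ g a,
      let r := d'.interp (Ctx.join (Δ := [.var x A]) g (a, PUnit.unit))
      (d.interp g a).1 = r.1 ∧ Eff.of (d.interp g a).2.1 = Eff.of r.2.1 := by
  cases d with
  | abs x _ hxN _ _ d => exact ⟨x, d, hxN, fun g a => ⟨rfl, Circs.of_cast _ _ _⟩⟩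

theorem VTyp.exists_of_lift {Γ : Ctx W E} {N : Tm ob E} {A : Ty W E} {e : Eff E}
    (d : VTyp α Γ (.lift N) (.bang A e)) :
    ∃ d' : CTyp α Γ N A e, ∀ g, (d.interp g PUnit.unit).1 = (d'.interp g).1 ∧
      Eff.of (d.interp g PUnit.unit).2.1 = Eff.of (d'.interp g).2.1 := by
  cases d with
  | lift _ d => exact ⟨d, fun g => ⟨rfl, Circs.of_cast _ _ _⟩⟩

theorem VTyp.exists_of_boxed {Γ : Ctx W E} {b c : WBundle} {C : LCirc ob} {T U : Bundle W}
    {e : Eff E} (d : VTyp α Γ (.boxed b C c) (.circ T U e)) :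
    ∃ (Q L : LabCtx W) (p q : Eff M), Γ.IsParam ∧ PermEff (fun a : ℕ × W => ob a.2) Q C.dom p ∧
      PermEff (fun a : ℕ × W => ob a.2) C.cod L q ∧ WBundle.HasType Q b T ∧
      WBundle.HasType L c U ∧ ∀ g, Eff.of (d.interp g).1 = p ⋆ Eff.of C.hom ⋆ q := by
  cases d with
  | circ p q hΦ hp hq hb hc h =>
    refine ⟨_, _, _, _, hΦ, hp.permEff, hq.permEff, hb, hc, fun _ => ?_⟩
    refine (Circs.of_cast _ _ _).trans ?_
    rw [Eff.of_comp, Eff.of_comp, Eff.comp_assoc rfl]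

end ClosedValues

/-! ### Wire bundles -/

section WireBundles

variable {W : Type w}

theorem WBundle.HasType.relabel {Q : LabCtx W} {b : WBundle} {T : Bundle W}
    (h : WBundle.HasType Q b T) (ρ : ℕ → ℕ) :
    WBundle.HasType (Q.relabel ρ) (b.relabel ρ) T := by
  induction h with
  | unit => exact .unit
  | lab l a => exact .lab _ _
  | pair _ _ ih ih' =>
    rw [LabCtx.relabel, List.map_append]
    exact .pair ih ih'

theorem WBundle.HasType.unique {Q Q' : LabCtx W} {b : WBundle} {T : Bundle W}
    (h : WBundle.HasType Q b T) (h' : WBundle.HasType Q' b T) : Q = Q' := by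
  induction h generalizing Q' with
  | unit | lab => cases h'; rfl
  | pair _ _ ih ih' =>
    cases h' with
    | pair h₁ h₂ => rw [ih h₁, ih' h₂]

variable {E : Type u'} [Category.{v'} E] [CircuitAlgebra E] {M : Type u} [Category.{v} M]
  [StrictSymPremonoidal M] {ob : W → M} {α : Abstraction M E}

theorem WBundle.HasType.nonempty_vtyp {Q : LabCtx W} {b : WBundle} {T : Bundle W}
    (h : WBundle.HasType Q b T) : Nonempty (VTyp α Q.toCtx (b.toVal : Val ob E) T.toTy) := by
  have hnil : Ctx.IsParam ([] : Ctx W E) := List.forall_mem_nil _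
  induction h with
  | unit => exact ⟨.unit hnil⟩
  | lab l a => exact ⟨.lab (Φ := []) l a hnil⟩
  | pair _ _ ih ih' =>
    obtain ⟨d⟩ := ih
    obtain ⟨d'⟩ := ih'
    rw [LabCtx.toCtx_append]
    exact ⟨.pair (Φ := []) hnil d d'⟩

theorem VTyp.hasType : ∀ {b : WBundle} {T : Bundle W} {Γ : Ctx W E} {L : LabCtx W},
    VTyp α Γ (b.toVal : Val ob E) T.toTy → L.toCtx = Γ → WBundle.HasType L b T
  | .unit, .unit, Γ, L, d, h => by
    simp only [WBundle.toVal, Bundle.toTy] at d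
    cases d with
    | unit hΦ =>
      obtain rfl := LabCtx.eq_nil_of_isParam (h ▸ hΦ)
      exact .unit
  | .lab l, .wire a, Γ, L, d, h => by
    simp only [WBundle.toVal, Bundle.toTy] at d
    cases d with
    | lab _ _ hΦ =>
      obtain ⟨L₀, L₁, rfl, rfl, h'⟩ := LabCtx.exists_of_toCtx_eq_append h
      rw [LabCtx.eq_nil_of_isParam hΦ, LabCtx.toCtx_injective (a₂ := [(l, a)]) h']
      exact .lab l a
  | .pair b c, .tensor T U, Γ, L, d, h => by
    simp only [WBundle.toVal, Bundle.toTy] at d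
    cases d with
    | pair hΦ d₁ d₂ =>
      obtain ⟨rfl, L₁, L₂, rfl, rfl, rfl⟩ := hΦ.exists_of_toCtx_eq h
      exact .pair (VTyp.hasType d₁ rfl) (VTyp.hasType d₂ rfl)
  | .unit, .wire _, _, _, d, _ | .unit, .tensor _ _, _, _, d, _ | .lab _, .unit, _, _, d, _
  | .lab _, .tensor _ _, _, _, d, _ | .pair _ _, .unit, _, _, d, _
  | .pair _ _, .wire _, _, _, d, _ => by
    simp only [WBundle.toVal, Bundle.toTy] at d
    cases d

end WireBundles

/-! ### Inversion for closed computations -/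

section Inversion

variable {W : Type w} {E : Type u'} [Category.{v'} E] [CircuitAlgebra E]
  {M : Type u} [Category.{v} M] [StrictSymPremonoidal M] {ob : W → M} {α : Abstraction M E}

namespace CTyp

/-- The last rule of the derivation is neither subsumption nor exchange, hence it is determined by
the computation. -/
def IsHead {Γ : Ctx W E} {N : Tm ob E} {A : Ty W E} {e : Eff E} : CTyp α Γ N A e → Prop
  | .sub _ _ => False
  | .ex _ _ => False
  | _ => True

namespace IsHead

variable {Γ : Ctx W E} {L : LabCtx W} {V V' : Val ob E} {N N' : Tm ob E} {A : Ty W E} {e : Eff E}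

theorem exists_of_app {d : CTyp α L.toCtx (.app V V') A e} (hd : d.IsHead) :
    ∃ (L₁ L₂ : LabCtx W) (B : Ty W E) (T : Bundle W) (d₁ : VTyp α L₁.toCtx V (.arrow B A T e))
      (d₂ : VTyp α L₂.toCtx V' B), L = L₁ ++ L₂ ∧
      let r := d₁.interp L₁.pt (d₂.interp L₂.pt)
      (d.interp L.pt).1 = r.1 ∧ Eff.of (d.interp L.pt).2.1 = Eff.of r.2.1 := by
  generalize LabCtx.pt (ob := ob) (α := α) L = g
  generalize hL : (L.toCtx : Ctx W E) = Γ at d g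
  cases d with
  | app hΦ d₁ d₂ =>
    obtain ⟨rfl, L₁, L₂, rfl, rfl, rfl⟩ := hΦ.exists_of_toCtx_eq hL
    refine ⟨L₁, L₂, _, _, d₁, d₂, rfl, ?_⟩
    rw [← LabCtx.eq_pt (Ctx.split (LabCtx.toCtx L₁) (Ctx.split [] g).2).1,
      ← LabCtx.eq_pt (Ctx.split (LabCtx.toCtx L₁) (Ctx.split [] g).2).2]
    exact ⟨rfl, Circs.of_cast _ _ _⟩
  | sub | ex => exact hd.elim

theorem exists_of_force {d : CTyp α Γ (.force V) A e} (hd : d.IsHead) :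
    ∃ d' : VTyp α Γ V (.bang A e), ∀ g, (d.interp g).1 = (d'.interp g PUnit.unit).1 ∧
      Eff.of (d.interp g).2.1 = Eff.of (d'.interp g PUnit.unit).2.1 := by
  cases d with
  | force _ d => exact ⟨d, fun _ => ⟨rfl, Circs.of_cast _ _ _⟩⟩
  | sub | ex => exact hd.elim

theorem exists_of_box {T : Bundle W} {d : CTyp α Γ (.box T V) A e} (hd : d.IsHead) :
    ∃ (U : Bundle W) (e' : Eff E) (d' : VTyp α Γ V (.arrow T.toTy U.toTy .unit e')),
      Γ.IsParam ∧ A = .circ T U e' ∧ ∀ g, HEq (d.interp g).1 (boxMap T U e' (d'.interp g)) ∧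
      Eff.of (d.interp g).2.1 = Eff.of (𝟙 (unit : M)) := by
  cases d with
  | box hΦ d => exact ⟨_, _, d, hΦ, rfl, fun _ => ⟨HEq.rfl, Circs.of_cast _ _ _⟩⟩
  | sub | ex => exact hd.elim

theorem exists_of_apply {d : CTyp α L.toCtx (.apply V V') A e} (hd : d.IsHead) :
    ∃ (L₁ L₂ : LabCtx W) (T U : Bundle W) (d₁ : VTyp α L₁.toCtx V (.circ T U e))
      (_ : VTyp α L₂.toCtx V' T.toTy), L = L₁ ++ L₂ ∧ A = U.toTy ∧
      Eff.of (d.interp L.pt).2.1 = Eff.of (d₁.interp L₁.pt).1 := by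
  generalize LabCtx.pt (ob := ob) (α := α) L = g
  generalize hL : (L.toCtx : Ctx W E) = Γ at d g
  cases d with
  | apply hΦ d₁ d₂ =>
    obtain ⟨rfl, L₁, L₂, rfl, rfl, rfl⟩ := hΦ.exists_of_toCtx_eq hL
    refine ⟨L₁, L₂, _, _, d₁, d₂, rfl, rfl, ?_⟩
    rw [← LabCtx.eq_pt (Ctx.split (LabCtx.toCtx L₁) (Ctx.split [] g).2).1]
    exact Circs.of_cast _ _ _
  | sub | ex => exact hd.elim

theorem exists_of_dest {d : CTyp α L.toCtx (.dest V N) A e} (hd : d.IsHead) :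
    ∃ (L₁ L₂ : LabCtx W) (B B' : Ty W E) (x y : ℕ) (d₁ : VTyp α L₁.toCtx V (.tensor B B'))
      (d₂ : CTyp α (L₂.toCtx ++ [.var x B, .var y B']) ((N.inst 1 (.fvar x)).inst 0 (.fvar y)) A e),
      L = L₂ ++ L₁ ∧ x ≠ y ∧ x ∉ N.fv ∧ y ∉ N.fv ∧
      let b := d₁.interp L₁.pt
      let r := d₂.interp (Ctx.join (Δ := [.var x B, .var y B']) L₂.pt (b.1, b.2, PUnit.unit))
      (d.interp L.pt).1 = r.1 ∧ Eff.of (d.interp L.pt).2.1 = Eff.of r.2.1 := by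
  generalize LabCtx.pt (ob := ob) (α := α) L = g
  generalize hL : (L.toCtx : Ctx W E) = Γ at d g
  cases d with
  | dest x y hΦ hxy _ _ hxN hyN d₁ d₂ =>
    obtain ⟨rfl, L₂, L₁, rfl, rfl, rfl⟩ := hΦ.exists_of_toCtx_eq hL
    refine ⟨L₁, L₂, _, _, x, y, d₁, d₂, rfl, hxy, hxN, hyN, ?_⟩
    rw [← LabCtx.eq_pt (Ctx.split (LabCtx.toCtx L₂) (Ctx.split [] g).2).1,
      ← LabCtx.eq_pt (Ctx.split (LabCtx.toCtx L₂) (Ctx.split [] g).2).2]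
    exact ⟨rfl, Circs.of_cast _ _ _⟩
  | sub | ex => exact hd.elim

theorem exists_of_ifz {n : ℕ} {d : CTyp α Γ (.ifz (.nat n) N N') A e} (hd : d.IsHead) :
    ∃ (d₁ : CTyp α Γ N A e) (d₂ : CTyp α Γ N' A e), ∀ g,
      d.interp g = if n = 0 then d₁.interp g else d₂.interp g := by
  cases d with
  | ifz _ d d₁ d₂ =>
    refine ⟨d₁, d₂, fun g => ?_⟩
    cases d
    cases n <;> rfl
  | sub | ex => exact hd.elim

theorem exists_of_ret {d : CTyp α Γ (.ret V) A e} (hd : d.IsHead) :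
    ∃ d' : VTyp α Γ V A, ∀ g, (d.interp g).1 = d'.interp g ∧
      Eff.of (d.interp g).2.1 = Eff.of (𝟙 (A.obj ob)) := by
  cases d with
  | ret d => exact ⟨d, fun _ => ⟨rfl, Circs.of_cast _ _ _⟩⟩
  | sub | ex => exact hd.elim

theorem exists_of_lett {d : CTyp α L.toCtx (.lett N N') A e} (hd : d.IsHead) :
    ∃ (L₁ L₂ : LabCtx W) (B : Ty W E) (e₁ e₂ : Eff E) (x : ℕ) (d₁ : CTyp α L₁.toCtx N B e₁)
      (d₂ : CTyp α (L₂.toCtx ++ [.var x B]) (N'.inst 0 (.fvar x)) A e₂), L = L₂ ++ L₁ ∧ x ∉ N'.fv ∧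
      let r := d₁.interp L₁.pt
      let r' := d₂.interp (Ctx.join (Δ := [.var x B]) L₂.pt (r.1, PUnit.unit))
      (d.interp L.pt).1 = r'.1 ∧
        Eff.of (d.interp L.pt).2.1 = (Eff.of r.2.1).lwhisk (L₂.obj ob) ⋆ Eff.of r'.2.1 := by
  generalize LabCtx.pt (ob := ob) (α := α) L = g
  generalize hL : (L.toCtx : Ctx W E) = Γ at d g
  cases d with
  | lett x hΦ _ hxN d₁ d₂ =>
    obtain ⟨rfl, L₂, L₁, rfl, rfl, rfl⟩ := hΦ.exists_of_toCtx_eq hL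
    refine ⟨L₁, L₂, _, _, _, x, d₁, d₂, rfl, hxN, ?_⟩
    rw [← LabCtx.eq_pt (Ctx.split (LabCtx.toCtx L₂) (Ctx.split [] g).2).1,
      ← LabCtx.eq_pt (Ctx.split (LabCtx.toCtx L₂) (Ctx.split [] g).2).2]
    refine ⟨rfl, (Circs.of_cast _ _ _).trans ?_⟩
    rw [Circs.of_comp, Circs.of_cast, ← LabCtx.toCtx_obj (E := E)]
    rfl
  | sub | ex => exact hd.elim

end IsHead

variable {N : Tm ob E} {A : Ty W E} {e : Eff E}

/-- Up to a permutation of its labels `L`, the derivation `d` is interpreted at `g` like a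
derivation of the same judgment whose last rule is neither subsumption nor exchange. The effect of
the latter is not recorded: it is recovered from the circuits that occur in the interpretations. -/
def HasHead {Γ : Ctx W E} (d : CTyp α Γ N A e) (g : Γ.flat ob α) (L : LabCtx W) : Prop :=
  ∃ (L₀ : LabCtx W) (q : Eff M) (e₀ : Eff E) (d₀ : CTyp α L₀.toCtx N A e₀), d₀.IsHead ∧
    PermEff (fun a : ℕ × W => ob a.2) L L₀ q ∧ (d.interp g).1 = (d₀.interp L₀.pt).1 ∧
    Eff.of (d.interp g).2.1 = q ⋆ Eff.of (d₀.interp L₀.pt).2.1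

theorem IsHead.hasHead {Γ : Ctx W E} {d : CTyp α Γ N A e} (hd : d.IsHead) (g : Γ.flat ob α)
    (L : LabCtx W) (hL : L.toCtx = Γ) : d.HasHead g L := by
  subst hL
  rw [LabCtx.eq_pt g]
  exact ⟨L, _, e, d, hd, .refl L, rfl, (Eff.id_comp (LabCtx.toCtx_obj ob L).symm).symm⟩

theorem HasHead.ex {Γ₁ Γ₂ : Ctx W E} {a b : Entry W E} {d : CTyp α (Γ₁ ++ a :: b :: Γ₂) N A e}
    {g : Ctx.flat ob α (Γ₁ ++ b :: a :: Γ₂)} {L : LabCtx W} (hL : L.toCtx = Γ₁ ++ b :: a :: Γ₂)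
    (ih : ∀ L : LabCtx W, L.toCtx = Γ₁ ++ a :: b :: Γ₂ → d.HasHead (Ctx.swapFlat Γ₁ g) L)
    (h : α.obj (Ctx.obj ob (Γ₁ ++ a :: b :: Γ₂)) = e.dom) : (CTyp.ex d h).HasHead g L := by
  obtain ⟨L₁, L₂, l, m, rfl, rfl, rfl, rfl, rfl⟩ :=
    LabCtx.exists_of_toCtx_eq_append_cons_cons hL
  obtain ⟨L₀, q, e₀, d₀, hd₀, hq, hval, heff⟩ := ih (L₁ ++ m :: l :: L₂) (LabCtx.toCtx_append _ _)
  refine ⟨L₀, _, e₀, d₀, hd₀, (PermEff.swap L₁ l m L₂).trans hq, hval, ?_⟩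
  have hswap := Eff.of_comp
    (swapHom (fun c : Entry W E => c.ty.obj ob) L₁.toCtx (.lab l.1 l.2) (.lab m.1 m.2) L₂.toCtx)
    (d.interp (Ctx.swapFlat L₁.toCtx g)).2.1
  rw [Eff.comp_assoc, ← heff, ← LabCtx.of_swapHom_toCtx (E := E)]
  · exact hswap
  · rw [hq.dom_eq, swapEff_cod]

theorem hasHead : {Γ : Ctx W E} → {N : Tm ob E} → {A : Ty W E} → {e : Eff E} →
    (d : CTyp α Γ N A e) → (g : Γ.flat ob α) → (L : LabCtx W) → L.toCtx = Γ → d.HasHead g L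
  | _, _, _, _, .sub d _, g, L, hL => d.hasHead g L hL
  | _, _, _, _, .ex d h, _, _, hL => HasHead.ex hL (d.hasHead _) h
  | _, _, _, _, .app .., g, L, hL | _, _, _, _, .force .., g, L, hL
  | _, _, _, _, .box .., g, L, hL | _, _, _, _, .apply .., g, L, hL
  | _, _, _, _, .dest .., g, L, hL | _, _, _, _, .ifz .., g, L, hL
  | _, _, _, _, .ret .., g, L, hL | _, _, _, _, .lett .., g, L, hL =>
    IsHead.hasHead (by trivial) g L hL

end CTyp

end Inversion

/-! ### Soundness -/

section CircuitIdentities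

variable {C : Type u} [Category.{v} C] [StrictSymPremonoidal C]

theorem Eff.lwhisk_eq_braid_comp_rwhisk_comp_braid (X : C) (e : Eff C) :
    e.lwhisk X = braid X e.dom ⋆ (e.rwhisk X ⋆ braid e.cod X) := by
  rw [rwhisk_comp_braid, ← comp_assoc (by simp), braid_comp_braid, id_comp (by simp)]

theorem Eff.lwhisk_comp_rwhisk {e d : Eff C} {X : C} (hd : (e.lwhisk X).cod = d.dom) (Z : C) :
    (e.lwhisk X ⋆ d).rwhisk Z = (braid X e.dom).rwhisk Z ⋆ e.rwhisk (X ⊗ₚ Z) ⋆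
      ((braid e.cod X).rwhisk Z ⋆ d.rwhisk Z) := by
  have hbraid : (e.rwhisk X).cod = (braid e.cod X).dom := rfl
  rw [rwhisk_comp Z hd, lwhisk_eq_braid_comp_rwhisk_comp_braid, rwhisk_comp Z (by simp),
    rwhisk_comp Z hbraid, rwhisk_tensor, comp_assoc (by simp [tensor_assoc]), comp_assoc (by simp),
    comp_assoc (by simp [tensor_assoc])]

theorem Eff.comp_comp_lwhisk_comp_rwhisk {c p e d c' p' : Eff C} {X Y Y' Z : C}
    (hY : e.dom = Y) (hY' : e.cod = Y') (hcp : c.cod = p.dom) (hp : p.cod = (X ⊗ₚ Y) ⊗ₚ Z)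
    (hd : (e.lwhisk X).cod = d.dom) (hcp' : c'.cod = p'.dom) (hp' : p'.cod = Y' ⊗ₚ X ⊗ₚ Z)
    (h : c ⋆ (p ⋆ (braid X Y).rwhisk Z ⋆ e.rwhisk (X ⊗ₚ Z)) = c' ⋆ p') :
    c ⋆ (p ⋆ (e.lwhisk X ⋆ d).rwhisk Z) = c' ⋆ (p' ⋆ (braid Y' X).rwhisk Z ⋆ d.rwhisk Z) := by
  subst hY hY'
  have hbraid : p.cod = ((braid X e.dom).rwhisk Z).dom := hp
  have hbraid' : p'.cod = ((braid e.cod X).rwhisk Z).dom := by simp [hp', tensor_assoc]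
  calc c ⋆ (p ⋆ (e.lwhisk X ⋆ d).rwhisk Z)
      = c ⋆ (p ⋆ (braid X e.dom).rwhisk Z ⋆ e.rwhisk (X ⊗ₚ Z)) ⋆
          ((braid e.cod X).rwhisk Z ⋆ d.rwhisk Z) := by
        rw [lwhisk_comp_rwhisk hd, comp_assoc hbraid, comp_assoc (e := c) (by simpa using hcp),
          comp_assoc (e := p) (by simpa using hbraid)]
    _ = c' ⋆ (p' ⋆ (braid e.cod X).rwhisk Z ⋆ d.rwhisk Z) := by
        rw [h, comp_assoc hcp', comp_assoc hbraid']

/-- Circuits need not commute with one another, but they commute with the permutation `r` of the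
wires on which they do not act. -/
theorem PermEff.comp_rwhisk_comp {X : Type w} {f : X → C} {l l' : List X} {p P q e q' r : Eff C}
    (hr : PermEff f l l' r) (hqe : q.cod = e.dom) (heq : e.cod = q'.dom)
    (hP : P.cod = q.dom ⊗ₚ listObj f l') (hp : p.cod = e.dom ⊗ₚ listObj f l)
    (h : P ⋆ q.rwhisk (listObj f l') = p ⋆ r.lwhisk e.dom) :
    P ⋆ (q ⋆ e ⋆ q').rwhisk (listObj f l') =
      p ⋆ e.rwhisk (listObj f l) ⋆ (q'.rwhisk (listObj f l) ⋆ r.lwhisk q'.cod) := by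
  have hc := hr.lwhisk_comp_rwhisk (e ⋆ q')
  rw [Eff.comp_dom, Eff.comp_cod heq] at hc
  calc P ⋆ (q ⋆ e ⋆ q').rwhisk (listObj f l')
      = P ⋆ q.rwhisk (listObj f l') ⋆ (e ⋆ q').rwhisk (listObj f l') := by
        rw [Eff.comp_assoc hqe, Eff.rwhisk_comp _ (by simpa using hqe), Eff.comp_assoc (by simpa)]
    _ = p ⋆ ((e ⋆ q').rwhisk (listObj f l) ⋆ r.lwhisk q'.cod) := by
        rw [h, Eff.comp_assoc (by simpa [hr.dom_eq] using hp), hc]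
    _ = p ⋆ e.rwhisk (listObj f l) ⋆ (q'.rwhisk (listObj f l) ⋆ r.lwhisk q'.cod) := by
        rw [Eff.rwhisk_comp _ heq, Eff.comp_assoc (by simp [heq]), Eff.comp_assoc hp]

end CircuitIdentities

section LabelledCircuits

variable {W : Type w} {M : Type u} [Category.{v} M] [StrictSymPremonoidal M] {ob : W → M}

theorem LCirc.of_hom_append (C D : LCirc ob) (ρ σ : ℕ → ℕ) (R : LabCtx W)
    (p : C.cod.obj ob ⟶ LabCtx.obj ob (D.dom.relabel ρ ++ R))
    (h : LabCtx.Distinct (D.cod.relabel σ ++ R)) :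
    Eff.of (LCirc.append ob C D ρ σ R p h).hom =
      Eff.of C.hom ⋆ (Eff.of p ⋆ (Eff.of D.hom).rwhisk (R.obj ob)) := by
  rw [append, Eff.of_comp, Eff.of_comp, Eff.of_eqToHom_comp, Eff.of_comp_eqToHom, Eff.of_rw]

theorem PermEff.relabel {L L' : LabCtx W} {P : Eff M}
    (h : PermEff (fun a : ℕ × W => ob a.2) L L' P) (ρ : ℕ → ℕ) :
    PermEff (fun a : ℕ × W => ob a.2) (L.relabel ρ) (L'.relabel ρ) P :=
  h.map (g := fun a : ℕ × W => (ρ a.1, a.2)) fun _ => rfl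

theorem Eval.dom_eq {E : Type u'} [Category.{v'} E] {C C' : LCirc ob} {N : Tm ob E}
    {V : Val ob E} (h : Eval C N C' V) : C.dom = C'.dom := by
  induction h with
  | app _ ih | force _ ih | dest _ ih | ifz_zero _ ih | ifz_succ _ ih => exact ih
  | lett _ _ ih ih' => exact ih.trans ih'
  | ret | box | apply => rfl

end LabelledCircuits

section Soundness

variable {W : Type w} {E : Type u'} [Category.{v'} E] [CircuitAlgebra E]
  {M : Type u} [Category.{v} M] [StrictSymPremonoidal M] {ob : W → M} {α : Abstraction M E}

theorem Bounded.of_eff_eq {X Y X' Y' : M} {C : X ⟶ Y} {C' : X' ⟶ Y'} {e : Eff E}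
    (h : Bounded α C e) (hC : Eff.of C = Eff.of C') : Bounded α C' e := by
  cases hC; exact h

/-- Up to a permutation of the outputs of `C`, these consist of the labels of the closed value `V`
and of `Q'`, the value `V` denotes `a`, and the circuit is `c`. -/
def Denotes (C : LCirc ob) (V : Val ob E) (Q' : LabCtx W) {A : Ty W E} (a : A.flat ob α)
    (c : Eff M) : Prop :=
  ∃ (L : LabCtx W) (P : Eff M) (d : VTyp α L.toCtx V A),
    PermEff (fun a : ℕ × W => ob a.2) C.cod (L ++ Q') P ∧ a = d.interp L.pt ∧
      c = Eff.of C.hom ⋆ P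

variable (α) in
/-- The circuit `C`, followed by any closed derivation for `N`, denotes the same as the circuit `C'`
with the value `V`. -/
def Sound (C : LCirc ob) (N : Tm ob E) (C' : LCirc ob) (V : Val ob E) : Prop :=
  ∀ (L Q' : LabCtx W) (P : Eff M) (A : Ty W E) (e : Eff E),
    PermEff (fun a : ℕ × W => ob a.2) C.cod (L ++ Q') P → ∀ d : CTyp α L.toCtx N A e,
    Denotes C' V Q' (d.interp L.pt).1
      (Eff.of C.hom ⋆ (P ⋆ (Eff.of (d.interp L.pt).2.1).rwhisk (Q'.obj ob)))

theorem VTyp.exists_app_bundle {V : Val ob E} {T : Bundle W} {B : Ty W E} {e : Eff E}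
    {Q : LabCtx W} {b : WBundle} (d : VTyp α (LabCtx.toCtx []) V (.arrow T.toTy B .unit e))
    (hb : WBundle.HasType Q b T) :
    ∃ t : CTyp α Q.toCtx (.app V b.toVal) B e,
      Eff.of (t.interp Q.pt).2.1 = Eff.of (d.interp (LabCtx.pt []) (T.pt ob α)).2.1 := by
  obtain ⟨v⟩ := hb.nonempty_vtyp (α := α) (ob := ob) (E := E)
  refine ⟨.app (Φ := []) (Γ₁ := []) (List.forall_mem_nil _) d v, (Circs.of_cast _ _ _).trans ?_⟩
  rw [T.flat_subsingleton.elim (T.pt ob α)]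
  rfl

namespace Sound

variable {C C' : LCirc ob} {N N' : Tm ob E} {U U' V : Val ob E}

theorem of_isHead
    (h : ∀ (L Q' : LabCtx W) (P : Eff M) (A : Ty W E) (e : Eff E),
      PermEff (fun a : ℕ × W => ob a.2) C.cod (L ++ Q') P → ∀ d : CTyp α L.toCtx N A e, d.IsHead →
      Denotes C' V Q' (d.interp L.pt).1
        (Eff.of C.hom ⋆ (P ⋆ (Eff.of (d.interp L.pt).2.1).rwhisk (Q'.obj ob)))) :
    Sound α C N C' V := by
  intro L Q' P A e hP d
  obtain ⟨L₀, q, e₀, d₀, hd₀, hq, hval, heff⟩ := d.hasHead L.pt L rfl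
  have hqd : q.cod = (Eff.of (d₀.interp L₀.pt).2.1).dom :=
    hq.cod_eq.trans (LabCtx.toCtx_obj ob L₀).symm
  have hPq : P.cod = (q.rwhisk (Q'.obj ob)).dom := by
    rw [hP.cod_eq, Eff.rwhisk_dom, hq.dom_eq, listObj_append]
  rw [hval, heff, Eff.rwhisk_comp _ hqd, ← Eff.comp_assoc hPq]
  exact h L₀ Q' _ A e₀ (hP.trans (hq.append_right Q')) d₀ hd₀

theorem app {B : Ty W E} (h : Sound α C (N.inst 0 U) C' V) :
    Sound α C (.app (.lam B N) U) C' V := by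
  refine .of_isHead fun L Q' P A e hP d hd => ?_
  obtain ⟨L₁, L₂, B, T, d₁, d₂, rfl, hval, heff⟩ := hd.exists_of_app
  cases d₁.eq_of_lam
  obtain ⟨x, d', hx, hd'⟩ := d₁.exists_of_lam
  obtain ⟨t, htval, hteff⟩ := d'.exists_subst_toCtx d₂ hx
  obtain ⟨hval', heff'⟩ := hd' L₁.pt (d₂.interp L₂.pt)
  rw [hval, hval', ← htval, heff, heff', ← hteff]
  exact h _ Q' P A e hP t

theorem force (h : Sound α C N C' V) : Sound α C (.force (.lift N)) C' V := by
  refine .of_isHead fun L Q' P A e hP d hd => ?_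
  obtain ⟨d', hd'⟩ := hd.exists_of_force
  obtain ⟨t, ht⟩ := d'.exists_of_lift
  rw [(hd' _).1, (ht _).1, (hd' _).2, (ht _).2]
  exact h L Q' P A e hP t

theorem dest (h : Sound α C ((N.inst 1 U).inst 0 U') C' V) :
    Sound α C (.dest (.pair U U') N) C' V := by
  refine .of_isHead fun L Q' P A e hP d hd => ?_
  obtain ⟨L₁, L₂, B, B', x, y, d₁, d₂, rfl, hxy, hx, hy, hval, heff⟩ := hd.exists_of_dest
  obtain ⟨L₃, L₄, d₃, d₄, rfl, hpair⟩ := d₁.exists_of_pair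
  obtain ⟨t, htval, hteff⟩ := d₂.exists_subst_subst_toCtx d₃ d₄ hxy hx hy
  rw [hpair] at hval heff
  rw [hval, heff]
  exact htval ▸ hteff ▸ h _ Q' P A e hP t

theorem ifz_zero (h : Sound α C N C' V) : Sound α C (.ifz (.nat 0) N N') C' V := by
  refine .of_isHead fun L Q' P A e hP d hd => ?_
  obtain ⟨d₁, d₂, hd'⟩ := hd.exists_of_ifz
  rw [hd', if_pos rfl]
  exact h L Q' P A e hP d₁

theorem ifz_succ {n : ℕ} (h : Sound α C N' C' V) : Sound α C (.ifz (.nat (n + 1)) N N') C' V := by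
  refine .of_isHead fun L Q' P A e hP d hd => ?_
  obtain ⟨d₁, d₂, hd'⟩ := hd.exists_of_ifz
  rw [hd', if_neg (Nat.succ_ne_zero _)]
  exact h L Q' P A e hP d₂

theorem ret : Sound α C (.ret V) C V := by
  refine .of_isHead fun L Q' P A e hP d hd => ?_
  obtain ⟨d', hd'⟩ := hd.exists_of_ret
  refine ⟨L, P, d', hP, (hd' _).1, ?_⟩
  rw [(hd' _).2, Eff.rwhisk_id, Eff.comp_id]

theorem lett {C'' : LCirc ob} (h : Sound α C N C' U) (h' : Sound α C' (N'.inst 0 U) C'' V) :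
    Sound α C (.lett N N') C'' V := by
  refine .of_isHead fun L Q' P A e hP d hd => ?_
  obtain ⟨L₁, L₂, B, e₁, e₂, x, d₁, d₂, rfl, hx, hval, heff⟩ := hd.exists_of_lett
  have hP₁ := (hP.trans ((PermEff.block L₂ L₁).append_right Q')).congr rfl
    (List.append_assoc L₁ L₂ Q') rfl
  obtain ⟨L₁', P₁', u, hP₁', hu, hc⟩ := h L₁ (L₂ ++ Q') _ B e₁ hP₁ d₁
  have hP₂ := (hP₁'.congr rfl (List.append_assoc L₁' L₂ Q').symm rfl).trans
    ((PermEff.block L₁' L₂).append_right Q')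
  obtain ⟨t, htval, hteff⟩ := d₂.exists_subst_toCtx u hx
  rw [← hu] at htval hteff
  have hB : B.obj ob = listObj (fun a : ℕ × W => ob a.2) L₁' :=
    u.obj_eq.symm.trans (LabCtx.toCtx_obj ob L₁')
  have hd : ((Eff.of (d₁.interp L₁.pt).2.1).lwhisk (L₂.obj ob)).cod =
      (Eff.of (t.interp (LabCtx.pt (L₂ ++ L₁'))).2.1).dom :=
    ((congrArg _ hB).trans (listObj_append _ _ _).symm).trans (LabCtx.toCtx_obj ob _).symm
  have hPcod := hP.cod_eq
  have hP₁'cod := hP₁'.cod_eq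
  rw [listObj_append, listObj_append] at hPcod hP₁'cod
  rw [show LabCtx.obj ob (L₂ ++ Q') = L₂.obj ob ⊗ₚ Q'.obj ob from listObj_append _ _ _] at hc
  rw [hval, heff, ← htval, ← hteff, Eff.comp_comp_lwhisk_comp_rwhisk (LabCtx.toCtx_obj ob L₁) hB
    hP.dom_eq.symm hPcod hd hP₁'.dom_eq.symm hP₁'cod hc]
  exact h' (L₂ ++ L₁') Q' _ A e₂ hP₂ t

theorem exists_boxed {D : LCirc ob} {T U : Bundle W} {Q : LabCtx W} {b c : WBundle} {e : Eff E}
    {hQ : Q.Distinct} (h : Sound α (LCirc.id ob Q hQ) (.app V b.toVal) D c.toVal)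
    (hb : WBundle.HasType Q b T) (hD : Q = D.dom)
    (d : VTyp α (LabCtx.toCtx []) V (.arrow T.toTy U.toTy .unit e)) :
    ∃ v : VTyp α (LabCtx.toCtx []) (.boxed b D c) (.circ T U e),
      Eff.of (v.interp (LabCtx.pt [])).1 =
        Eff.of (d.interp (LabCtx.pt []) (T.pt ob α)).2.1 := by
  obtain ⟨t, ht⟩ := d.exists_app_bundle hb
  obtain ⟨L, P, v, hP, -, hc⟩ := h Q [] _ U.toTy e (.of_eq (List.append_nil Q).symm rfl) t
  obtain ⟨q, hq, rfl⟩ := permEff_iff.1 (hP.congr rfl (List.append_nil L) rfl)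
  obtain ⟨p, hp, hp'⟩ := permEff_iff.1
    (PermEff.of_eq (f := fun a : ℕ × W => ob a.2) hD (rfl : Q.obj ob = _))
  have hcirc : Eff.of (t.interp Q.pt).2.1 = Eff.of (p ≫ D.hom ≫ q) := by
    have hdom : Q.obj ob = (Eff.of (t.interp Q.pt).2.1).dom := (LabCtx.toCtx_obj ob Q).symm
    calc Eff.of (t.interp Q.pt).2.1
        = Eff.of (𝟙 (Q.obj ob)) ⋆ (Eff.of (𝟙 (Q.obj ob)) ⋆
            (Eff.of (t.interp Q.pt).2.1).rwhisk unit) := by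
          rw [Eff.rwhisk_unit, Eff.id_comp hdom, Eff.id_comp hdom]
      _ = Eff.of D.hom ⋆ Eff.of q := hc
      _ = Eff.of (p ≫ D.hom ≫ q) := by
          rw [Eff.of_comp, Eff.of_comp, hp', Eff.id_comp (by rw [Eff.comp_dom, hD])]
  refine ⟨.circ p q (List.forall_mem_nil _) hp hq hb (v.hasType rfl)
    ((t.interp Q.pt).2.2.of_eff_eq hcirc), ?_⟩
  rw [← ht, hcirc]
  exact Circs.of_cast _ _ _

theorem box {D : LCirc ob} {T : Bundle W} {Q : LabCtx W} {b c : WBundle} (hQ : Q.Distinct)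
    (hb : WBundle.HasType Q b T) (hD : Q = D.dom)
    (h : Sound α (LCirc.id ob Q hQ) (.app V b.toVal) D c.toVal) :
    Sound α C (.box T V) C (.boxed b D c) := by
  refine .of_isHead fun L Q' P A e hP d hd => ?_
  obtain ⟨U, e', d', hL, rfl, hd'⟩ := hd.exists_of_box
  obtain rfl := LabCtx.eq_nil_of_isParam hL
  obtain ⟨hval, heff⟩ := hd' (LabCtx.pt [])
  obtain ⟨v, hv⟩ := h.exists_boxed hb hD d'
  refine ⟨[], P, v, hP, (eq_of_heq hval).trans (Circs.ext_of ?_), ?_⟩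
  · exact (Circs.of_cast _ _ _).trans hv.symm
  · rw [heff, Eff.rwhisk_id, Eff.comp_id]

theorem apply {D : LCirc ob} {b c : WBundle} {ρ σ : ℕ → ℕ} {R : LabCtx W}
    {p : C.cod.obj ob ⟶ LabCtx.obj ob (D.dom.relabel ρ ++ R)}
    (h : LabCtx.Distinct (D.cod.relabel σ ++ R))
    (hp : IsPerm (fun a : ℕ × W => ob a.2) C.cod (D.dom.relabel ρ ++ R) p) :
    Sound α C (.apply (.boxed b D c) (b.relabel ρ).toVal)
      (LCirc.append ob C D ρ σ R p h) (c.relabel σ).toVal := by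
  refine .of_isHead fun L Q' P B e hP d hd => ?_
  obtain ⟨L₁, L₂, T, U, d₁, d₂, rfl, rfl, heff⟩ := hd.exists_of_apply
  obtain ⟨Q, L', q, q', hL₁, hq, hq', hb, hc, hd₁⟩ := d₁.exists_of_boxed
  obtain rfl := LabCtx.eq_nil_of_isParam hL₁
  obtain rfl := (d₂.hasType rfl).unique (hb.relabel ρ)
  obtain ⟨v⟩ := (hc.relabel σ).nonempty_vtyp (α := α) (ob := ob) (E := E)
  have hqρ := hq.relabel ρ
  have hq'σ := hq'.relabel σ
  have hR : R.Perm Q' := (List.perm_append_left_iff _).1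
    (hp.permEff.perm.symm.trans (hP.perm.trans (hqρ.perm.append_right Q')))
  obtain ⟨r, hr⟩ := PermEff.exists_of_perm (f := fun a : ℕ × W => ob a.2) hR
  have hperm := (hP.trans (hqρ.append_right Q')).unique (List.Nodup.of_map _ C.cod_distinct)
    (hp.permEff.trans (hr.append_left _))
  refine ⟨L'.relabel σ, _, v, (hq'σ.append_right R).trans (hr.append_left _),
    U.flat_subsingleton.elim _ _, ?_⟩
  have hX : listObj (fun a : ℕ × W => ob a.2) (D.dom.relabel ρ) = (Eff.of D.hom).dom :=
    D.dom.relabel_obj ob ρ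
  have hY : listObj (fun a : ℕ × W => ob a.2) (L'.relabel σ) = q'.cod :=
    (L'.relabel_obj ob σ).trans hq'.cod_eq.symm
  rw [hX] at hperm
  rw [hY, heff, hd₁, LCirc.of_hom_append]
  have hcp : (Eff.of C.hom).cod = (Eff.of p ⋆ (Eff.of D.hom).rwhisk (R.obj ob)).dom := by
    rw [Eff.comp_dom]
  have hPcod : P.cod = q.dom ⊗ₚ listObj (fun a : ℕ × W => ob a.2) Q' := by
    rw [hP.cod_eq, listObj_append, hqρ.dom_eq]
    rfl
  rw [Eff.comp_assoc hcp]
  refine congrArg _ (hr.comp_rwhisk_comp hq.cod_eq hq'.dom_eq.symm hPcod ?_ hperm)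
  exact (listObj_append _ _ _).trans (congrArg (· ⊗ₚ _) hX)

end Sound

theorem Eval.sound {C C' : LCirc ob} {N : Tm ob E} {V : Val ob E} (h : Eval C N C' V) :
    Sound α C N C' V := by
  induction h with
  | app _ ih => exact ih.app
  | force _ ih => exact ih.force
  | dest _ ih => exact ih.dest
  | ifz_zero _ ih => exact ih.ifz_zero
  | ifz_succ _ ih => exact ih.ifz_succ
  | ret => exact .ret
  | lett _ _ ih ih' => exact ih.lett ih'
  | box hQ hb h ih => exact ih.box hQ hb h.dom_eq
  | apply _ _ _ _ h hp => exact .apply h hp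

theorem ConfTyp.of_circuit {Q Q' : LabCtx W} {C : LCirc ob} {N : Tm ob E} {A : Ty W E} {e : Eff E}
    (d : ConfTyp α Q C N A Q' e) : Eff.of d.circuit = Eff.of C.hom ⋆ Eff.of d.perm := by
  rw [circuit, Eff.of_eqToHom_comp, Eff.of_comp, Eff.of_comp_eqToHom]

theorem ConfVTyp.of_circuit {Q Q' : LabCtx W} {C : LCirc ob} {V : Val ob E} {A : Ty W E}
    (d : ConfVTyp α Q C V A Q') : Eff.of d.circuit = Eff.of C.hom ⋆ Eff.of d.perm := by
  rw [circuit, Eff.of_eqToHom_comp, Eff.of_comp, Eff.of_comp_eqToHom]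

theorem ConfTyp.of_interp {Q Q' : LabCtx W} {C : LCirc ob} {N : Tm ob E} {A : Ty W E} {e : Eff E}
    (d : ConfTyp α Q C N A Q' e) (x : PUnit) : Eff.of (d.interp x).2.1 =
      Eff.of C.hom ⋆ (Eff.of d.perm ⋆ (Eff.of (d.typ.interp d.ctx.pt).2.1).rwhisk (Q'.obj ob)) := by
  refine (Circs.of_comp _ _ d.eff_dom).trans ?_
  rw [← Eff.comp_assoc rfl, ← d.of_circuit]
  rfl

end Soundness

end ProtoQuipperR

theorem mainTheorem3
    {M : Type u} [Category.{v} M] [ProtoQuipperR.StrictSymPremonoidal M]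
    {E : Type u'} [Category.{v'} E] [ProtoQuipperR.CircuitAlgebra E]
    (α : ProtoQuipperR.Abstraction M E)
    {W : Type w} (ob : W → M)
    {Q Q' : ProtoQuipperR.LabCtx W} {C C' : ProtoQuipperR.LCirc ob}
    {N : ProtoQuipperR.Tm ob E} {V : ProtoQuipperR.Val ob E} {A : ProtoQuipperR.Ty W E}
    {t₁ t₂ : E} {e : t₁ ⟶ t₂}
    (d : ProtoQuipperR.ConfTyp α Q C N A Q' ⟨t₁, t₂, e⟩)
    (h : ProtoQuipperR.Eval C N C' V) :
    ∃ (d' : ProtoQuipperR.ConfVTyp α Q C' V A Q') (hle : d'.eff.Le d.eff),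
      d.interp = fun x => (d'.interpJ x).incl hle := by
  obtain ⟨L', P, t', hP, hval, hcirc⟩ := h.sound d.ctx Q' _ A _ d.isPerm.permEff d.typ
  obtain ⟨p, hp, rfl⟩ := ProtoQuipperR.permEff_iff.1 hP
  let d' : ProtoQuipperR.ConfVTyp α Q C' V A Q' := ⟨L', d.dom_eq.trans h.dom_eq, p, hp, t'⟩
  have hc (x : PUnit) : ProtoQuipperR.Eff.of (d.interp x).2.1 =
      ProtoQuipperR.Eff.of d'.circuit :=
    (d.of_interp x).trans (hcirc.trans d'.of_circuit.symm)
  exact ⟨d', (d.interp PUnit.unit).2.2.of_eff_eq (hc _),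
    funext fun x => Prod.ext hval (ProtoQuipperR.Circs.ext_of (hc x))⟩
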